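/- Setting. Let $0\le q<1$, $\tau>0$ and $\beta>1$ be fixed. For integers $n>1$, $p$ with $n^{\beta}\le p$ and a real number $c\ge 0$, let $\mathcal{P}_q(\tau,c)$ be the set of probability distributions of an integrable random vector $X$ in $\mathbb{R}^p$ such that (i) $\mathbb{P}\{|v^{T}(X-\mathbb{E}X)|>t\}\le e^{-t^2/(2\tau)}$ for all $t>0$ and all $v$ with $\|v\|_2=1$ ("$X$ is subgaussian with parameter $\tau$"), and (ii) for every $j$, the $j$th column of the covariance matrix $\Sigma=(\sigma_{ij})$ of $X$ with the diagonal entry $\sigma_{jj}$ removed lies in the weak $\ell_q$ ball $\{\xi\in\mathbb{R}^{p-1}: |\xi|_{(k)}^{q}\le c\,k^{-1},\ k=1,\dots,p-1\}$, where $|\xi|_{(k)}$ is the $k$th largest entry of $\xi$ in magnitude and $0^0=0$. Let $\mathbf{X}_1,\dots,\mathbf{X}_n$ be i.i.d. with a law $\theta\in\mathcal{P}_q(\tau,c)$, $\bar{\mathbf X}=\frac1n\sum_l \mathbf{X}_l$, let $\Sigma^{*}=(\sigma^{*}_{ij})=\frac1n\sum_{l=1}^n(\mathbf{X}_l-\bar{\mathbf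 X})(\mathbf{X}_l-\bar{\mathbf X})^{T}$, and for $\gamma>0$ let $\hat\Sigma=(\hat\sigma_{ij})$ be the thresholding estimator $$\hat\sigma_{ij}=\sigma^{*}_{ij}\cdot 1\Big(|\sigma^{*}_{ij}|\ge\gamma\sqrt{\tfrac{\log p}{n}}\Big).$$ Write $\|\cdot\|$ for the spectral norm and $r_{n,p}(c)=c^{2}\left(\frac{\log p}{n}\right)^{1-q}+\frac{\log p}{n}$. Call constants $\gamma,C_1,\delta>0$ admissible for $\tau$ if for all $n\ge1$, all $p$, all subgaussian distributions on $\mathbb{R}^p$ with parameter $\tau$, all $i,j$ and all $0<t\le\delta$, $\mathbb{P}(|\sigma^{*}_{ij}-\sigma_{ij}|>t)\le C_1\exp(-\frac{8}{\gamma^{2}}nt^{2})$. Theorem. (a) Admissible constants $\gamma,C_1,\delta>0$ depending only on $\tau$ exist. (b) For all admissible $\gamma,C_1,\delta$ there is a constant $C>0$, depending only on $q,\tau,\beta,\gamma,C_1,\delta$, such that for all $n>1$, $p\ge n^{\beta}$ and $c\ge0$ with $\gamma\sqrt{\log p/n}\le\delta$, $$\sup_{\theta\in\mathcal{P}_q(\tau,c)}\mathbb{E}_{\mathbf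 X|\theta}\|\hat\Sigma-\Sigma\|^{2}\le C\,r_{n,p}(c).$$ (c) Consequently, together with the minimax lower bound, for all $M,K>0$ there are constants $c_0,C>0$, depending only on $q,\tau,\beta,M,K$, such that for all $n>1$, $p\ge n^{\beta}$ and $0\le c\le M n^{(1-q)/2}(\log p)^{-(3-q)/2}$ with $\log p\le Kn$, $$c_0\,r_{n,p}(c)\le\inf_{\tilde\Sigma}\sup_{\theta\in\mathcal{P}_q(\tau,c)}\mathbb{E}_{\mathbf X|\theta}\|\tilde\Sigma-\Sigma\|^{2}\le C\,r_{n,p}(c),$$ where the infimum is over all estimators, i.e. measurable functions of $(\mathbf{X}_1,\dots,\mathbf{X}_n)$ with values in $\mathbb{R}^{p\times p}$. -/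

import Mathlib

open MeasureTheory ProbabilityTheory
open scoped ENNReal

namespace SparseCov

/-- The `k`-th largest element in magnitude (`k = 1, …, m`) of the vector `ξ`
with `m` entries. -/
noncomputable def kthLargestAbs {ι : Type*} [Fintype ι] (ξ : ι → ℝ) (k : ℕ) : ℝ :=
  (((Finset.univ : Finset ι).val.map fun i => |ξ i|).sort (· ≥ ·)).getD (k - 1) 0

/-- `x ^ q` for `x ≥ 0`, `q ≥ 0`, with the convention `0 ^ 0 = 0`, under which the weak `ℓ_q`
ball with `q = 0` is defined by counting nonzero entries. -/
noncomputable def sparsePow (x q : ℝ) : ℝ := if x = 0 then 0 else x ^ q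

/-- The weak `ℓ_q` ball of radius `c`. -/
def weakBall (ι : Type*) [Fintype ι] (q c : ℝ) : Set (ι → ℝ) :=
  {ξ | ∀ k : ℕ, 1 ≤ k → k ≤ Fintype.card ι → sparsePow (kthLargestAbs ξ k) q ≤ c * (k : ℝ)⁻¹}

/-- Matrices each of whose columns, with the diagonal entry removed, lies in the weak `ℓ_q` ball
of radius `c`. -/
def sparseClass (p : ℕ) (q c : ℝ) : Set (Matrix (Fin p) (Fin p) ℝ) :=
  {S | ∀ j : Fin p, (fun i : {i : Fin p // i ≠ j} => S i j) ∈ weakBall {i : Fin p // i ≠ j} q c}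

/-- The covariance matrix of a distribution on `ℝ^p`. -/
noncomputable def covMat {p : ℕ} (μ : Measure (EuclideanSpace ℝ (Fin p))) :
    Matrix (Fin p) (Fin p) ℝ :=
  Matrix.of fun i j => covariance (fun x => x i) (fun x => x j) μ

/-- Subgaussian probability distributions with parameter `τ`:
`P (|vᵀ(X - E X)| > t) ≤ exp (-t² / (2τ))` for all `t > 0` and all unit vectors `v`. -/
structure IsSubgaussian {p : ℕ} (μ : Measure (EuclideanSpace ℝ (Fin p))) (τ : ℝ) : Prop where
  isProb : IsProbabilityMeasure μ
  integrable : Integrable (fun x => x) μ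
  tail : ∀ v : EuclideanSpace ℝ (Fin p), ‖v‖ = 1 → ∀ t : ℝ, 0 < t →
    μ.real {x | t < |inner ℝ v (x - ∫ y, y ∂μ)|} ≤ Real.exp (-t ^ 2 / (2 * τ))

/-- Subgaussian distributions with parameter `τ` whose covariance matrix lies in the sparse
class. -/
def distClass (p : ℕ) (q τ c : ℝ) : Set (Measure (EuclideanSpace ℝ (Fin p))) :=
  {μ | IsSubgaussian μ τ ∧ covMat μ ∈ sparseClass p q c}

/-- A sample of `n` observations in `ℝ^p`. -/
abbrev Sample (n p : ℕ) : Type := Fin n → EuclideanSpace ℝ (Fin p)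

/-- The joint law of `n` i.i.d. observations with law `μ`. -/
noncomputable def sampleLaw (n : ℕ) {p : ℕ} (μ : Measure (EuclideanSpace ℝ (Fin p))) :
    Measure (Sample n p) :=
  Measure.pi fun _ => μ

/-- The sample mean. -/
noncomputable def sampleMean {n p : ℕ} (X : Sample n p) : EuclideanSpace ℝ (Fin p) :=
  (n : ℝ)⁻¹ • ∑ l, X l

/-- The (Gaussian) maximum likelihood estimator of the covariance matrix,
`n⁻¹ ∑ (X_l - X̄)(X_l - X̄)ᵀ`. -/
noncomputable def mle {n p : ℕ} (X : Sample n p) : Matrix (Fin p) (Fin p) ℝ :=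
  Matrix.of fun i j => (n : ℝ)⁻¹ * ∑ l, (X l - sampleMean X) i * (X l - sampleMean X) j

/-- The threshold level `γ √(log p / n)`. -/
noncomputable def threshold (n p : ℕ) (γ : ℝ) : ℝ := γ * √(Real.log p / n)

open Classical in
/-- The hard-thresholding estimator. -/
noncomputable def thresholdEstimator (n p : ℕ) (γ : ℝ) (X : Sample n p) :
    Matrix (Fin p) (Fin p) ℝ :=
  Matrix.of fun i j => if threshold n p γ ≤ |mle X i j| then mle X i j else 0

/-- The spectral norm, i.e. the `ℓ₂ → ℓ₂` operator norm. -/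
noncomputable def specNorm {p : ℕ} (A : Matrix (Fin p) (Fin p) ℝ) : ℝ :=
  ‖Matrix.toEuclideanCLM (n := Fin p) (𝕜 := ℝ) A‖

/-- The expected squared spectral norm error of the estimator `T` under the law `μ`. -/
noncomputable def risk {n p : ℕ} (T : Sample n p → Matrix (Fin p) (Fin p) ℝ)
    (μ : Measure (EuclideanSpace ℝ (Fin p))) : ℝ≥0∞ :=
  ∫⁻ X, ENNReal.ofReal (specNorm (T X - covMat μ) ^ 2) ∂(sampleLaw n μ)

/-- The worst-case risk of an estimator over the class of distributions. -/
noncomputable def maxRisk {n p : ℕ} (T : Sample n p → Matrix (Fin p) (Fin p) ℝ)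
    (q τ c : ℝ) : ℝ≥0∞ :=
  ⨆ μ ∈ distClass p q τ c, risk T μ

/-- Estimators are measurable functions of the sample. -/
def IsEstimator {n p : ℕ} (T : Sample n p → Matrix (Fin p) (Fin p) ℝ) : Prop :=
  ∀ i j, Measurable fun X => T X i j

/-- The minimax risk over the class of distributions. -/
noncomputable def minimaxRisk (n p : ℕ) (q τ c : ℝ) : ℝ≥0∞ :=
  ⨅ (T : Sample n p → Matrix (Fin p) (Fin p) ℝ) (_ : IsEstimator T), maxRisk T q τ c

/-- The rate `c² (log p / n)^(1-q) + log p / n`. -/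
noncomputable def rate (n p : ℕ) (q c : ℝ) : ℝ :=
  c ^ 2 * (Real.log p / n) ^ (1 - q) + Real.log p / n

/-- The large deviation inequality for the entries of the maximum likelihood estimator that the
constant `γ` in the threshold has to satisfy, uniformly over sample sizes, dimensions and
subgaussian distributions with parameter `τ`:
`P (|σ*_ij - σ_ij| > t) ≤ C₁ exp (-(8/γ²) n t²)` for `0 < t ≤ δ`. -/
def DeviationBound (τ γ C₁ δ : ℝ) : Prop :=
  ∀ n p : ℕ, 1 ≤ n → ∀ μ : Measure (EuclideanSpace ℝ (Fin p)), IsSubgaussian μ τ →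
    ∀ (i j : Fin p) (t : ℝ), 0 < t → t ≤ δ →
      (sampleLaw n μ).real {X | t < |mle X i j - covMat μ i j|}
        ≤ C₁ * Real.exp (-(8 / γ ^ 2) * n * t ^ 2)

end SparseCov

namespace SparseCov

/-! ### Order statistics and weak balls -/

/-! Upper bound. Let λ be the threshold. Where the sample covariance is within 3λ/4 of σ_ij,
thresholding errs by at most 4 min(|σ_ij|, λ). A weak ℓ_q column has at most c x^(-q) entries above
x, so integrating over 0 < x < λ bounds its sum of min(|σ_ij|, λ) by c λ^(1-q)/(1-q). The Schur test
turns these column sums into a spectral bound whose square is of the order of the rate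
(`sum_min_le_of_mem_weakBall`, `specNorm_le_of_abs_le`). The remaining entries are controlled in
Frobenius norm: each is bad with probability at most C₁ p^(-4), and an eighth moment bound makes all
p² of them contribute O(1/p) (`risk_thresholdEstimator_le`). The deviation inequality is a Chernoff
bound for products of subgaussian coordinates (`exists_deviationBound`). When λ exceeds δ, the rate
is bounded below and the zero estimator is good enough for the minimax statement (`minimaxRisk_le`).

Lower bound. All laws used have finite support, so expectations are finite sums and arbitrary
functions of the sample may serve as estimators. Half of the mass sits at the origin, which absorbs
the factor 2 of a two-sided Chernoff bound and gives exactly the required tail. The tool is a test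
of one law against a uniform mixture, governed by the second moment of the mixture's likelihood
ratio (`card_mul_sq_le_integral_atomLaw`). The term log p / n comes from raising the variance of one
unknown coordinate (`parametric_le_of_maxRisk_le`).

For the sparse term, covariances of size ε ~ √(log p / n) are planted between "row" and "column"
coordinates. Every pair (row, column) owns a latent fair sign. Given the latent signs, each observed
sign is independent with mean Im(z)/2, where z is the product of 1 + iηu over the latent signs u of
its row or column. The modulus of z is deterministic, so these means are admissible, and all mixed
moments are explicit products: a row and a column share one latent sign and have covariance η²/4,
while two rows or two columns are uncorrelated. Rows alone, and columns alone, are independent fair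
signs, which gives subgaussianity. The cross moment of the likelihood ratios for two choices of one
row is at most exp(∑ (ab)²) per observation (`sum_latentWeight_mul_rowRatio_mul_rowRatio_le`). Hence
a row with k entries η² = ε in random positions cannot be detected when exp(nε²) is small against
p/k².

An Assouad argument then averages over which rows are switched on and over families of positions
that keep every column sparse (`card_mul_le_of_maxRisk_le`). The row sums of the cross block are
tested against the indicator of the columns, so an undetected sum of order kε in a typical row costs
(kε)² in squared spectral norm. With k ~ c ε^(-q) this is c² (log p / n)^(1-q); the hypothesis β > 1
leaves a power of p for exp(nε²). -/

theorem lt_getD_iff_of_pairwise_ge {L : List ℝ} (hL : L.Pairwise (· ≥ ·)) {x : ℝ} (hx : 0 ≤ x)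
    (i : ℕ) : x < L.getD i 0 ↔ i < L.countP (fun y => decide (x < y)) := by
  induction L generalizing i with
  | nil => simpa using hx
  | cons a L ih =>
    rw [List.pairwise_cons] at hL
    by_cases hxa : x < a
    · rw [List.countP_cons_of_pos (by simpa using hxa)]
      cases i with
      | zero => simpa using hxa
      | succ i => simpa using ih hL.2 i
    · have hall : ∀ y ∈ a :: L, ¬ x < y := by
        intro y hy
        rcases List.mem_cons.1 hy with rfl | hy
        · exact hxa
        · exact fun h => hxa (h.trans_le (hL.1 y hy))
      have h0 : (a :: L).countP (fun y => decide (x < y)) = 0 := by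
        rw [List.countP_eq_zero]
        intro y hy
        simpa using hall y hy
      rw [h0]
      simp only [not_lt_zero, iff_false]
      by_cases hi : i < (a :: L).length
      · rw [List.getD_eq_getElem _ _ hi]
        exact hall _ (List.getElem_mem hi)
      · rw [List.getD_eq_default _ _ (not_lt.1 hi)]
        exact not_lt.2 hx

theorem lt_kthLargestAbs_iff {ι : Type*} [Fintype ι] (ξ : ι → ℝ) {x : ℝ} (hx : 0 ≤ x) {k : ℕ}
    (hk : 1 ≤ k) :
    x < kthLargestAbs ξ k ↔ k ≤ (Finset.univ.filter fun i => x < |ξ i|).card := by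
  unfold kthLargestAbs
  rw [lt_getD_iff_of_pairwise_ge (Multiset.pairwise_sort _ _) hx]
  have : List.countP (fun y => decide (x < y))
      ((Multiset.map (fun i => |ξ i|) Finset.univ.val).sort (· ≥ ·))
      = (Finset.univ.filter fun i => x < |ξ i|).card := by
    rw [← Multiset.coe_countP, Multiset.sort_eq, Multiset.countP_map]
    rfl
  rw [this]
  omega

/-- If N entries exceed x, then so does the N-th largest, and the weak ball condition at k = N reads
x^q ≤ c/N. -/
theorem card_lt_abs_le_of_mem_weakBall {ι : Type*} [Fintype ι] {ξ : ι → ℝ} {q c : ℝ} (hq : 0 ≤ q)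
    (hc : 0 ≤ c) (hξ : ξ ∈ weakBall ι q c) {x : ℝ} (hx : 0 < x) :
    ((Finset.univ.filter fun i => x < |ξ i|).card : ℝ) ≤ c * x ^ (-q) := by
  set N := (Finset.univ.filter fun i => x < |ξ i|).card with hN
  rcases Nat.eq_zero_or_pos N with h0 | hpos
  · rw [h0]
    have := Real.rpow_nonneg hx.le (-q)
    simpa using mul_nonneg hc this
  · have hk : x < kthLargestAbs ξ N := (lt_kthLargestAbs_iff ξ hx.le hpos).2 le_rfl
    have h1 := hξ N hpos (Finset.card_le_univ _)
    have hk0 : kthLargestAbs ξ N ≠ 0 := (hx.trans hk).ne'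
    rw [sparsePow, if_neg hk0] at h1
    have h2 : x ^ q ≤ c * (N : ℝ)⁻¹ := (Real.rpow_le_rpow hx.le hk.le hq).trans h1
    have hNr : (0 : ℝ) < N := by exact_mod_cast hpos
    have hxq : 0 < x ^ q := Real.rpow_pos_of_pos hx q
    rw [Real.rpow_neg hx.le, ← div_eq_mul_inv, le_div_iff₀ hxq]
    rw [← div_eq_mul_inv, le_div_iff₀ hNr] at h2
    linarith [mul_comm (N : ℝ) (x ^ q)]

/-- Only the first d order statistics can be nonzero, and each is at most b, so the condition at k
follows from the one at d. The convention 0^0 = 0 frees the others even when q = 0. -/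
theorem mem_weakBall_of_card_le {ι : Type*} [Fintype ι] {ξ : ι → ℝ} {q c b : ℝ} {d : ℕ}
    (hq : 0 ≤ q) (hc : 0 ≤ c) (hcard : (Finset.univ.filter fun i => ξ i ≠ 0).card ≤ d)
    (hb : ∀ i, |ξ i| ≤ b) (hdb : b ^ q * d ≤ c) : ξ ∈ weakBall ι q c := by
  intro k hk _
  by_cases h0 : kthLargestAbs ξ k = 0
  · rw [sparsePow, if_pos h0]
    positivity
  rw [sparsePow, if_neg h0]
  have hnn : 0 ≤ kthLargestAbs ξ k := by
    unfold kthLargestAbs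
    rw [List.getD_eq_getElem?_getD]
    by_cases hi : k - 1 < ((Multiset.map (fun i => |ξ i|) Finset.univ.val).sort (· ≥ ·)).length
    · rw [List.getElem?_eq_getElem hi]
      have hm := List.getElem_mem hi
      rw [Multiset.mem_sort, Multiset.mem_map] at hm
      obtain ⟨i, -, hi⟩ := hm
      simp only [Option.getD_some, ← hi]
      exact abs_nonneg _
    · rw [List.getElem?_eq_none (not_lt.1 hi)]
      simp
  have hpos : 0 < kthLargestAbs ξ k := lt_of_le_of_ne hnn (Ne.symm h0)
  have hkd : k ≤ d := by
    refine ((lt_kthLargestAbs_iff ξ le_rfl hk).1 hpos).trans (le_trans (le_of_eq ?_) hcard)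
    congr 1
    ext i
    simp
  have hkr : (0 : ℝ) < k := by exact_mod_cast hk
  have hb0 : 0 ≤ b := by
    by_contra hneg
    have h1 := (lt_kthLargestAbs_iff ξ le_rfl hk).1 hpos
    have h2 : 0 < (Finset.univ.filter fun i => (0 : ℝ) < |ξ i|).card := lt_of_lt_of_le hk h1
    obtain ⟨i, -⟩ := Finset.card_pos.1 h2
    exact hneg ((abs_nonneg _).trans (hb i))
  have hkb : kthLargestAbs ξ k ≤ b := by
    by_contra hlt
    have h1 := (lt_kthLargestAbs_iff ξ hb0 hk).1 (not_le.1 hlt)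
    have h2 : 0 < (Finset.univ.filter fun i => b < |ξ i|).card := lt_of_lt_of_le hk h1
    obtain ⟨i, hi⟩ := Finset.card_pos.1 h2
    simp only [Finset.mem_filter] at hi
    exact absurd (hb i) (not_le.2 hi.2)
  have h1 : kthLargestAbs ξ k ^ q ≤ b ^ q := Real.rpow_le_rpow hnn hkb hq
  rw [← div_eq_mul_inv, le_div_iff₀ hkr]
  have hkd' : (k : ℝ) ≤ d := by exact_mod_cast hkd
  calc kthLargestAbs ξ k ^ q * k ≤ b ^ q * d := by gcongr
    _ ≤ c := hdb

theorem intervalIntegral_indicator_lt {s lam : ℝ} (hs : 0 ≤ s) (hlam : 0 ≤ lam) :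
    min s lam = ∫ x in (0 : ℝ)..lam, if x < s then (1 : ℝ) else 0 := by
  have h : (fun x : ℝ => if x < s then (1 : ℝ) else 0) = (Set.Iio s).indicator (fun _ => (1 : ℝ)) := by
    ext x
    simp [Set.indicator]
  rw [h, intervalIntegral.integral_of_le hlam, integral_indicator measurableSet_Iio,
    Measure.restrict_restrict measurableSet_Iio]
  rcases le_total s lam with hsl | hsl
  · have : Set.Iio s ∩ Set.Ioc 0 lam = Set.Ioo 0 s := by
      ext x
      simp only [Set.mem_inter_iff, Set.mem_Iio, Set.mem_Ioc, Set.mem_Ioo]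
      constructor
      · rintro ⟨h1, h2, h3⟩
        exact ⟨h2, h1⟩
      · rintro ⟨h1, h2⟩
        exact ⟨h2, h1, h2.le.trans hsl⟩
    rw [this, min_eq_left hsl]
    simp [hs]
  · have : (Set.Iio s ∩ Set.Ioc 0 lam : Set ℝ) =ᵐ[volume] Set.Ioo 0 lam := by
      have h2 : Set.Iio s ∩ Set.Ioo 0 lam = Set.Ioo 0 lam := by
        ext x
        simp only [Set.mem_inter_iff, Set.mem_Iio, Set.mem_Ioo]
        constructor
        · rintro ⟨h1, h2⟩
          exact h2
        · rintro h1
          exact ⟨h1.2.trans_le hsl, h1⟩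
      exact ((ae_eq_refl _).inter Ioo_ae_eq_Ioc.symm).trans (Filter.EventuallyEq.of_eq h2)
    rw [Measure.restrict_congr_set this, min_eq_right hsl]
    simp [hlam]

theorem intervalIntegrable_indicator_lt (s a b : ℝ) :
    IntervalIntegrable (fun x : ℝ => if x < s then (1 : ℝ) else 0) volume a b := by
  have h : (fun x : ℝ => if x < s then (1 : ℝ) else 0) = (Set.Iio s).indicator (fun _ => (1 : ℝ)) := by
    ext x
    simp [Set.indicator]
  rw [h, intervalIntegrable_iff]
  exact (integrableOn_const (by simp)).indicator measurableSet_Iio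

/-- Layer cake: the sum is the integral over (0, λ) of the number of entries above x, which is at
most c x^(-q). This is integrable at 0 because q < 1. -/
theorem sum_min_le_of_mem_weakBall {ι : Type*} [Fintype ι] {ξ : ι → ℝ} {q c lam : ℝ} (hq : 0 ≤ q)
    (hq1 : q < 1) (hc : 0 ≤ c) (hlam : 0 ≤ lam) (hξ : ξ ∈ weakBall ι q c) :
    ∑ i, min |ξ i| lam ≤ c * lam ^ (1 - q) / (1 - q) := by
  have h1 : ∑ i, min |ξ i| lam
      = ∫ x in (0 : ℝ)..lam, ∑ i, if x < |ξ i| then (1 : ℝ) else 0 := by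
    rw [intervalIntegral.integral_finsetSum
      (fun i _ => intervalIntegrable_indicator_lt |ξ i| 0 lam)]
    exact Finset.sum_congr rfl fun i _ => intervalIntegral_indicator_lt (abs_nonneg _) hlam
  have h2 : ∫ x in (0 : ℝ)..lam, c * x ^ (-q) = c * lam ^ (1 - q) / (1 - q) := by
    rw [intervalIntegral.integral_const_mul, integral_rpow (Or.inl (by linarith)),
      Real.zero_rpow (by linarith)]
    rw [show -q + 1 = 1 - q by ring]
    ring
  rw [h1, ← h2]
  refine intervalIntegral.integral_mono_on_of_le_Ioo hlam ?_ ?_ ?_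
  · have := IntervalIntegrable.sum Finset.univ
      fun i _ => intervalIntegrable_indicator_lt |ξ i| 0 lam
    rwa [Finset.sum_fn] at this
  · exact (intervalIntegral.intervalIntegrable_rpow' (by linarith)).const_mul c
  · intro x hx
    have := card_lt_abs_le_of_mem_weakBall hq hc hξ hx.1
    rw [Finset.card_filter] at this
    push_cast at this
    exact this

/-! ### The spectral norm -/

variable {p : ℕ}

theorem toEuclideanCLM_apply (A : Matrix (Fin p) (Fin p) ℝ) (x : EuclideanSpace ℝ (Fin p))
    (i : Fin p) : Matrix.toEuclideanCLM (n := Fin p) (𝕜 := ℝ) A x i = ∑ j, A i j * x j := by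
  rw [Matrix.ofLp_toEuclideanCLM]
  rfl

theorem specNorm_nonneg (A : Matrix (Fin p) (Fin p) ℝ) : 0 ≤ specNorm A := norm_nonneg _

theorem specNorm_add_le (A B : Matrix (Fin p) (Fin p) ℝ) :
    specNorm (A + B) ≤ specNorm A + specNorm B := by
  unfold specNorm
  rw [map_add]
  exact norm_add_le _ _

theorem norm_sq_mulVec_le (A : Matrix (Fin p) (Fin p) ℝ) (x : EuclideanSpace ℝ (Fin p)) :
    ∑ i, (∑ j, A i j * x j) ^ 2 ≤ specNorm A ^ 2 * ‖x‖ ^ 2 := by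
  have h := (Matrix.toEuclideanCLM (n := Fin p) (𝕜 := ℝ) A).le_opNorm x
  have h2 : ‖Matrix.toEuclideanCLM (n := Fin p) (𝕜 := ℝ) A x‖ ^ 2 ≤ (specNorm A * ‖x‖) ^ 2 :=
    pow_le_pow_left₀ (norm_nonneg _) h 2
  rw [EuclideanSpace.norm_sq_eq, mul_pow] at h2
  refine le_trans (le_of_eq ?_) h2
  refine Finset.sum_congr rfl fun i _ => ?_
  rw [toEuclideanCLM_apply, Real.norm_eq_abs, sq_abs]

theorem specNorm_le_of_sq {A : Matrix (Fin p) (Fin p) ℝ} {R : ℝ} (hR : 0 ≤ R)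
    (h : ∀ x : EuclideanSpace ℝ (Fin p), ∑ i, (∑ j, A i j * x j) ^ 2 ≤ R ^ 2 * ∑ j, x j ^ 2) :
    specNorm A ≤ R := by
  refine ContinuousLinearMap.opNorm_le_bound _ hR fun x => ?_
  refine le_of_sq_le_sq ?_ (by positivity)
  rw [mul_pow, EuclideanSpace.norm_sq_eq, EuclideanSpace.norm_sq_eq]
  simpa only [toEuclideanCLM_apply, Real.norm_eq_abs, sq_abs] using h x

theorem abs_entry_le_specNorm (A : Matrix (Fin p) (Fin p) ℝ) (i j : Fin p) :
    |A i j| ≤ specNorm A := by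
  have h := norm_sq_mulVec_le A (EuclideanSpace.single j (1 : ℝ))
  simp only [PiLp.norm_single, norm_one, one_pow, mul_one] at h
  have h2 : A i j ^ 2 ≤ specNorm A ^ 2 := by
    refine le_trans ?_ h
    refine le_trans (le_of_eq ?_) (Finset.single_le_sum (f := fun i => (∑ k, A i k *
      (EuclideanSpace.single j (1 : ℝ) : EuclideanSpace ℝ (Fin p)) k) ^ 2)
      (fun i _ => sq_nonneg _) (Finset.mem_univ i))
    simp
  exact abs_le_of_sq_le_sq h2 (specNorm_nonneg A)

/-- Cauchy–Schwarz in each row: the Frobenius norm dominates. It is affordable only for entries that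
are rarely nonzero. -/
theorem specNorm_sq_le_sum_sq (A : Matrix (Fin p) (Fin p) ℝ) :
    specNorm A ^ 2 ≤ ∑ i, ∑ j, A i j ^ 2 := by
  have h0 : 0 ≤ ∑ i, ∑ j, A i j ^ 2 :=
    Finset.sum_nonneg fun i _ => Finset.sum_nonneg fun j _ => sq_nonneg _
  have h : specNorm A ≤ √(∑ i, ∑ j, A i j ^ 2) := by
    refine specNorm_le_of_sq (Real.sqrt_nonneg _) fun x => ?_
    rw [Real.sq_sqrt h0, Finset.sum_mul]
    exact Finset.sum_le_sum fun i _ => Finset.sum_mul_sq_le_sq_mul_sq _ _ _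
  calc specNorm A ^ 2 ≤ √(∑ i, ∑ j, A i j ^ 2) ^ 2 := pow_le_pow_left₀ (specNorm_nonneg A) h 2
    _ = _ := Real.sq_sqrt h0

/-- The Schur test. -/
theorem specNorm_le_of_abs_le {A m : Matrix (Fin p) (Fin p) ℝ} {R : ℝ} (hR : 0 ≤ R)
    (hA : ∀ i j, |A i j| ≤ m i j) (hm : ∀ i j, m i j = m j i) (hsum : ∀ j, ∑ i, m i j ≤ R) :
    specNorm A ≤ R := by
  have hm0 : ∀ i j, 0 ≤ m i j := fun i j => (abs_nonneg _).trans (hA i j)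
  refine specNorm_le_of_sq hR fun x => ?_
  have h1 : ∀ i, (∑ j, A i j * x j) ^ 2 ≤ R * ∑ j, m i j * x j ^ 2 := by
    intro i
    -- Cauchy–Schwarz with m = √m · √m. One factor gives a row sum, which symmetry turns into a
    -- column sum; the other keeps the weights for the sum over i.
    have hcs := Finset.sum_mul_sq_le_sq_mul_sq Finset.univ (fun j => √(m i j))
      (fun j => √(m i j) * |x j|)
    have e1 : ∀ j, √(m i j) * (√(m i j) * |x j|) = m i j * |x j| := fun j => by
      rw [← mul_assoc, Real.mul_self_sqrt (hm0 i j)]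
    have e2 : ∀ j, √(m i j) ^ 2 = m i j := fun j => Real.sq_sqrt (hm0 i j)
    have e3 : ∀ j, (√(m i j) * |x j|) ^ 2 = m i j * x j ^ 2 := fun j => by
      rw [mul_pow, e2, sq_abs]
    simp only [e1, e2, e3] at hcs
    have h2 : |∑ j, A i j * x j| ≤ ∑ j, m i j * |x j| :=
      (Finset.abs_sum_le_sum_abs _ _).trans (Finset.sum_le_sum fun j _ => by
        rw [abs_mul]
        exact mul_le_mul_of_nonneg_right (hA i j) (abs_nonneg _))
    have h3 : (∑ j, A i j * x j) ^ 2 ≤ (∑ j, m i j * |x j|) ^ 2 := by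
      rw [← sq_abs (∑ j, A i j * x j)]
      exact pow_le_pow_left₀ (abs_nonneg _) h2 2
    refine h3.trans (hcs.trans ?_)
    refine mul_le_mul_of_nonneg_right ?_
      (Finset.sum_nonneg fun j _ => mul_nonneg (hm0 i j) (sq_nonneg _))
    rw [Finset.sum_congr rfl fun j _ => hm i j]
    exact hsum i
  calc ∑ i, (∑ j, A i j * x j) ^ 2 ≤ ∑ i, R * ∑ j, m i j * x j ^ 2 :=
        Finset.sum_le_sum fun i _ => h1 i
    _ = R * ∑ j, (∑ i, m i j) * x j ^ 2 := by
        rw [← Finset.mul_sum, Finset.sum_comm]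
        simp only [Finset.sum_mul]
    _ ≤ R * ∑ j, R * x j ^ 2 := by
        refine mul_le_mul_of_nonneg_left (Finset.sum_le_sum fun j _ => ?_) hR
        exact mul_le_mul_of_nonneg_right (hsum j) (sq_nonneg _)
    _ = R ^ 2 * ∑ j, x j ^ 2 := by
        rw [← Finset.mul_sum]
        ring

/-! ### Large deviations of means of subexponential variables -/

/-- The linear term is kept exact, so that it vanishes when a centered variable is averaged. -/
theorem exp_le_one_add_add_sq_mul_exp_abs (x : ℝ) :
    Real.exp x ≤ 1 + x + x ^ 2 * Real.exp |x| := by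
  have h := Complex.norm_exp_sub_sum_le_norm_mul_exp (x : ℂ) 2
  have e : Complex.exp (x : ℂ) - ∑ m ∈ Finset.range 2, (x : ℂ) ^ m / (m.factorial : ℂ)
      = ((Real.exp x - (1 + x) : ℝ) : ℂ) := by
    simp [Finset.sum_range_succ]
  rw [e, Complex.norm_real, Complex.norm_real, Real.norm_eq_abs, Real.norm_eq_abs, sq_abs] at h
  linarith [le_abs_self (Real.exp x - (1 + x))]

theorem sq_le_exp_half_mul_abs {a : ℝ} (ha : 0 < a) (z : ℝ) :
    z ^ 2 ≤ 8 / a ^ 2 * Real.exp (a / 2 * |z|) := by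
  have h := Real.pow_div_factorial_le_exp (x := a / 2 * |z|) (by positivity) 2
  have h2 : z ^ 2 = 8 / a ^ 2 * ((a / 2 * |z|) ^ 2 / (Nat.factorial 2 : ℕ)) := by
    rw [mul_pow, sq_abs]
    norm_num [Nat.factorial]
    field_simp
    ring
  rw [h2]
  exact mul_le_mul_of_nonneg_left h (by positivity)

theorem integrable_exp_mul_of_abs {E : Type*} [MeasurableSpace E] {μ : Measure E} {Z : E → ℝ}
    {a : ℝ} (hZ : Measurable Z)
    (hint : Integrable (fun x => Real.exp (a * |Z x|)) μ) {s : ℝ} (hs : |s| ≤ a) :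
    Integrable (fun x => Real.exp (s * Z x)) μ := by
  refine hint.mono' (by fun_prop) (Filter.Eventually.of_forall fun x => ?_)
  rw [Real.norm_eq_abs, Real.abs_exp, Real.exp_le_exp]
  calc s * Z x ≤ |s * Z x| := le_abs_self _
    _ = |s| * |Z x| := abs_mul _ _
    _ ≤ a * |Z x| := by gcongr

section

variable {E : Type*} [MeasurableSpace E] {μ : Measure E} [IsProbabilityMeasure μ] {Z : E → ℝ}
  {a B : ℝ}

/-- A centered subexponential variable has a Gaussian moment generating function near 0. Half of the
exponential moment dominates e^{|sZ|}, the other half dominates Z². -/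
theorem integral_exp_mul_le (ha : 0 < a) (hZ : Measurable Z)
    (hint : Integrable (fun x => Real.exp (a * |Z x|)) μ)
    (hB : ∫ x, Real.exp (a * |Z x|) ∂μ ≤ B) (h0 : ∫ x, Z x ∂μ = 0) {s : ℝ} (hs : |s| ≤ a / 2) :
    ∫ x, Real.exp (s * Z x) ∂μ ≤ Real.exp (8 * B / a ^ 2 * s ^ 2) := by
  have hZi : Integrable Z μ := by
    refine (hint.const_mul (1 / a)).mono' hZ.aestronglyMeasurable
      (Filter.Eventually.of_forall fun x => ?_)
    have := Real.add_one_le_exp (a * |Z x|)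
    rw [Real.norm_eq_abs, div_mul_eq_mul_div, le_div_iff₀ ha]
    linarith
  have hi1 : Integrable (fun x => 1 + s * Z x) μ := (integrable_const 1).add (hZi.const_mul s)
  have hpt : ∀ x, Real.exp (s * Z x)
      ≤ 1 + s * Z x + 8 / a ^ 2 * s ^ 2 * Real.exp (a * |Z x|) := by
    intro x
    refine (exp_le_one_add_add_sq_mul_exp_abs (s * Z x)).trans ?_
    have h1 : Real.exp |s * Z x| ≤ Real.exp (a / 2 * |Z x|) := by
      rw [abs_mul]
      gcongr
    have h2 := sq_le_exp_half_mul_abs ha (Z x)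
    have h3 : Real.exp (a * |Z x|) = Real.exp (a / 2 * |Z x|) * Real.exp (a / 2 * |Z x|) := by
      rw [← Real.exp_add]
      ring_nf
    have h4 : (s * Z x) ^ 2 * Real.exp |s * Z x|
        ≤ (s ^ 2 * (8 / a ^ 2 * Real.exp (a / 2 * |Z x|))) * Real.exp (a / 2 * |Z x|) := by
      rw [mul_pow]
      gcongr
    rw [h3]
    linarith [h4]
  calc ∫ x, Real.exp (s * Z x) ∂μ
      ≤ ∫ x, (1 + s * Z x + 8 / a ^ 2 * s ^ 2 * Real.exp (a * |Z x|)) ∂μ :=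
        integral_mono (integrable_exp_mul_of_abs hZ hint (by linarith))
          (hi1.add (hint.const_mul _)) hpt
    _ = 1 + 8 / a ^ 2 * s ^ 2 * ∫ x, Real.exp (a * |Z x|) ∂μ := by
        rw [integral_add hi1 (hint.const_mul _),
          integral_add (integrable_const 1) (hZi.const_mul s), integral_const_mul,
          integral_const_mul, h0]
        simp
    _ ≤ 1 + 8 / a ^ 2 * s ^ 2 * B := by gcongr
    _ = 8 * B / a ^ 2 * s ^ 2 + 1 := by ring
    _ ≤ _ := Real.add_one_le_exp _

theorem pi_real_lt_mean_le (ha : 0 < a) (hZ : Measurable Z)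
    (hint : Integrable (fun x => Real.exp (a * |Z x|)) μ)
    (hB : ∫ x, Real.exp (a * |Z x|) ∂μ ≤ B) (hB0 : 0 < B) (h0 : ∫ x, Z x ∂μ = 0) {n : ℕ}
    (hn : 0 < n) {t : ℝ} (ht : 0 < t) (hta : t ≤ 8 * B / a) :
    (Measure.pi fun _ : Fin n => μ).real {X | t < (n : ℝ)⁻¹ * ∑ l, Z (X l)}
      ≤ Real.exp (-(a ^ 2 / (32 * B)) * n * t ^ 2) := by
  set C := 8 * B / a ^ 2 with hC
  have hCpos : 0 < C := by positivity
  -- The minimizer of C s² - s t. The requirement s ≤ a/2 is exactly t ≤ 8B/a.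
  set s := t / (2 * C) with hs
  have hs0 : 0 < s := by positivity
  have hsa : |s| ≤ a / 2 := by
    rw [abs_of_pos hs0, hs, div_le_iff₀ (by positivity)]
    calc t ≤ 8 * B / a := hta
      _ = a / 2 * (2 * C) := by
        rw [hC]
        field_simp
  have hnr : (0 : ℝ) < n := by exact_mod_cast hn
  have hexp : ∀ X : Fin n → E, Real.exp (s * ∑ l, Z (X l)) = ∏ l, Real.exp (s * Z (X l)) := by
    intro X
    rw [← Real.exp_sum, Finset.mul_sum]
  have hi : Integrable (fun X : Fin n → E => Real.exp (s * ∑ l, Z (X l)))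
      (Measure.pi fun _ : Fin n => μ) := by
    simp only [hexp]
    exact Integrable.fintype_prod fun _ =>
      integrable_exp_mul_of_abs hZ hint (by linarith)
  have hm := measure_ge_le_exp_mul_mgf (μ := Measure.pi fun _ : Fin n => μ)
    (X := fun X : Fin n → E => ∑ l, Z (X l)) (n * t) hs0.le hi
  have hmgf : mgf (fun X : Fin n → E => ∑ l, Z (X l)) (Measure.pi fun _ : Fin n => μ) s
      ≤ Real.exp (n * (C * s ^ 2)) := by
    unfold mgf
    simp only [hexp]
    rw [integral_fintype_prod_eq_pow (fun x => Real.exp (s * Z x)), Fintype.card_fin,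
      Real.exp_nat_mul]
    exact pow_le_pow_left₀ (integral_nonneg fun x => (Real.exp_pos _).le)
      (integral_exp_mul_le ha hZ hint hB h0 hsa) n
  calc (Measure.pi fun _ : Fin n => μ).real {X | t < (n : ℝ)⁻¹ * ∑ l, Z (X l)}
      ≤ (Measure.pi fun _ : Fin n => μ).real {X | n * t ≤ ∑ l, Z (X l)} := by
        refine measureReal_mono fun X hX => ?_
        simp only [Set.mem_ofPred_eq] at hX ⊢
        rw [inv_mul_eq_div, lt_div_iff₀ hnr] at hX
        linarith
    _ ≤ Real.exp (-s * (n * t)) * Real.exp (n * (C * s ^ 2)) :=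
        hm.trans (mul_le_mul_of_nonneg_left hmgf (Real.exp_pos _).le)
    _ = Real.exp (-(a ^ 2 / (32 * B)) * n * t ^ 2) := by
        rw [← Real.exp_add]
        congr 1
        rw [hs, hC]
        field_simp
        ring

theorem pi_real_lt_abs_mean_le (ha : 0 < a) (hZ : Measurable Z)
    (hint : Integrable (fun x => Real.exp (a * |Z x|)) μ)
    (hB : ∫ x, Real.exp (a * |Z x|) ∂μ ≤ B) (hB0 : 0 < B) (h0 : ∫ x, Z x ∂μ = 0) {n : ℕ}
    (hn : 0 < n) {t : ℝ} (ht : 0 < t) (hta : t ≤ 8 * B / a) :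
    (Measure.pi fun _ : Fin n => μ).real {X | t < |(n : ℝ)⁻¹ * ∑ l, Z (X l)|}
      ≤ 2 * Real.exp (-(a ^ 2 / (32 * B)) * n * t ^ 2) := by
  have h1 := pi_real_lt_mean_le ha hZ hint hB hB0 h0 hn ht hta
  have h2 := pi_real_lt_mean_le (Z := fun x => -Z x) ha hZ.neg (by simpa using hint)
    (by simpa using hB) hB0 (by rw [integral_neg, h0, neg_zero]) hn ht hta
  have hsub : {X : Fin n → E | t < |(n : ℝ)⁻¹ * ∑ l, Z (X l)|}
      ⊆ {X | t < (n : ℝ)⁻¹ * ∑ l, Z (X l)} ∪ {X | t < (n : ℝ)⁻¹ * ∑ l, -Z (X l)} := by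
    intro X hX
    simp only [Set.mem_ofPred_eq, lt_abs] at hX
    rcases hX with h | h
    · exact Or.inl h
    · right
      simpa [Finset.sum_neg_distrib] using h
  calc _ ≤ _ := measureReal_mono hsub
    _ ≤ _ := measureReal_union_le _ _
    _ ≤ _ := by linarith

end

/-! ### Moments of subgaussian vectors -/

section

variable {p : ℕ} {μ : Measure (EuclideanSpace ℝ (Fin p))} {τ : ℝ}

/-- Layer cake for the squared projection, whose tail at t is at most exp(-t/(2τ)). With rate a =
1/(4τ), half of this decay, the integral of a e^{at} e^{-2at} is 1, and 1 + 1 = 2. -/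
theorem IsSubgaussian.lintegral_exp_inner_sq_le (h : IsSubgaussian μ τ) (hτ : 0 < τ)
    {v : EuclideanSpace ℝ (Fin p)} (hv : ‖v‖ = 1) :
    ∫⁻ x, ENNReal.ofReal (Real.exp (1 / (4 * τ) * inner ℝ v (x - ∫ y, y ∂μ) ^ 2)) ∂μ ≤ 2 := by
  have := h.isProb
  set m := ∫ y, y ∂μ
  set a := 1 / (4 * τ) with ha
  have hapos : 0 < a := by positivity
  set f : EuclideanSpace ℝ (Fin p) → ℝ := fun x => inner ℝ v (x - m) ^ 2 with hf
  have hfm : Measurable f := by fun_prop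
  have hlc := lintegral_comp_eq_lintegral_meas_lt_mul μ (f := f)
    (g := fun t => a * Real.exp (a * t)) (Filter.Eventually.of_forall fun x => sq_nonneg _)
    hfm.aemeasurable (fun t _ => (by fun_prop : Continuous _).intervalIntegrable _ _)
    (Filter.Eventually.of_forall fun t => by positivity)
  have hG : ∀ r : ℝ, ∫ t in (0 : ℝ)..r, a * Real.exp (a * t) = Real.exp (a * r) - 1 := by
    intro r
    have := intervalIntegral.integral_eq_sub_of_hasDerivAt (a := 0) (b := r)
      (f := fun t => Real.exp (a * t)) (f' := fun t => a * Real.exp (a * t))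
      (fun t _ => by
        have := ((hasDerivAt_id t).const_mul a).exp
        simpa [mul_comm] using this)
      ((by fun_prop : Continuous _).intervalIntegrable _ _)
    simp
  simp only [hG] at hlc
  have hbound : ∫⁻ t in Set.Ioi (0 : ℝ), μ {x | t < f x} * ENNReal.ofReal (a * Real.exp (a * t))
      ≤ 1 := by
    have hpt : ∀ t ∈ Set.Ioi (0 : ℝ), μ {x | t < f x} * ENNReal.ofReal (a * Real.exp (a * t))
        ≤ ENNReal.ofReal (a * Real.exp (-a * t)) := by
      intro t ht
      have ht0 : 0 < t := ht
      have hset : {x | t < f x} = {x | √t < |inner ℝ v (x - m)|} := by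
        ext x
        simp only [Set.mem_ofPred_eq, hf]
        rw [← Real.sqrt_lt_sqrt_iff ht0.le, Real.sqrt_sq_eq_abs]
      have hta := h.tail v hv (√t) (Real.sqrt_pos.2 ht0)
      rw [← hset, Real.sq_sqrt ht0.le] at hta
      have hμ : μ {x | t < f x} ≤ ENNReal.ofReal (Real.exp (-t / (2 * τ))) := by
        rw [← ofReal_measureReal]
        exact ENNReal.ofReal_le_ofReal hta
      refine (mul_le_mul_left hμ _).trans ?_
      rw [← ENNReal.ofReal_mul (Real.exp_pos _).le]
      refine ENNReal.ofReal_le_ofReal (le_of_eq ?_)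
      rw [mul_left_comm, ← Real.exp_add]
      congr 2
      rw [ha]
      field_simp
      ring
    refine (setLIntegral_mono' measurableSet_Ioi hpt).trans ?_
    rw [← ofReal_integral_eq_lintegral_ofReal]
    · rw [integral_const_mul, integral_exp_mul_Ioi (by linarith) 0]
      have : a * (-Real.exp (-a * 0) / -a) = 1 := by
        simp
        field_simp
      rw [this]
      simp
    · exact (integrableOn_exp_mul_Ioi (by linarith) 0).const_mul a
    · exact Filter.Eventually.of_forall fun t => by positivity
  have h3 : ∀ x, ENNReal.ofReal (Real.exp (a * f x))
      = ENNReal.ofReal (Real.exp (a * f x) - 1) + 1 := by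
    intro x
    have : 0 ≤ Real.exp (a * f x) - 1 := by
      have h1 : 0 ≤ a * f x := mul_nonneg hapos.le (sq_nonneg _)
      linarith [Real.add_one_le_exp (a * f x)]
    rw [← ENNReal.ofReal_one, ← ENNReal.ofReal_add this zero_le_one]
    simp
  calc ∫⁻ x, ENNReal.ofReal (Real.exp (a * f x)) ∂μ
      = ∫⁻ x, ENNReal.ofReal (Real.exp (a * f x) - 1) ∂μ + 1 := by
        simp only [h3]
        rw [lintegral_add_right _ measurable_const]
        simp
    _ ≤ 1 + 1 := by
        rw [hlc]
        gcongr
    _ = 2 := by norm_num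

theorem IsSubgaussian.integrable_exp_inner_sq (h : IsSubgaussian μ τ) (hτ : 0 < τ)
    {v : EuclideanSpace ℝ (Fin p)} (hv : ‖v‖ = 1) :
    Integrable (fun x => Real.exp (1 / (4 * τ) * inner ℝ v (x - ∫ y, y ∂μ) ^ 2)) μ := by
  refine ⟨by fun_prop, ?_⟩
  rw [hasFiniteIntegral_iff_ofReal (Filter.Eventually.of_forall fun x => (Real.exp_pos _).le)]
  exact (h.lintegral_exp_inner_sq_le hτ hv).trans_lt (by norm_num)

theorem IsSubgaussian.integral_exp_inner_sq_le (h : IsSubgaussian μ τ) (hτ : 0 < τ)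
    {v : EuclideanSpace ℝ (Fin p)} (hv : ‖v‖ = 1) :
    ∫ x, Real.exp (1 / (4 * τ) * inner ℝ v (x - ∫ y, y ∂μ) ^ 2) ∂μ ≤ 2 := by
  rw [integral_eq_lintegral_of_nonneg_ae (Filter.Eventually.of_forall fun x => (Real.exp_pos _).le)
    (by fun_prop)]
  exact ENNReal.toReal_le_of_le_ofReal (by norm_num)
    ((h.lintegral_exp_inner_sq_le hτ hv).trans (by norm_num))

/-- The centered coordinate. -/
noncomputable def centered (μ : Measure (EuclideanSpace ℝ (Fin p))) (i : Fin p)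
    (x : EuclideanSpace ℝ (Fin p)) : ℝ := x i - ∫ y, y i ∂μ

theorem measurable_centered (i : Fin p) : Measurable (centered μ i) := by
  unfold centered
  fun_prop

theorem IsSubgaussian.integral_apply (h : IsSubgaussian μ τ) (i : Fin p) :
    (∫ y, y ∂μ) i = ∫ y, y i ∂μ :=
  eval_integral_piLp (f := fun y : EuclideanSpace ℝ (Fin p) => y)
    (fun i => (EuclideanSpace.proj (𝕜 := ℝ) i).integrable_comp h.integrable) i

theorem IsSubgaussian.integrable_apply (h : IsSubgaussian μ τ) (i : Fin p) :
    Integrable (fun y => y i) μ :=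
  (EuclideanSpace.proj (𝕜 := ℝ) i).integrable_comp h.integrable

theorem IsSubgaussian.inner_single (h : IsSubgaussian μ τ) (i : Fin p)
    (x : EuclideanSpace ℝ (Fin p)) :
    inner ℝ (EuclideanSpace.single i (1 : ℝ)) (x - ∫ y, y ∂μ) = centered μ i x := by
  rw [EuclideanSpace.inner_single_left]
  simp [centered, h.integral_apply]

theorem IsSubgaussian.integrable_exp_centered_sq (h : IsSubgaussian μ τ) (hτ : 0 < τ)
    (i : Fin p) : Integrable (fun x => Real.exp (1 / (4 * τ) * centered μ i x ^ 2)) μ := by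
  have := h.integrable_exp_inner_sq hτ (v := EuclideanSpace.single i (1 : ℝ)) (by simp)
  simpa only [h.inner_single] using this

theorem IsSubgaussian.integral_exp_centered_sq_le (h : IsSubgaussian μ τ) (hτ : 0 < τ)
    (i : Fin p) : ∫ x, Real.exp (1 / (4 * τ) * centered μ i x ^ 2) ∂μ ≤ 2 := by
  have := h.integral_exp_inner_sq_le hτ (v := EuclideanSpace.single i (1 : ℝ)) (by simp)
  simpa only [h.inner_single] using this

theorem covMat_apply (i j : Fin p) :
    covMat μ i j = ∫ x, centered μ i x * centered μ j x ∂μ := rfl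

end

section

variable {p : ℕ} {μ : Measure (EuclideanSpace ℝ (Fin p))} {τ : ℝ}

theorem IsSubgaussian.integrable_centered_sq (h : IsSubgaussian μ τ) (hτ : 0 < τ) (i : Fin p) :
    Integrable (fun x => centered μ i x ^ 2) μ := by
  refine ((h.integrable_exp_centered_sq hτ i).const_mul (4 * τ)).mono'
    ((measurable_centered i).pow_const 2).aestronglyMeasurable
    (Filter.Eventually.of_forall fun x => ?_)
  rw [Real.norm_eq_abs, abs_of_nonneg (sq_nonneg _)]
  have h1 := Real.add_one_le_exp (1 / (4 * τ) * centered μ i x ^ 2)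
  have h2 : 4 * τ * (1 / (4 * τ) * centered μ i x ^ 2) = centered μ i x ^ 2 := by
    field_simp
  nlinarith

/-- From z ≤ e^z at z = x²/(4τ): the second moment is at most 4τ times the exponential moment, which
is at most 2. -/
theorem IsSubgaussian.integral_centered_sq_le (h : IsSubgaussian μ τ) (hτ : 0 < τ) (i : Fin p) :
    ∫ x, centered μ i x ^ 2 ∂μ ≤ 8 * τ := by
  have := h.isProb
  have hle : ∫ x, centered μ i x ^ 2 ∂μ
      ≤ ∫ x, 4 * τ * Real.exp (1 / (4 * τ) * centered μ i x ^ 2) ∂μ := by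
    refine integral_mono (h.integrable_centered_sq hτ i)
      ((h.integrable_exp_centered_sq hτ i).const_mul (4 * τ)) fun x => ?_
    have h1 := Real.add_one_le_exp (1 / (4 * τ) * centered μ i x ^ 2)
    have h2 : 4 * τ * (1 / (4 * τ) * centered μ i x ^ 2) = centered μ i x ^ 2 := by
      field_simp
    simp only
    nlinarith
  rw [integral_const_mul] at hle
  nlinarith [h.integral_exp_centered_sq_le hτ i]

theorem abs_mul_le_half_sq_add_sq (x y : ℝ) : |x * y| ≤ (x ^ 2 + y ^ 2) / 2 := by
  rw [abs_le]
  constructor <;> nlinarith [sq_nonneg (x - y), sq_nonneg (x + y)]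

theorem IsSubgaussian.integrable_centered_mul (h : IsSubgaussian μ τ) (hτ : 0 < τ)
    (i j : Fin p) : Integrable (fun x => centered μ i x * centered μ j x) μ := by
  refine (((h.integrable_centered_sq hτ i).add (h.integrable_centered_sq hτ j)).div_const 2).mono'
    ((measurable_centered i).mul (measurable_centered j)).aestronglyMeasurable
    (Filter.Eventually.of_forall fun x => ?_)
  exact abs_mul_le_half_sq_add_sq _ _

theorem IsSubgaussian.abs_covMat_le (h : IsSubgaussian μ τ) (hτ : 0 < τ) (i j : Fin p) :
    |covMat μ i j| ≤ 8 * τ := by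
  rw [covMat_apply]
  calc |∫ x, centered μ i x * centered μ j x ∂μ|
      ≤ ∫ x, |centered μ i x * centered μ j x| ∂μ := abs_integral_le_integral_abs
    _ ≤ ∫ x, (centered μ i x ^ 2 + centered μ j x ^ 2) / 2 ∂μ :=
        integral_mono (h.integrable_centered_mul hτ i j).abs
          (((h.integrable_centered_sq hτ i).add (h.integrable_centered_sq hτ j)).div_const 2)
          fun x => abs_mul_le_half_sq_add_sq _ _
    _ = (∫ x, centered μ i x ^ 2 ∂μ + ∫ x, centered μ j x ^ 2 ∂μ) / 2 := by
        rw [integral_div, integral_add (h.integrable_centered_sq hτ i)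
          (h.integrable_centered_sq hτ j)]
    _ ≤ 8 * τ := by
        linarith [h.integral_centered_sq_le hτ i, h.integral_centered_sq_le hτ j]

theorem IsSubgaussian.integral_centered (h : IsSubgaussian μ τ) (i : Fin p) :
    ∫ x, centered μ i x ∂μ = 0 := by
  have := h.isProb
  unfold centered
  rw [integral_sub (h.integrable_apply i) (integrable_const _)]
  simp

/-- The centered product of two coordinates. -/
noncomputable def centeredProd (μ : Measure (EuclideanSpace ℝ (Fin p))) (i j : Fin p)
    (x : EuclideanSpace ℝ (Fin p)) : ℝ := centered μ i x * centered μ j x - covMat μ i j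

theorem measurable_centeredProd (i j : Fin p) : Measurable (centeredProd μ i j) :=
  ((measurable_centered i).mul (measurable_centered j)).sub_const _

theorem IsSubgaussian.integral_centeredProd (h : IsSubgaussian μ τ) (hτ : 0 < τ) (i j : Fin p) :
    ∫ x, centeredProd μ i j x ∂μ = 0 := by
  have := h.isProb
  unfold centeredProd
  rw [integral_sub (h.integrable_centered_mul hτ i j) (integrable_const _), covMat_apply]
  simp

theorem exp_half_add_le (x y : ℝ) :
    Real.exp ((x + y) / 2) ≤ (Real.exp x + Real.exp y) / 2 := by
  have h1 : Real.exp x = Real.exp (x / 2) ^ 2 := by rw [← Real.exp_nat_mul]; ring_nf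
  have h2 : Real.exp y = Real.exp (y / 2) ^ 2 := by rw [← Real.exp_nat_mul]; ring_nf
  have h3 : Real.exp ((x + y) / 2) = Real.exp (x / 2) * Real.exp (y / 2) := by
    rw [← Real.exp_add]; ring_nf
  rw [h1, h2, h3]
  nlinarith [sq_nonneg (Real.exp (x / 2) - Real.exp (y / 2))]

/-- A product of coordinates is at most the mean of their squares, and centering adds at most 8τ;
multiplied by 1/(4τ) this is the factor e². -/
theorem IsSubgaussian.exp_abs_centeredProd_le (h : IsSubgaussian μ τ) (hτ : 0 < τ) (i j : Fin p)
    (x : EuclideanSpace ℝ (Fin p)) :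
    Real.exp (1 / (4 * τ) * |centeredProd μ i j x|)
      ≤ Real.exp 2 * ((Real.exp (1 / (4 * τ) * centered μ i x ^ 2)
        + Real.exp (1 / (4 * τ) * centered μ j x ^ 2)) / 2) := by
  refine le_trans ?_ (mul_le_mul_of_nonneg_left (exp_half_add_le _ _) (Real.exp_pos 2).le)
  rw [← Real.exp_add, Real.exp_le_exp]
  have h1 : |centeredProd μ i j x| ≤ (centered μ i x ^ 2 + centered μ j x ^ 2) / 2 + 8 * τ := by
    unfold centeredProd
    calc _ ≤ |centered μ i x * centered μ j x| + |covMat μ i j| := abs_sub _ _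
      _ ≤ _ := add_le_add (abs_mul_le_half_sq_add_sq _ _) (h.abs_covMat_le hτ i j)
  have ha : 0 < 1 / (4 * τ) := by positivity
  have h2 := mul_le_mul_of_nonneg_left h1 ha.le
  have h3 : 1 / (4 * τ) * (8 * τ) = 2 := by
    field_simp
    norm_num
  rw [mul_add, h3] at h2
  linarith

theorem IsSubgaussian.integrable_exp_abs_centeredProd (h : IsSubgaussian μ τ) (hτ : 0 < τ)
    (i j : Fin p) : Integrable (fun x => Real.exp (1 / (4 * τ) * |centeredProd μ i j x|)) μ := by
  refine ((((h.integrable_exp_centered_sq hτ i).add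
    (h.integrable_exp_centered_sq hτ j)).div_const 2).const_mul (Real.exp 2)).mono' ?_
    (Filter.Eventually.of_forall fun x => ?_)
  · have := measurable_centeredProd (μ := μ) i j
    fun_prop
  · rw [Real.norm_eq_abs, Real.abs_exp]
    exact h.exp_abs_centeredProd_le hτ i j x

theorem IsSubgaussian.integral_exp_abs_centeredProd_le (h : IsSubgaussian μ τ) (hτ : 0 < τ)
    (i j : Fin p) :
    ∫ x, Real.exp (1 / (4 * τ) * |centeredProd μ i j x|) ∂μ ≤ 2 * Real.exp 2 := by
  calc _ ≤ ∫ x, Real.exp 2 * ((Real.exp (1 / (4 * τ) * centered μ i x ^ 2)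
        + Real.exp (1 / (4 * τ) * centered μ j x ^ 2)) / 2) ∂μ :=
        integral_mono (h.integrable_exp_abs_centeredProd hτ i j)
          ((((h.integrable_exp_centered_sq hτ i).add
            (h.integrable_exp_centered_sq hτ j)).div_const 2).const_mul (Real.exp 2))
          fun x => h.exp_abs_centeredProd_le hτ i j x
    _ = Real.exp 2 * ((∫ x, Real.exp (1 / (4 * τ) * centered μ i x ^ 2) ∂μ
        + ∫ x, Real.exp (1 / (4 * τ) * centered μ j x ^ 2) ∂μ) / 2) := by
        rw [integral_const_mul, integral_div, integral_add (h.integrable_exp_centered_sq hτ i)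
          (h.integrable_exp_centered_sq hτ j)]
    _ ≤ 2 * Real.exp 2 := by
        have := Real.exp_pos 2
        nlinarith [h.integral_exp_centered_sq_le hτ i, h.integral_exp_centered_sq_le hτ j]

theorem exp_abs_centered_le {a : ℝ} (ha : 0 < a) (i : Fin p) (x : EuclideanSpace ℝ (Fin p)) :
    Real.exp (a * |centered μ i x|) ≤ Real.exp a * Real.exp (a * centered μ i x ^ 2) := by
  rw [← Real.exp_add, Real.exp_le_exp]
  have : |centered μ i x| ≤ 1 + centered μ i x ^ 2 := by
    rw [← sq_abs]
    nlinarith [sq_nonneg (|centered μ i x| - 1), abs_nonneg (centered μ i x)]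
  nlinarith

theorem IsSubgaussian.integrable_exp_abs_centered (h : IsSubgaussian μ τ) (hτ : 0 < τ)
    (i : Fin p) : Integrable (fun x => Real.exp (1 / (4 * τ) * |centered μ i x|)) μ := by
  refine ((h.integrable_exp_centered_sq hτ i).const_mul (Real.exp (1 / (4 * τ)))).mono' ?_
    (Filter.Eventually.of_forall fun x => ?_)
  · have := measurable_centered (μ := μ) i
    fun_prop
  · rw [Real.norm_eq_abs, Real.abs_exp]
    exact exp_abs_centered_le (by positivity) i x

theorem IsSubgaussian.integral_exp_abs_centered_le (h : IsSubgaussian μ τ) (hτ : 0 < τ)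
    (i : Fin p) :
    ∫ x, Real.exp (1 / (4 * τ) * |centered μ i x|) ∂μ ≤ 2 * Real.exp (1 / (4 * τ)) := by
  calc _ ≤ ∫ x, Real.exp (1 / (4 * τ)) * Real.exp (1 / (4 * τ) * centered μ i x ^ 2) ∂μ :=
        integral_mono (h.integrable_exp_abs_centered hτ i)
          ((h.integrable_exp_centered_sq hτ i).const_mul (Real.exp (1 / (4 * τ))))
          fun x => exp_abs_centered_le (by positivity) i x
    _ ≤ _ := by
        rw [integral_const_mul]
        nlinarith [h.integral_exp_centered_sq_le hτ i, Real.exp_pos (1 / (4 * τ))]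

/-! ### Deviations of the maximum likelihood estimator -/

theorem sampleMean_apply {n : ℕ} (X : Sample n p) (i : Fin p) :
    sampleMean X i = (n : ℝ)⁻¹ * ∑ l, X l i := by
  simp [sampleMean]

/-- Centering at the sample mean instead of the true mean costs only a product of two averages,
which is of second order. -/
theorem mle_sub_covMat {n : ℕ} (hn : 0 < n) (X : Sample n p) (i j : Fin p) :
    mle X i j - covMat μ i j = (n : ℝ)⁻¹ * ∑ l, centeredProd μ i j (X l)
      - ((n : ℝ)⁻¹ * ∑ l, centered μ i (X l)) * ((n : ℝ)⁻¹ * ∑ l, centered μ j (X l)) := by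
  have hnr : (n : ℝ) ≠ 0 := by exact_mod_cast hn.ne'
  have e : ∀ k : Fin p, ∀ l, (X l - sampleMean X) k
      = centered μ k (X l) - (n : ℝ)⁻¹ * ∑ l, centered μ k (X l) := by
    intro k l
    rw [PiLp.sub_apply, sampleMean_apply]
    simp only [centered, Finset.sum_sub_distrib, Finset.sum_const, Finset.card_univ,
      Fintype.card_fin, nsmul_eq_mul]
    field_simp
    ring
  simp only [mle, Matrix.of_apply, e]
  set A := (n : ℝ)⁻¹ * ∑ l, centered μ i (X l) with hA
  set A' := (n : ℝ)⁻¹ * ∑ l, centered μ j (X l) with hA'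
  have h1 : ∑ l, centered μ i (X l) = n * A := by
    rw [hA]
    field_simp
  have h2 : ∑ l, centered μ j (X l) = n * A' := by
    rw [hA']
    field_simp
  have h3 : ∀ l, (centered μ i (X l) - A) * (centered μ j (X l) - A')
      = centered μ i (X l) * centered μ j (X l) - A' * centered μ i (X l)
        - A * centered μ j (X l) + A * A' := fun l => by ring
  simp only [h3, centeredProd, Finset.sum_add_distrib, Finset.sum_sub_distrib, ← Finset.mul_sum,
    h1, h2, Finset.sum_const, Finset.card_univ, Fintype.card_fin, nsmul_eq_mul]
  field_simp
  ring

theorem exists_deviationBound (hτ : 0 < τ) :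
    ∃ γ C₁ δ : ℝ, 0 < γ ∧ 0 < C₁ ∧ 0 < δ ∧ DeviationBound τ γ C₁ δ := by
  set a := 1 / (4 * τ) with ha
  have hapos : 0 < a := by positivity
  set B := 2 * Real.exp 2 + 2 * Real.exp a with hB
  have hBpos : 0 < B := by positivity
  set b := 8 * B / a with hb
  have hbpos : 0 < b := by positivity
  set κ := a ^ 2 / (32 * B) with hκ
  have hκpos : 0 < κ := by positivity
  -- This γ makes 8/γ² = κ/4, the loss from splitting t into halves. The constant 6 adds three
  -- two-sided bounds. In δ, the bounds b and b² keep t/2 and √(t/2) in the Chernoff range, and t ≤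
  -- 1 gives t² ≤ t.
  refine ⟨√(32 / κ), 6, min 1 (min b (b ^ 2)), by positivity, by norm_num, by positivity, ?_⟩
  intro n p hn μ hμ i j t ht htδ
  have := hμ.isProb
  have ht1 : t ≤ 1 := htδ.trans (min_le_left _ _)
  have htb : t ≤ b := htδ.trans ((min_le_right _ _).trans (min_le_left _ _))
  have htb2 : t ≤ b ^ 2 := htδ.trans ((min_le_right _ _).trans (min_le_right _ _))
  have hst : √(t / 2) ≤ b := by
    rw [Real.sqrt_le_left hbpos.le]
    linarith
  have hst0 : 0 < √(t / 2) := Real.sqrt_pos.2 (by positivity)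
  have hnr : (0 : ℝ) < n := by exact_mod_cast hn
  have d1 := pi_real_lt_abs_mean_le hapos (measurable_centeredProd (μ := μ) i j)
    (hμ.integrable_exp_abs_centeredProd hτ i j)
    ((hμ.integral_exp_abs_centeredProd_le hτ i j).trans
      (le_add_of_nonneg_right (by positivity) : _ ≤ B)) hBpos
    (hμ.integral_centeredProd hτ i j) hn (half_pos ht) (by linarith)
  have d2 : ∀ k : Fin p, _ := fun k =>
    pi_real_lt_abs_mean_le hapos (measurable_centered (μ := μ) k)
    (hμ.integrable_exp_abs_centered hτ k)
    ((hμ.integral_exp_abs_centered_le hτ k).trans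
      (le_add_of_nonneg_left (by positivity) : _ ≤ B)) hBpos
    (hμ.integral_centered k) hn hst0 hst
  rw [Real.sq_sqrt (by positivity)] at d2
  -- If the average of products is at most t/2 and both averages of coordinates are at most √(t/2),
  -- the deviation is at most t.
  have hsub : {X : Sample n p | t < |mle X i j - covMat μ i j|}
      ⊆ {X | t / 2 < |(n : ℝ)⁻¹ * ∑ l, centeredProd μ i j (X l)|}
        ∪ ({X | √(t / 2) < |(n : ℝ)⁻¹ * ∑ l, centered μ i (X l)|}
          ∪ {X | √(t / 2) < |(n : ℝ)⁻¹ * ∑ l, centered μ j (X l)|}) := by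
    intro X hX
    simp only [Set.mem_ofPred_eq, mle_sub_covMat hn] at hX
    simp only [Set.mem_union, Set.mem_ofPred_eq]
    by_contra hcon
    push Not at hcon
    obtain ⟨h1, h2, h3⟩ := hcon
    have h4 := abs_sub ((n : ℝ)⁻¹ * ∑ l, centeredProd μ i j (X l))
      (((n : ℝ)⁻¹ * ∑ l, centered μ i (X l)) * ((n : ℝ)⁻¹ * ∑ l, centered μ j (X l)))
    rw [abs_mul (((n : ℝ)⁻¹ * ∑ l, centered μ i (X l)))] at h4
    have h5 := mul_le_mul h2 h3 (abs_nonneg _) hst0.le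
    rw [Real.mul_self_sqrt (by positivity)] at h5
    linarith
  have hexp : 8 / √(32 / κ) ^ 2 = κ / 4 := by
    rw [Real.sq_sqrt (by positivity)]
    field_simp
    norm_num
  rw [hexp]
  have e1 : Real.exp (-κ * n * (t / 2) ^ 2) = Real.exp (-(κ / 4) * n * t ^ 2) := by
    congr 1
    ring
  have e2 : Real.exp (-κ * n * (t / 2)) ≤ Real.exp (-(κ / 4) * n * t ^ 2) := by
    rw [Real.exp_le_exp]
    have : t ^ 2 ≤ t := by nlinarith
    have h2 : 0 < κ * n := by positivity
    nlinarith
  rw [e1] at d1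
  unfold sampleLaw
  calc _ ≤ _ := measureReal_mono hsub
    _ ≤ _ := measureReal_union_le _ _
    _ ≤ _ := add_le_add le_rfl (measureReal_union_le _ _)
    _ ≤ 2 * Real.exp (-(κ / 4) * n * t ^ 2) + (2 * Real.exp (-κ * n * (t / 2))
        + 2 * Real.exp (-κ * n * (t / 2))) := add_le_add d1 (add_le_add (d2 i) (d2 j))
    _ ≤ _ := by linarith

theorem IsSubgaussian.abs_mle_sub_covMat_le (h : IsSubgaussian μ τ) (hτ : 0 < τ) {n : ℕ}
    (hn : 0 < n) (X : Sample n p) (i j : Fin p) :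
    |mle X i j - covMat μ i j|
      ≤ (n : ℝ)⁻¹ * ∑ l, (centered μ i (X l) ^ 2 + centered μ j (X l) ^ 2 + 8 * τ) := by
  have hnr : (0 : ℝ) < n := by exact_mod_cast hn
  have hsq : ∀ k : Fin p, ((n : ℝ)⁻¹ * ∑ l, centered μ k (X l)) ^ 2
      ≤ (n : ℝ)⁻¹ * ∑ l, centered μ k (X l) ^ 2 := by
    intro k
    have := sq_sum_le_card_mul_sum_sq (s := Finset.univ) (f := fun l => centered μ k (X l))
    rw [Finset.card_univ, Fintype.card_fin] at this
    rw [mul_pow, inv_pow, inv_mul_le_iff₀ (by positivity)]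
    calc _ ≤ _ := this
      _ = _ := by field_simp
  rw [mle_sub_covMat hn]
  have h1 : |(n : ℝ)⁻¹ * ∑ l, centeredProd μ i j (X l)|
      ≤ (n : ℝ)⁻¹ * ∑ l, ((centered μ i (X l) ^ 2 + centered μ j (X l) ^ 2) / 2 + 8 * τ) := by
    rw [abs_mul, abs_of_pos (inv_pos.2 hnr)]
    refine mul_le_mul_of_nonneg_left ((Finset.abs_sum_le_sum_abs _ _).trans
      (Finset.sum_le_sum fun l _ => ?_)) (inv_pos.2 hnr).le
    unfold centeredProd
    exact (abs_sub _ _).trans (add_le_add (abs_mul_le_half_sq_add_sq _ _) (h.abs_covMat_le hτ i j))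
  have h2 := abs_mul_le_half_sq_add_sq ((n : ℝ)⁻¹ * ∑ l, centered μ i (X l))
    ((n : ℝ)⁻¹ * ∑ l, centered μ j (X l))
  have h3 := hsq i
  have h4 := hsq j
  refine (abs_sub _ _).trans ?_
  simp only [Finset.sum_add_distrib, ← Finset.sum_div, mul_add, ← mul_div_assoc] at h1 ⊢
  linarith

/-- Jensen moves the eighth power inside the sample average, where x^8 ≤ 8! e^x applies. The bound
does not decrease in n; it is needed only for the rare large deviations. -/
theorem IsSubgaussian.lintegral_mle_sub_covMat_pow_le (h : IsSubgaussian μ τ) (hτ : 0 < τ) {n : ℕ}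
    (hn : 0 < n) (i j : Fin p) :
    ∫⁻ X : Sample n p, ENNReal.ofReal (|mle X i j - covMat μ i j| ^ 8) ∂(sampleLaw n μ)
      ≤ ENNReal.ofReal ((8 * τ) ^ 8 * (Nat.factorial 8 : ℕ) * (2 * Real.exp 1)) := by
  have := h.isProb
  have hnr : (0 : ℝ) < n := by exact_mod_cast hn
  set K := (8 * τ) ^ 8 * (Nat.factorial 8 : ℕ) * Real.exp 1 with hK
  have hKpos : 0 < K := by positivity
  set G : EuclideanSpace ℝ (Fin p) → ℝ := fun x =>
    (Real.exp (1 / (4 * τ) * centered μ i x ^ 2)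
        + Real.exp (1 / (4 * τ) * centered μ j x ^ 2)) / 2 with hG
  have hGi : Integrable G μ := ((h.integrable_exp_centered_sq hτ i).add
    (h.integrable_exp_centered_sq hτ j)).div_const 2
  have hGle : ∫ x, G x ∂μ ≤ 2 := by
    rw [hG, integral_div, integral_add (h.integrable_exp_centered_sq hτ i)
          (h.integrable_exp_centered_sq hτ j)]
    linarith [h.integral_exp_centered_sq_le hτ i, h.integral_exp_centered_sq_le hτ j]
  have hG0 : ∀ x, 0 ≤ G x := fun x => by positivity
  have hpt : ∀ x, (centered μ i x ^ 2 + centered μ j x ^ 2 + 8 * τ) ^ 8 ≤ K * G x := by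
    intro x
    set S := centered μ i x ^ 2 + centered μ j x ^ 2 + 8 * τ with hS
    have hS0 : 0 ≤ S := by positivity
    have h1 := Real.pow_div_factorial_le_exp (x := S / (8 * τ)) (by positivity) 8
    -- The scale 8τ splits the exponent into 1 plus the mean of the two normalized squares, so
    -- convexity of exp gives G.
    have h2 : Real.exp (S / (8 * τ)) ≤ Real.exp 1 * G x := by
      refine le_trans (le_of_eq ?_)
        (mul_le_mul_of_nonneg_left (exp_half_add_le _ _) (Real.exp_pos 1).le)
      rw [← Real.exp_add, hS]
      congr 1
      field_simp
      ring
    have h3 := h1.trans h2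
    rw [div_pow, div_div, div_le_iff₀ (by positivity)] at h3
    calc _ ≤ _ := h3
      _ = K * G x := by
        rw [hK]
        ring
  have hpt2 : ∀ X : Sample n p, |mle X i j - covMat μ i j| ^ 8
      ≤ (n : ℝ)⁻¹ * ∑ l, K * G (X l) := by
    intro X
    refine (pow_le_pow_left₀ (abs_nonneg _) (h.abs_mle_sub_covMat_le hτ hn X i j) 8).trans ?_
    have hJ := Real.pow_arith_mean_le_arith_mean_pow Finset.univ (fun _ : Fin n => (n : ℝ)⁻¹)
      (fun l => centered μ i (X l) ^ 2 + centered μ j (X l) ^ 2 + 8 * τ)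
      (fun _ _ => (inv_pos.2 hnr).le) (by simp [hnr.ne']) (fun _ _ => by positivity) 8
    rw [← Finset.mul_sum, ← Finset.mul_sum] at hJ
    exact hJ.trans (mul_le_mul_of_nonneg_left (Finset.sum_le_sum fun l _ => hpt (X l)) (inv_pos.2 hnr).le)
  have hil : ∀ l : Fin n, Integrable (fun X : Sample n p => K * G (X l)) (sampleLaw n μ) :=
    fun l => integrable_comp_eval (μ := fun _ : Fin n => μ) (hGi.const_mul K)
  have hi : Integrable (fun X : Sample n p => (n : ℝ)⁻¹ * ∑ l, K * G (X l)) (sampleLaw n μ) :=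
    (integrable_finsetSum _ fun l _ => hil l).const_mul _
  calc _ ≤ ∫⁻ X : Sample n p, ENNReal.ofReal ((n : ℝ)⁻¹ * ∑ l, K * G (X l)) ∂(sampleLaw n μ) :=
        lintegral_mono fun X => ENNReal.ofReal_le_ofReal (hpt2 X)
    _ = ENNReal.ofReal (∫ X : Sample n p, (n : ℝ)⁻¹ * ∑ l, K * G (X l) ∂(sampleLaw n μ)) := by
        rw [ofReal_integral_eq_lintegral_ofReal hi]
        exact Filter.Eventually.of_forall fun X => mul_nonneg (inv_pos.2 hnr).le
          (Finset.sum_nonneg fun l _ => mul_nonneg hKpos.le (hG0 _))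
    _ ≤ _ := by
        refine ENNReal.ofReal_le_ofReal ?_
        rw [integral_const_mul, integral_finsetSum _ fun l _ => hil l]
        have : ∀ l : Fin n, ∫ X : Sample n p, K * G (X l) ∂(sampleLaw n μ) = K * ∫ x, G x ∂μ := by
          intro l
          unfold sampleLaw
          rw [integral_comp_eval (μ := fun _ : Fin n => μ) (i := l) (f := fun x => K * G x) (hGi.const_mul K).aestronglyMeasurable,
            integral_const_mul]
        simp only [this, Finset.sum_const, Finset.card_univ, Fintype.card_fin, nsmul_eq_mul]
        rw [inv_mul_cancel_left₀ hnr.ne']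
        calc K * ∫ x, G x ∂μ ≤ K * 2 := by gcongr
          _ = _ := by rw [hK]; ring

end

/-! ### Risk of the thresholding estimator -/

section

variable {n p : ℕ} {μ : Measure (EuclideanSpace ℝ (Fin p))} {τ : ℝ}

theorem covMat_comm (i j : Fin p) : covMat μ i j = covMat μ j i := by
  rw [covMat_apply, covMat_apply]
  simp only [mul_comm]

theorem measurable_mle (i j : Fin p) : Measurable fun X : Sample n p => mle X i j := by
  simp only [mle, Matrix.of_apply, PiLp.sub_apply, sampleMean_apply]
  fun_prop

theorem measurable_thresholdEstimator (γ : ℝ) (i j : Fin p) :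
    Measurable fun X : Sample n p => thresholdEstimator n p γ X i j := by
  simp only [thresholdEstimator, Matrix.of_apply]
  exact Measurable.ite (measurableSet_le measurable_const (measurable_mle i j).abs)
    (measurable_mle i j) measurable_const

theorem IsEstimator.thresholdEstimator (γ : ℝ) : IsEstimator (thresholdEstimator n p γ) :=
  measurable_thresholdEstimator γ

/-- A kept entry has |σ| ≥ λ/4, so its error 3λ/4 is at most 3|σ|. A discarded entry has |σ| ≤ 7λ/4,
and its error is |σ|. -/
theorem abs_thresholdEstimator_sub_le_min {γ : ℝ} (X : Sample n p) {i j : Fin p}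
    (h : |mle X i j - covMat μ i j| ≤ 3 / 4 * threshold n p γ) :
    |thresholdEstimator n p γ X i j - covMat μ i j|
      ≤ 4 * min |covMat μ i j| (threshold n p γ) := by
  set lam := threshold n p γ
  have hlam : 0 ≤ lam := by linarith [abs_nonneg (mle X i j - covMat μ i j)]
  have h2 := abs_sub_abs_le_abs_sub (mle X i j) (covMat μ i j)
  have h3 := abs_sub_abs_le_abs_sub (covMat μ i j) (mle X i j)
  rw [abs_sub_comm] at h3
  simp only [thresholdEstimator, Matrix.of_apply]
  rw [mul_min_of_nonneg _ _ (by norm_num : (0 : ℝ) ≤ 4), le_min_iff]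
  split_ifs with hc
  · constructor <;> linarith
  · rw [not_le] at hc
    rw [zero_sub, abs_neg]
    constructor <;> linarith [abs_nonneg (covMat μ i j)]

theorem abs_thresholdEstimator_sub_le {γ : ℝ} (hγ : 0 ≤ γ) (X : Sample n p) (i j : Fin p) :
    |thresholdEstimator n p γ X i j - covMat μ i j|
      ≤ |mle X i j - covMat μ i j| + threshold n p γ := by
  have hlam : 0 ≤ threshold n p γ := mul_nonneg hγ (Real.sqrt_nonneg _)
  simp only [thresholdEstimator, Matrix.of_apply]
  split_ifs with hc
  · linarith
  · rw [not_le] at hc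
    rw [zero_sub, abs_neg]
    have h3 := abs_sub_abs_le_abs_sub (covMat μ i j) (mle X i j)
    rw [abs_sub_comm] at h3
    linarith

/-- The class constrains only off-diagonal entries; the diagonal one contributes at most λ. -/
theorem sum_min_column_le {q c lam : ℝ} (hq0 : 0 ≤ q) (hq1 : q < 1) (hc : 0 ≤ c) (hlam : 0 ≤ lam)
    {S : Matrix (Fin p) (Fin p) ℝ} (hS : S ∈ sparseClass p q c) (j : Fin p) :
    ∑ i, 4 * min |S i j| lam ≤ 4 * (c * lam ^ (1 - q) / (1 - q) + lam) := by
  rw [← Finset.mul_sum, Fintype.sum_eq_add_sum_subtype_ne _ j]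
  have h1 := sum_min_le_of_mem_weakBall hq0 hq1 hc hlam (hS j)
  have h2 : min |S j j| lam ≤ lam := min_le_right _ _
  linarith

/-- An elementary substitute for Hölder's inequality. With a = p it is summed over p² entries: the
first term gains p^(-3), and the second is charged only on an event of probability O(p^(-4)). -/
theorem sq_le_pow_eight_div_add {D a : ℝ} (ha : 0 < a) : D ^ 2 ≤ |D| ^ 8 / a ^ 3 + a := by
  rcases le_total (D ^ 2) a with h | h
  · have : 0 ≤ |D| ^ 8 / a ^ 3 := by positivity
    linarith
  · have h2 : D ^ 2 ≤ |D| ^ 8 / a ^ 3 := by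
      rw [le_div_iff₀ (by positivity)]
      calc D ^ 2 * a ^ 3 ≤ D ^ 2 * (D ^ 2) ^ 3 := by gcongr
        _ = (D ^ 2) ^ 4 := by ring
        _ = |D| ^ 8 := by rw [← sq_abs]; ring
    linarith

-- The error matrix is split entrywise by whether |D| ≤ 4 min(|σ|, λ). The Schur test treats the
-- entries that obey this, the Frobenius norm the others, and the latter vanish unless the deviation
-- exceeds 3λ/4.
open Classical in
theorem specNorm_thresholdEstimator_sub_sq_le {q c γ δ : ℝ} (hq0 : 0 ≤ q) (hq1 : q < 1)
    (hc : 0 ≤ c) (hγ : 0 ≤ γ) (hp : 0 < p) (hδ : threshold n p γ ≤ δ)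
    (hS : covMat μ ∈ sparseClass p q c) (X : Sample n p) :
    specNorm (thresholdEstimator n p γ X - covMat μ) ^ 2
      ≤ 2 * (4 * (c * threshold n p γ ^ (1 - q) / (1 - q) + threshold n p γ)) ^ 2
        + ∑ i, ∑ j, (2 * (2 ^ 7 * |mle X i j - covMat μ i j| ^ 8 / (p : ℝ) ^ 3)
          + 2 * (2 ^ 7 * δ ^ 8 / (p : ℝ) ^ 3)
          + {X : Sample n p | 3 / 4 * threshold n p γ < |mle X i j - covMat μ i j|}.indicator
            (fun _ => 2 * (p : ℝ)) X) := by
  set lam := threshold n p γ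
  have hlam : 0 ≤ lam := mul_nonneg hγ (Real.sqrt_nonneg _)
  have hpr : (0 : ℝ) < p := by exact_mod_cast hp
  set D := thresholdEstimator n p γ X - covMat μ with hD
  set m : Matrix (Fin p) (Fin p) ℝ := Matrix.of fun i j => 4 * min |covMat μ i j| lam with hm
  set D1 : Matrix (Fin p) (Fin p) ℝ := Matrix.of fun i j =>
    if |D i j| ≤ m i j then D i j else 0 with hD1
  set D2 : Matrix (Fin p) (Fin p) ℝ := Matrix.of fun i j =>
    if |D i j| ≤ m i j then 0 else D i j with hD2
  have hsplit : D = D1 + D2 := by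
    ext i j
    simp only [hD1, hD2, Matrix.add_apply, Matrix.of_apply]
    split_ifs <;> simp
  set R := 4 * (c * lam ^ (1 - q) / (1 - q) + lam) with hR
  have hR0 : 0 ≤ R := by
    have : 0 ≤ lam ^ (1 - q) := Real.rpow_nonneg hlam _
    have : 0 < 1 - q := by linarith
    positivity
  have hn1 : specNorm D1 ≤ R := by
    refine specNorm_le_of_abs_le (m := m) hR0 ?_ ?_ ?_
    · intro i j
      simp only [hD1, Matrix.of_apply]
      split_ifs with h
      · exact h
      · simp only [abs_zero, hm, Matrix.of_apply]
        positivity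
    · intro i j
      simp only [hm, Matrix.of_apply]
      rw [covMat_comm]
    · intro j
      exact sum_min_column_le hq0 hq1 hc hlam hS j
  have hn2 : specNorm D2 ^ 2 ≤ ∑ i, ∑ j, D2 i j ^ 2 := specNorm_sq_le_sum_sq D2
  have hent : ∀ i j, 2 * D2 i j ^ 2 ≤ (2 * (2 ^ 7 * |mle X i j - covMat μ i j| ^ 8 / (p : ℝ) ^ 3)
          + 2 * (2 ^ 7 * δ ^ 8 / (p : ℝ) ^ 3)
          + {X : Sample n p | 3 / 4 * lam < |mle X i j - covMat μ i j|}.indicator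
            (fun _ => 2 * (p : ℝ)) X) := by
    intro i j
    have hδ0 : 0 ≤ δ := hlam.trans hδ
    by_cases hb : |mle X i j - covMat μ i j| ≤ 3 / 4 * lam
    · have h1 : D2 i j = 0 := by
        simp only [hD2, Matrix.of_apply]
        rw [if_pos]
        exact abs_thresholdEstimator_sub_le_min X hb
      rw [h1, Set.indicator_of_notMem (by simpa using hb)]
      exact le_trans (by norm_num : 2 * (0 : ℝ) ^ 2 ≤ 0) (by positivity)
    · rw [Set.indicator_of_mem (by simpa using hb)]
      have h2 : |D2 i j| ≤ |mle X i j - covMat μ i j| + δ := by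
        simp only [hD2, Matrix.of_apply]
        split_ifs
        · simp only [abs_zero]
          positivity
        · exact (abs_thresholdEstimator_sub_le hγ X i j).trans (by gcongr)
      have h3 := sq_le_pow_eight_div_add (D := D2 i j) hpr
      have h4 : |D2 i j| ^ 8 ≤ 2 ^ 7 * (|mle X i j - covMat μ i j| ^ 8 + δ ^ 8) :=
        (pow_le_pow_left₀ (abs_nonneg _) h2 8).trans (add_pow_le (abs_nonneg _) hδ0 8)
      have h5 : |D2 i j| ^ 8 / (p : ℝ) ^ 3
          ≤ 2 ^ 7 * (|mle X i j - covMat μ i j| ^ 8 + δ ^ 8) / (p : ℝ) ^ 3 := by gcongr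
      rw [mul_add, add_div] at h5
      linarith
  calc specNorm D ^ 2 ≤ (specNorm D1 + specNorm D2) ^ 2 := by
        rw [hsplit]
        exact pow_le_pow_left₀ (specNorm_nonneg _) (specNorm_add_le _ _) 2
    _ ≤ 2 * specNorm D1 ^ 2 + 2 * specNorm D2 ^ 2 := by
        nlinarith [sq_nonneg (specNorm D1 - specNorm D2)]
    _ ≤ 2 * R ^ 2 + 2 * ∑ i, ∑ j, D2 i j ^ 2 := by
        have := pow_le_pow_left₀ (specNorm_nonneg _) hn1 2
        linarith
    _ ≤ _ := by
        simp only [Finset.mul_sum]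
        exact add_le_add le_rfl (Finset.sum_le_sum fun i _ => Finset.sum_le_sum fun j _ => hent i j)

theorem threshold_pos {γ : ℝ} (hγ : 0 < γ) (hn : 0 < n) (hp : 1 < p) : 0 < threshold n p γ := by
  have hl : 0 < Real.log p := Real.log_pos (by exact_mod_cast hp)
  have hnr : (0 : ℝ) < n := by exact_mod_cast hn
  unfold threshold
  positivity

theorem DeviationBound.measure_bad_le {γ C₁ δ : ℝ} (hdev : DeviationBound τ γ C₁ δ) (hγ : 0 < γ)
    (hC₁ : 0 < C₁) (hμ : IsSubgaussian μ τ) (hn : 0 < n) (hp : 1 < p) (hδ : threshold n p γ ≤ δ)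
    (i j : Fin p) :
    sampleLaw n μ {X | 3 / 4 * threshold n p γ < |mle X i j - covMat μ i j|}
      ≤ ENNReal.ofReal (C₁ / (p : ℝ) ^ 4) := by
  have := hμ.isProb
  have : IsProbabilityMeasure (sampleLaw n μ) := by
    unfold sampleLaw
    infer_instance
  have hnr : (0 : ℝ) < n := by exact_mod_cast hn
  have hpr : (0 : ℝ) < p := by exact_mod_cast (by omega : 0 < p)
  have hl : 0 < Real.log p := Real.log_pos (by exact_mod_cast hp)
  have ht := threshold_pos hγ hn hp
  have h := hdev n p hn μ hμ i j (3 / 4 * threshold n p γ) (by positivity) (by linarith)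
  rw [← ofReal_measureReal]
  -- The admissible exponent at 3λ/4 is 8 · 9/16 = 9/2 powers of p, more than the four needed.
  have e : -(8 / γ ^ 2) * n * (3 / 4 * threshold n p γ) ^ 2 = -(9 / 2) * Real.log p := by
    unfold threshold
    rw [mul_pow, mul_pow, Real.sq_sqrt (by positivity)]
    field_simp
    norm_num
  have e2 : ((p : ℝ) ^ 4)⁻¹ = Real.exp (-4 * Real.log p) := by
    rw [neg_mul, Real.exp_neg]
    congr 1
    have := Real.exp_nat_mul (Real.log p) 4
    rw [Real.exp_log hpr] at this
    rw [← this]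
    norm_num
  rw [e] at h
  refine ENNReal.ofReal_le_ofReal (h.trans ?_)
  rw [div_eq_mul_inv C₁, e2]
  refine mul_le_mul_of_nonneg_left ?_ hC₁.le
  rw [Real.exp_le_exp]
  linarith

/-- Each of the p² entries contributes O(p^(-3)), from the eighth moments, from δ^8, and from 2p ·
C₁ p^(-4); in total O(1/p). -/
theorem risk_thresholdEstimator_le {q c γ C₁ δ : ℝ} (hτ : 0 < τ) (hq0 : 0 ≤ q) (hq1 : q < 1)
    (hc : 0 ≤ c) (hγ : 0 < γ) (hC₁ : 0 < C₁) (hdev : DeviationBound τ γ C₁ δ) (hn : 0 < n)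
    (hp : 1 < p) (hδ : threshold n p γ ≤ δ) (hμ : μ ∈ distClass p q τ c) :
    risk (thresholdEstimator n p γ) μ
      ≤ ENNReal.ofReal (2 * (4 * (c * threshold n p γ ^ (1 - q) / (1 - q) + threshold n p γ)) ^ 2
        + (2 ^ 8 * ((8 * τ) ^ 8 * (Nat.factorial 8 : ℕ) * (2 * Real.exp 1))
          + 2 ^ 8 * δ ^ 8 + 2 * C₁) / p) := by
  obtain ⟨hμ, hS⟩ := hμ
  have := hμ.isProb
  have : IsProbabilityMeasure (sampleLaw n μ) := by
    unfold sampleLaw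
    infer_instance
  have hpr : (0 : ℝ) < p := by exact_mod_cast (by omega : 0 < p)
  have hδ0 : 0 < δ := (threshold_pos hγ hn hp).trans_le hδ
  set R := 2 * (4 * (c * threshold n p γ ^ (1 - q) / (1 - q) + threshold n p γ)) ^ 2 with hR
  have hR0 : 0 ≤ R := by positivity
  set M := (8 * τ) ^ 8 * (Nat.factorial 8 : ℕ) * (2 * Real.exp 1) with hM
  have hM0 : 0 < M := by positivity
  set bad : Fin p → Fin p → Set (Sample n p) := fun i j =>
    {X | 3 / 4 * threshold n p γ < |mle X i j - covMat μ i j|} with hbad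
  have hmeas : ∀ i j, Measurable fun X : Sample n p => |mle X i j - covMat μ i j| :=
    fun i j => ((measurable_mle i j).sub_const _).abs
  have hbadm : ∀ i j, MeasurableSet (bad i j) := fun i j =>
    measurableSet_lt measurable_const (hmeas i j)
  have hpt : ∀ X : Sample n p,
      ENNReal.ofReal (specNorm (thresholdEstimator n p γ X - covMat μ) ^ 2)
      ≤ ENNReal.ofReal R + ∑ i, ∑ j, (ENNReal.ofReal (2 ^ 8 / (p : ℝ) ^ 3)
          * ENNReal.ofReal (|mle X i j - covMat μ i j| ^ 8)
        + ENNReal.ofReal (2 ^ 8 * δ ^ 8 / (p : ℝ) ^ 3)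
        + (bad i j).indicator (fun _ => ENNReal.ofReal (2 * p)) X) := by
    intro X
    have hind : ∀ i j, (bad i j).indicator (fun _ => ENNReal.ofReal (2 * (p : ℝ))) X
        = ENNReal.ofReal ((bad i j).indicator (fun _ => 2 * (p : ℝ)) X) := by
      intro i j
      by_cases hX : X ∈ bad i j
      · simp [hX]
      · simp [hX]
    have hind0 : ∀ i j, 0 ≤ (bad i j).indicator (fun _ => 2 * (p : ℝ)) X := fun i j =>
      Set.indicator_nonneg (fun _ _ => by positivity) _
    refine (ENNReal.ofReal_le_ofReal (specNorm_thresholdEstimator_sub_sq_le hq0 hq1 hc hγ.le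
      (by omega) hδ hS X)).trans (le_of_eq ?_)
    rw [ENNReal.ofReal_add hR0 (Finset.sum_nonneg fun i _ => Finset.sum_nonneg fun j _ =>
      add_nonneg (by positivity) (hind0 i j)), ENNReal.ofReal_sum_of_nonneg
      (fun i _ => Finset.sum_nonneg fun j _ => add_nonneg (by positivity) (hind0 i j))]
    congr 1
    refine Finset.sum_congr rfl fun i _ => ?_
    rw [ENNReal.ofReal_sum_of_nonneg (fun j _ => add_nonneg (by positivity) (hind0 i j))]
    refine Finset.sum_congr rfl fun j _ => ?_
    rw [ENNReal.ofReal_add (by positivity) (hind0 i j), ENNReal.ofReal_add (by positivity)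
      (by positivity), hind, ← ENNReal.ofReal_mul (by positivity)]
    congr 3 <;> ring
  have hent : ∀ i j, ∫⁻ X, (ENNReal.ofReal (2 ^ 8 / (p : ℝ) ^ 3)
          * ENNReal.ofReal (|mle X i j - covMat μ i j| ^ 8)
        + ENNReal.ofReal (2 ^ 8 * δ ^ 8 / (p : ℝ) ^ 3)
        + (bad i j).indicator (fun _ => ENNReal.ofReal (2 * p)) X) ∂(sampleLaw n μ)
      ≤ ENNReal.ofReal ((2 ^ 8 * M + 2 ^ 8 * δ ^ 8 + 2 * C₁) / (p : ℝ) ^ 3) := by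
    intro i j
    have hm8 : Measurable fun X : Sample n p => ENNReal.ofReal (|mle X i j - covMat μ i j| ^ 8) :=
      ((hmeas i j).pow_const 8).ennreal_ofReal
    rw [lintegral_add_left ((hm8.const_mul _).add_const _), lintegral_add_left (hm8.const_mul _),
      lintegral_const_mul _ hm8, lintegral_const, measure_univ, mul_one,
      lintegral_indicator_const (hbadm i j)]
    calc _ ≤ ENNReal.ofReal (2 ^ 8 / (p : ℝ) ^ 3) * ENNReal.ofReal M
          + ENNReal.ofReal (2 ^ 8 * δ ^ 8 / (p : ℝ) ^ 3)
          + ENNReal.ofReal (2 * p) * ENNReal.ofReal (C₁ / (p : ℝ) ^ 4) := by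
          gcongr
          · exact hμ.lintegral_mle_sub_covMat_pow_le hτ hn i j
          · exact hdev.measure_bad_le hγ hC₁ hμ hn hp hδ i j
      _ = _ := by
          rw [← ENNReal.ofReal_mul (by positivity), ← ENNReal.ofReal_mul (by positivity),
            ← ENNReal.ofReal_add (by positivity) (by positivity),
            ← ENNReal.ofReal_add (by positivity) (by positivity)]
          congr 1
          field_simp
  have hmt : ∀ i j, Measurable fun X : Sample n p => (ENNReal.ofReal (2 ^ 8 / (p : ℝ) ^ 3)
          * ENNReal.ofReal (|mle X i j - covMat μ i j| ^ 8)
        + ENNReal.ofReal (2 ^ 8 * δ ^ 8 / (p : ℝ) ^ 3)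
        + (bad i j).indicator (fun _ => ENNReal.ofReal (2 * (p : ℝ))) X) := fun i j =>
    (((((hmeas i j).pow_const 8).ennreal_ofReal).const_mul _).add_const _).add
      (measurable_const.indicator (hbadm i j))
  unfold risk
  refine (lintegral_mono hpt).trans ?_
  rw [lintegral_add_left measurable_const, lintegral_const, measure_univ, mul_one,
    lintegral_finsetSum _ (fun i _ => Finset.measurable_sum _ fun j _ => hmt i j)]
  have hsum : ∀ i, ∫⁻ X, ∑ j, (ENNReal.ofReal (2 ^ 8 / (p : ℝ) ^ 3)
          * ENNReal.ofReal (|mle X i j - covMat μ i j| ^ 8)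
        + ENNReal.ofReal (2 ^ 8 * δ ^ 8 / (p : ℝ) ^ 3)
        + (bad i j).indicator (fun _ => ENNReal.ofReal (2 * (p : ℝ))) X) ∂(sampleLaw n μ)
      ≤ p * ENNReal.ofReal ((2 ^ 8 * M + 2 ^ 8 * δ ^ 8 + 2 * C₁) / (p : ℝ) ^ 3) := by
    intro i
    rw [lintegral_finsetSum _ fun j _ => hmt i j]
    refine (Finset.sum_le_sum fun j _ => hent i j).trans (le_of_eq ?_)
    simp
  refine (add_le_add le_rfl (Finset.sum_le_sum fun i _ => hsum i)).trans (le_of_eq ?_)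
  simp only [Finset.sum_const, Finset.card_univ, Fintype.card_fin, nsmul_eq_mul]
  rw [ENNReal.ofReal_add hR0 (by positivity), ← ENNReal.ofReal_natCast,
    ← ENNReal.ofReal_mul (by positivity), ← ENNReal.ofReal_mul (by positivity)]
  congr 2
  field_simp

theorem maxRisk_thresholdEstimator_le {q τ β γ C₁ δ : ℝ} (hq0 : 0 ≤ q) (hq1 : q < 1) (hτ : 0 < τ)
    (hβ : 1 < β) (hγ : 0 < γ) (hC₁ : 0 < C₁) (hδ : 0 < δ) (hdev : DeviationBound τ γ C₁ δ) :
    ∃ C : ℝ, 0 < C ∧ ∀ (n p : ℕ) (c : ℝ), 1 < n → (n : ℝ) ^ β ≤ p → 0 ≤ c →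
        threshold n p γ ≤ δ →
        maxRisk (thresholdEstimator n p γ) q τ c ≤ ENNReal.ofReal (C * rate n p q c) := by
  set M := 2 ^ 8 * ((8 * τ) ^ 8 * (Nat.factorial 8 : ℕ) * (2 * Real.exp 1))
          + 2 ^ 8 * δ ^ 8 + 2 * C₁ with hM
  have hM0 : 0 < M := by positivity
  have hlog2 : 0 < Real.log 2 := Real.log_pos (by norm_num)
  have hq1' : 0 < 1 - q := by linarith
  set A := (γ ^ (1 - q) / (1 - q)) ^ 2 with hA
  have hA0 : 0 < A := by
    have := Real.rpow_pos_of_pos hγ (1 - q)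
    positivity
  refine ⟨64 * A + 64 * γ ^ 2 + M / Real.log 2, by positivity, ?_⟩
  intro n p c hn hnp hc hthr
  have hnr : (1 : ℝ) < n := by exact_mod_cast hn
  have hnp' : (n : ℝ) ≤ p := by
    refine le_trans ?_ hnp
    calc (n : ℝ) = (n : ℝ) ^ (1 : ℝ) := (Real.rpow_one _).symm
      _ ≤ (n : ℝ) ^ β := Real.rpow_le_rpow_of_exponent_le hnr.le hβ.le
  have hnp2 : n ≤ p := by exact_mod_cast hnp'
  have hp : 1 < p := by omega
  have hp2 : (2 : ℝ) ≤ p := by exact_mod_cast hp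
  have hlogp : Real.log 2 ≤ Real.log p := Real.log_le_log (by norm_num) hp2
  refine iSup₂_le fun μ hμ => ?_
  refine (risk_thresholdEstimator_le hτ hq0 hq1 hc hγ hC₁ hdev (by omega) hp hthr hμ).trans
    (ENNReal.ofReal_le_ofReal ?_)
  rw [← hM]
  unfold rate threshold
  set x := Real.log p / n with hx
  have hx0 : 0 < x := div_pos (hlog2.trans_le hlogp) (by linarith)
  have h1 : (γ * √x) ^ (1 - q) = γ ^ (1 - q) * √x ^ (1 - q) :=
    Real.mul_rpow hγ.le (Real.sqrt_nonneg _)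
  have h2 : (√x ^ (1 - q)) ^ 2 = x ^ (1 - q) := by
    rw [Real.sqrt_eq_rpow, ← Real.rpow_mul hx0.le, ← Real.rpow_natCast, ← Real.rpow_mul hx0.le]
    congr 1
    push_cast
    ring
  have h3 : (c * (γ * √x) ^ (1 - q) / (1 - q)) ^ 2 = A * (c ^ 2 * x ^ (1 - q)) := by
    rw [h1, ← h2, hA]
    ring
  have h4 : (γ * √x) ^ 2 = γ ^ 2 * x := by
    rw [mul_pow, Real.sq_sqrt hx0.le]
  -- Since n ≤ p and log 2 ≤ log p, the remainder 1/p is absorbed by log p / n.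
  have h5 : M / p ≤ M / Real.log 2 * x := by
    rw [hx, div_mul_div_comm, div_le_div_iff₀ (by linarith) (by positivity)]
    have : Real.log 2 * n ≤ Real.log p * p := mul_le_mul hlogp hnp' (by linarith) (by linarith)
    nlinarith
  have h6 : 2 * (4 * (c * (γ * √x) ^ (1 - q) / (1 - q) + γ * √x)) ^ 2
      ≤ 64 * (A * (c ^ 2 * x ^ (1 - q))) + 64 * (γ ^ 2 * x) := by
    rw [← h3, ← h4]
    nlinarith [sq_nonneg (c * (γ * √x) ^ (1 - q) / (1 - q) - γ * √x)]
  have h7 : 0 ≤ c ^ 2 * x ^ (1 - q) := mul_nonneg (sq_nonneg _) (Real.rpow_nonneg hx0.le _)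
  have h8 : 0 < M / Real.log 2 := by positivity
  nlinarith [mul_nonneg hA0.le hx0.le, mul_nonneg (sq_nonneg γ) h7, mul_nonneg h8.le h7]

/-! ### The zero estimator -/

theorem IsSubgaussian.integral_inner_sq_le (h : IsSubgaussian μ τ) (hτ : 0 < τ)
    (v : EuclideanSpace ℝ (Fin p)) :
    ∫ x, inner ℝ v (x - ∫ y, y ∂μ) ^ 2 ∂μ ≤ 8 * τ * ‖v‖ ^ 2 := by
  rcases eq_or_ne v 0 with rfl | hv
  · simp
  have hv' : ‖v‖ ≠ 0 := norm_ne_zero_iff.2 hv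
  set u := ‖v‖⁻¹ • v with hu
  have hu1 : ‖u‖ = 1 := by
    rw [hu, norm_smul, norm_inv, norm_norm, inv_mul_cancel₀ hv']
  have hvu : v = ‖v‖ • u := by
    rw [hu, smul_smul, mul_inv_cancel₀ hv', one_smul]
  have e : ∀ x, inner ℝ v (x - ∫ y, y ∂μ) ^ 2 = ‖v‖ ^ 2 * inner ℝ u (x - ∫ y, y ∂μ) ^ 2 := by
    intro x
    nth_rewrite 1 [hvu]
    rw [real_inner_smul_left, mul_pow]
  simp only [e, integral_const_mul]
  rw [mul_comm]
  refine mul_le_mul_of_nonneg_right ?_ (sq_nonneg _)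
  have hle : ∫ x, inner ℝ u (x - ∫ y, y ∂μ) ^ 2 ∂μ
      ≤ ∫ x, 4 * τ * Real.exp (1 / (4 * τ) * inner ℝ u (x - ∫ y, y ∂μ) ^ 2) ∂μ := by
    refine integral_mono_of_nonneg (Filter.Eventually.of_forall fun x => sq_nonneg _)
      ((h.integrable_exp_inner_sq hτ hu1).const_mul (4 * τ))
      (Filter.Eventually.of_forall fun x => ?_)
    have h1 := Real.add_one_le_exp (1 / (4 * τ) * inner ℝ u (x - ∫ y, y ∂μ) ^ 2)
    have h2 : 4 * τ * (1 / (4 * τ) * inner ℝ u (x - ∫ y, y ∂μ) ^ 2)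
        = inner ℝ u (x - ∫ y, y ∂μ) ^ 2 := by
      field_simp
    simp only
    nlinarith
  rw [integral_const_mul] at hle
  nlinarith [h.integral_exp_inner_sq_le hτ hu1]

theorem IsSubgaussian.inner_eq_sum (h : IsSubgaussian μ τ) (v x : EuclideanSpace ℝ (Fin p)) :
    inner ℝ v (x - ∫ y, y ∂μ) = ∑ i, v i * centered μ i x := by
  rw [PiLp.inner_apply]
  refine Finset.sum_congr rfl fun i _ => ?_
  rw [PiLp.sub_apply, h.integral_apply]
  simp [centered, mul_comm]

/-- Every projection ⟨v, X - EX⟩ has second moment at most 8τ‖v‖². For y = Σx, the pairing of y with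
Σx is the mixed second moment of the projections on y and x. -/
theorem IsSubgaussian.specNorm_covMat_le (h : IsSubgaussian μ τ) (hτ : 0 < τ) :
    specNorm (covMat μ) ≤ 8 * τ := by
  have hint : ∀ v : EuclideanSpace ℝ (Fin p),
      Integrable (fun x => inner ℝ v (x - ∫ y, y ∂μ) ^ 2) μ := by
    intro v
    have e : ∀ x, inner ℝ v (x - ∫ y, y ∂μ) ^ 2
        = ∑ i, ∑ j, (v i * v j) * (centered μ i x * centered μ j x) := by
      intro x
      rw [h.inner_eq_sum, sq, Finset.sum_mul_sum]
      exact Finset.sum_congr rfl fun i _ => Finset.sum_congr rfl fun j _ => by ring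
    simp only [e]
    exact integrable_finsetSum _ fun i _ => integrable_finsetSum _ fun j _ =>
      (h.integrable_centered_mul hτ i j).const_mul _
  refine specNorm_le_of_sq (by positivity) fun x => ?_
  set y : EuclideanSpace ℝ (Fin p) :=
    Matrix.toEuclideanCLM (n := Fin p) (𝕜 := ℝ) (covMat μ) x with hy
  have hyi : ∀ i, ∑ j, covMat μ i j * x j = y i := fun i => (toEuclideanCLM_apply _ _ _).symm
  simp only [hyi]
  have hx2 : ∑ j, x j ^ 2 = ‖x‖ ^ 2 := by
    rw [EuclideanSpace.norm_sq_eq]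
    simp
  have hy2 : ∑ j, y j ^ 2 = ‖y‖ ^ 2 := by
    rw [EuclideanSpace.norm_sq_eq]
    simp
  rw [hx2, hy2, ← mul_pow]
  refine pow_le_pow_left₀ (norm_nonneg _) ?_ 2
  have hbil : ∀ u : EuclideanSpace ℝ (Fin p), ∑ i, u i * y i
      = ∫ z, inner ℝ u (z - ∫ y, y ∂μ) * inner ℝ x (z - ∫ y, y ∂μ) ∂μ := by
    intro u
    have e : ∀ z, inner ℝ u (z - ∫ y, y ∂μ) * inner ℝ x (z - ∫ y, y ∂μ)
        = ∑ i, ∑ j, (u i * x j) * (centered μ i z * centered μ j z) := by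
      intro z
      rw [h.inner_eq_sum, h.inner_eq_sum, Finset.sum_mul_sum]
      exact Finset.sum_congr rfl fun i _ => Finset.sum_congr rfl fun j _ => by ring
    simp only [e]
    rw [integral_finsetSum _ fun i _ => integrable_finsetSum _ fun j _ =>
      (h.integrable_centered_mul hτ i j).const_mul _]
    refine Finset.sum_congr rfl fun i _ => ?_
    rw [integral_finsetSum _ fun j _ => (h.integrable_centered_mul hτ i j).const_mul _, ← hyi,
      Finset.mul_sum]
    refine Finset.sum_congr rfl fun j _ => ?_
    rw [integral_const_mul, covMat_apply]
    ring
  rcases eq_or_ne y 0 with hy0 | hy0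
  · rw [hy0]
    simp only [norm_zero]
    positivity
  rcases eq_or_ne x 0 with hx0 | hx0
  · exact absurd (by rw [hy, hx0, map_zero]) hy0
  have hyn : 0 < ‖y‖ := norm_pos_iff.2 hy0
  have hxn : 0 < ‖x‖ := norm_pos_iff.2 hx0
  -- Rescaling y to the norm of x makes the inequality 2|ab| ≤ a² + b² lossless.
  set s := ‖x‖ / ‖y‖ with hs
  have hs0 : 0 < s := by positivity
  have h1 : s * ‖y‖ ^ 2 ≤ 8 * τ * ‖x‖ ^ 2 := by
    have h2 := hbil (s • y)
    have h3 : ∑ i, (s • y) i * y i = s * ‖y‖ ^ 2 := by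
      rw [← hy2, Finset.mul_sum]
      refine Finset.sum_congr rfl fun i _ => ?_
      rw [PiLp.smul_apply, smul_eq_mul]
      ring
    rw [← h3, h2]
    calc _ ≤ ∫ z, (inner ℝ (s • y) (z - ∫ y, y ∂μ) ^ 2 + inner ℝ x (z - ∫ y, y ∂μ) ^ 2) / 2 ∂μ := by
          refine integral_mono (((hint (s • y)).add (hint x)).div_const 2 |>.mono' (by fun_prop)
            (Filter.Eventually.of_forall fun z => abs_mul_le_half_sq_add_sq _ _))
            (((hint (s • y)).add (hint x)).div_const 2) fun z => ?_
          exact (le_abs_self _).trans (abs_mul_le_half_sq_add_sq _ _)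
      _ = (∫ z, inner ℝ (s • y) (z - ∫ y, y ∂μ) ^ 2 ∂μ
          + ∫ z, inner ℝ x (z - ∫ y, y ∂μ) ^ 2 ∂μ) / 2 := by
          rw [integral_div, integral_add (hint _) (hint _)]
      _ ≤ (8 * τ * ‖s • y‖ ^ 2 + 8 * τ * ‖x‖ ^ 2) / 2 := by
          have := h.integral_inner_sq_le hτ (s • y)
          have := h.integral_inner_sq_le hτ x
          linarith
      _ = 8 * τ * ‖x‖ ^ 2 := by
          have : ‖s • y‖ = ‖x‖ := by
            rw [norm_smul, Real.norm_eq_abs, abs_of_pos hs0, hs]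
            field_simp
          rw [this]
          ring
  have h4 : s * ‖y‖ ^ 2 = ‖x‖ * ‖y‖ := by
    rw [hs]
    field_simp
  rw [h4] at h1
  have h5 : ‖x‖ * ‖y‖ ≤ ‖x‖ * (8 * τ * ‖x‖) := by linarith
  exact le_of_mul_le_mul_left h5 hxn

theorem maxRisk_zero_le {q c : ℝ} (hτ : 0 < τ) :
    maxRisk (fun _ : Sample n p => 0) q τ c ≤ ENNReal.ofReal ((8 * τ) ^ 2) := by
  refine iSup₂_le fun μ hμ => ?_
  have := hμ.1.isProb
  have : IsProbabilityMeasure (sampleLaw n μ) := by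
    unfold sampleLaw
    infer_instance
  unfold risk
  have e : specNorm (0 - covMat μ) = specNorm (covMat μ) := by
    unfold specNorm
    rw [zero_sub, map_neg, norm_neg]
  rw [lintegral_const, measure_univ, mul_one, e]
  exact ENNReal.ofReal_le_ofReal
    (pow_le_pow_left₀ (specNorm_nonneg _) (hμ.1.specNorm_covMat_le hτ) 2)

/-- There is no constraint on the threshold here: when it exceeds δ, log p / n is at least (δ/γ)²,
so the bounded risk of the zero estimator is already of the order of the rate. -/
theorem minimaxRisk_le {q β τ : ℝ} (hq0 : 0 ≤ q) (hq1 : q < 1) (hτ : 0 < τ) (hβ : 1 < β) :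
    ∃ C : ℝ, 0 < C ∧ ∀ (n p : ℕ) (c : ℝ), 1 < n → (n : ℝ) ^ β ≤ p → 0 ≤ c →
      minimaxRisk n p q τ c ≤ ENNReal.ofReal (C * rate n p q c) := by
  obtain ⟨γ, C₁, δ, hγ, hC₁, hδ, hdev⟩ := exists_deviationBound hτ
  obtain ⟨C, hC, h⟩ := maxRisk_thresholdEstimator_le hq0 hq1 hτ hβ hγ hC₁ hδ hdev
  refine ⟨max C ((8 * τ) ^ 2 * (γ / δ) ^ 2), lt_max_of_lt_left hC, fun n p c hn hnp hc => ?_⟩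
  have hx0 : 0 ≤ Real.log p / n := div_nonneg (Real.log_natCast_nonneg p) (Nat.cast_nonneg n)
  have h7 : 0 ≤ c ^ 2 * (Real.log p / n) ^ (1 - q) :=
    mul_nonneg (sq_nonneg _) (Real.rpow_nonneg hx0 _)
  have hrate : 0 ≤ rate n p q c := add_nonneg h7 hx0
  rcases le_or_gt (threshold n p γ) δ with hthr | hthr
  · refine (iInf₂_le _ (IsEstimator.thresholdEstimator γ)).trans ((h n p c hn hnp hc hthr).trans
      (ENNReal.ofReal_le_ofReal ?_))
    gcongr
    exact le_max_left _ _
  · have hest : IsEstimator (fun _ : Sample n p => (0 : Matrix (Fin p) (Fin p) ℝ)) :=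
      fun i j => measurable_const
    refine (iInf₂_le _ hest).trans ((maxRisk_zero_le hτ).trans (ENNReal.ofReal_le_ofReal ?_))
    have h1 : δ ^ 2 ≤ γ ^ 2 * (Real.log p / n) := by
      have := pow_le_pow_left₀ hδ.le hthr.le 2
      unfold threshold at this
      rwa [mul_pow, Real.sq_sqrt hx0] at this
    have h2 : 1 ≤ (γ / δ) ^ 2 * (Real.log p / n) := by
      rw [div_pow, div_mul_eq_mul_div, le_div_iff₀ (by positivity)]
      linarith
    calc (8 * τ) ^ 2 = (8 * τ) ^ 2 * 1 := (mul_one _).symm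
      _ ≤ (8 * τ) ^ 2 * ((γ / δ) ^ 2 * (Real.log p / n)) := by gcongr
      _ = (8 * τ) ^ 2 * (γ / δ) ^ 2 * (Real.log p / n) := by ring
      _ ≤ (8 * τ) ^ 2 * (γ / δ) ^ 2 * rate n p q c := by
          gcongr
          unfold rate
          linarith
      _ ≤ _ := by
          gcongr
          exact le_max_right _ _

end

/-! ### Finitely supported laws -/

section

variable {Ω E : Type*} [Fintype Ω] [MeasurableSpace E]

/-- The law of `X` under the weights `w` on a finite space. -/
noncomputable def finLaw (w : Ω → ℝ) (X : Ω → E) : Measure E :=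
  ∑ ω, ENNReal.ofReal (w ω) • Measure.dirac (X ω)

/-- For finitely supported laws every function is integrable, measurable or not. This removes all
measurability questions from the lower bounds. -/
theorem integrable_finLaw [MeasurableSingletonClass E] {F : Type*} [NormedAddCommGroup F]
    (w : Ω → ℝ) (X : Ω → E) (f : E → F) : Integrable f (finLaw w X) := by
  unfold finLaw
  rw [integrable_finsetSum_measure]
  intro ω _
  exact (integrable_dirac (by simp)).smul_measure ENNReal.ofReal_ne_top

theorem integral_finLaw [MeasurableSingletonClass E] {F : Type*} [NormedAddCommGroup F]
    [NormedSpace ℝ F] [CompleteSpace F] {w : Ω → ℝ} (hw : ∀ ω, 0 ≤ w ω) (X : Ω → E) (f : E → F) :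
    ∫ x, f x ∂(finLaw w X) = ∑ ω, w ω • f (X ω) := by
  unfold finLaw
  rw [integral_finsetSum_measure]
  · refine Finset.sum_congr rfl fun ω _ => ?_
    rw [integral_smul_measure, integral_dirac, ENNReal.toReal_ofReal (hw ω)]
  · intro ω _
    exact (integrable_dirac (by simp)).smul_measure ENNReal.ofReal_ne_top

theorem isProbabilityMeasure_finLaw {w : Ω → ℝ} (hw : ∀ ω, 0 ≤ w ω) (h1 : ∑ ω, w ω = 1)
    (X : Ω → E) : IsProbabilityMeasure (finLaw w X) := by
  constructor
  simp only [finLaw, Measure.coe_finsetSum, Finset.sum_apply, Measure.smul_apply,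
    measure_univ, smul_eq_mul, mul_one]
  rw [← ENNReal.ofReal_sum_of_nonneg fun ω _ => hw ω, h1, ENNReal.ofReal_one]

theorem finLaw_apply (w : Ω → ℝ) (X : Ω → E) {s : Set E} (hs : MeasurableSet s) :
    finLaw w X s = ∑ ω, ENNReal.ofReal (w ω) * s.indicator 1 (X ω) := by
  simp [finLaw, Finset.sum_apply, Measure.dirac_apply' _ hs]

/-- An i.i.d. sample from a finite law again has a finite law, so expectations over samples are
finite sums. -/
theorem pi_finLaw {w : Ω → ℝ} (hw : ∀ ω, 0 ≤ w ω) (h1 : ∑ ω, w ω = 1) (X : Ω → E) (n : ℕ) :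
    (Measure.pi fun _ : Fin n => finLaw w X)
      = finLaw (fun ω : Fin n → Ω => ∏ l, w (ω l)) (fun ω l => X (ω l)) := by
  have := isProbabilityMeasure_finLaw hw h1 X
  refine Measure.pi_eq fun s hs => ?_
  rw [finLaw_apply _ _ (MeasurableSet.univ_pi hs)]
  simp only [finLaw_apply _ _ (hs _)]
  rw [Finset.prod_univ_sum]
  simp only [Fintype.piFinset_univ]
  refine Finset.sum_congr rfl fun ω _ => ?_
  rw [Finset.prod_mul_distrib, ENNReal.ofReal_prod_of_nonneg fun l _ => hw _]
  congr 1
  by_cases h : ∀ l, X (ω l) ∈ s l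
  · rw [Set.indicator_of_mem (by simpa [Set.mem_pi] using h)]
    simp [h]
  · rw [Set.indicator_of_notMem (by simpa [Set.mem_pi] using h)]
    push Not at h
    obtain ⟨l, hl⟩ := h
    rw [eq_comm, Finset.prod_eq_zero (Finset.mem_univ l)]
    simp [hl]

/-- Latent variables may be reweighted freely as long as the weights of the observed part are
unchanged. -/
theorem finLaw_eq_of_marginal {U V : Type*} [Fintype U] [Fintype V] {w w' : U × V → ℝ}
    (hw : ∀ ω, 0 ≤ w ω) (hw' : ∀ ω, 0 ≤ w' ω) (X : V → E)
    (h : ∀ v, ∑ u, w (u, v) = ∑ u, w' (u, v)) :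
    finLaw w (fun ω => X ω.2) = finLaw w' (fun ω => X ω.2) := by
  unfold finLaw
  rw [Fintype.sum_prod_type_right, Fintype.sum_prod_type_right]
  refine Finset.sum_congr rfl fun v _ => ?_
  simp only [← Finset.sum_smul]
  rw [← ENNReal.ofReal_sum_of_nonneg fun u _ => hw (u, v),
    ← ENNReal.ofReal_sum_of_nonneg fun u _ => hw' (u, v), h]

end

/-! ### Testing a finite mixture -/

/-- The Bayes risk of testing a point against a mixture, in terms of the second moment of the
likelihood ratio of the mixture. -/
theorem sum_sq_add_mixture_ge {Ω : Type*} [Fintype Ω] {w : Ω → ℝ} (hw : ∀ ω, 0 ≤ w ω)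
    {g : Ω → ℝ} (hg : ∀ ω, 0 ≤ g ω) (hg1 : ∑ ω, w ω * g ω = 1) {B : ℝ} (hB : 0 ≤ B)
    (hg2 : ∑ ω, w ω * g ω ^ 2 ≤ B) {D : Ω → ℝ} {δ : ℝ} (hδ : 0 ≤ δ) :
    δ ^ 2 / (1 + B) ≤ ∑ ω, w ω * (D ω ^ 2 + g ω * (max 0 (δ - |D ω|)) ^ 2) := by
  set s := 1 / (1 + B) with hs
  have hs0 : 0 < s := by positivity
  have hpt : ∀ ω, δ ^ 2 * ((2 * s - s ^ 2) * g ω - s ^ 2 * g ω ^ 2)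
      ≤ D ω ^ 2 + g ω * (max 0 (δ - |D ω|)) ^ 2 := by
    intro ω
    set e := max 0 (δ - |D ω|) with he
    have he1 : δ ≤ |D ω| + e := by linarith [le_max_right 0 (δ - |D ω|)]
    have he0 : 0 ≤ e := le_max_left _ _
    have hg0 := hg ω
    -- The minimum of D² + g e² subject to |D| + e ≥ δ is δ² g/(1 + g).
    have h1 : δ ^ 2 * g ω ≤ (1 + g ω) * (D ω ^ 2 + g ω * e ^ 2) := by
      have h2 : δ ^ 2 ≤ (|D ω| + e) ^ 2 := pow_le_pow_left₀ hδ he1 2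
      have h3 : δ ^ 2 * g ω ≤ (|D ω| + e) ^ 2 * g ω := mul_le_mul_of_nonneg_right h2 hg0
      rw [← sq_abs (D ω)]
      nlinarith [sq_nonneg (|D ω| - g ω * e)]
    -- Expanding g (1 - s(1 + g))² ≥ 0 bounds g/(1 + g) below by a quadratic in g, whose mean needs
    -- only the first two moments. The choice s = 1/(1 + B) makes the result δ²/(1 + B).
    have h4 : (2 * s - s ^ 2) * g ω - s ^ 2 * g ω ^ 2 ≤ g ω / (1 + g ω) := by
      rw [le_div_iff₀ (by positivity)]
      nlinarith [mul_nonneg hg0 (sq_nonneg (1 - s * (1 + g ω)))]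
    calc _ ≤ δ ^ 2 * (g ω / (1 + g ω)) := mul_le_mul_of_nonneg_left h4 (sq_nonneg _)
      _ ≤ _ := by
        rw [← mul_div_assoc, div_le_iff₀ (by positivity)]
        linarith
  calc δ ^ 2 / (1 + B) = δ ^ 2 * ((2 * s - s ^ 2) * 1 - s ^ 2 * B) := by
        rw [hs]
        field_simp
        ring
    _ ≤ δ ^ 2 * ((2 * s - s ^ 2) * ∑ ω, w ω * g ω - s ^ 2 * ∑ ω, w ω * g ω ^ 2) := by
        rw [hg1]
        gcongr
    _ = ∑ ω, w ω * (δ ^ 2 * ((2 * s - s ^ 2) * g ω - s ^ 2 * g ω ^ 2)) := by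
        rw [Finset.mul_sum, Finset.mul_sum, ← Finset.sum_sub_distrib, Finset.mul_sum]
        exact Finset.sum_congr rfl fun ω _ => by ring
    _ ≤ _ := Finset.sum_le_sum fun ω _ => mul_le_mul_of_nonneg_left (hpt ω) (hw ω)

theorem sum_prod_fun {ι Ω K : Type*} [Fintype ι] [DecidableEq ι] [Fintype Ω] [CommSemiring K]
    (f : ι → Ω → K) :
    ∑ ω : ι → Ω, ∏ l, f l (ω l) = ∏ l, ∑ a, f l a := by
  rw [Finset.prod_univ_sum, Fintype.piFinset_univ]

/-- An error D under the base law and errors F a under the alternatives that cannot both be small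
must add up to order δ² on average. The second moment of the mixture's likelihood ratio is an
average over pairs, and each pair factorizes over the n observations into an n-th power. -/
theorem card_mul_sq_le_integral_add_sum {Ω A E : Type*} [Fintype Ω] [Nonempty A] [Fintype A]
    [MeasurableSpace E] [MeasurableSingletonClass E] {w : Ω → ℝ} (hw : ∀ ω, 0 ≤ w ω)
    (hw1 : ∑ ω, w ω = 1) {h : A → Ω → ℝ} (hh : ∀ a ω, 0 ≤ h a ω)
    (hh1 : ∀ a, ∑ ω, w ω * h a ω = 1) {n : ℕ} {B : ℝ} (hB : 0 ≤ B)
    (hpair : ∑ a, ∑ b, (∑ ω, w ω * h a ω * h b ω) ^ n ≤ B * (Fintype.card A : ℝ) ^ 2)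
    (X : Ω → E) {D : (Fin n → E) → ℝ} {F : A → (Fin n → E) → ℝ} {δ : ℝ} (hδ : 0 ≤ δ)
    (hF : ∀ a x, δ ≤ |D x| + |F a x|) :
    (Fintype.card A : ℝ) * (δ ^ 2 / (1 + B))
      ≤ Fintype.card A * ∫ x, D x ^ 2 ∂(Measure.pi fun _ : Fin n => finLaw w X)
        + ∑ a, ∫ x, F a x ^ 2 ∂(Measure.pi fun _ : Fin n => finLaw (fun ω => w ω * h a ω) X) := by
  have hA : (0 : ℝ) < Fintype.card A := by exact_mod_cast Fintype.card_pos
  set N : ℝ := ((Fintype.card A : ℕ) : ℝ) with hN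
  have hwh : ∀ a ω, 0 ≤ w ω * h a ω := fun a ω => mul_nonneg (hw ω) (hh a ω)
  have hint0 : ∫ x, D x ^ 2 ∂(Measure.pi fun _ : Fin n => finLaw w X)
      = ∑ ω : Fin n → Ω, (∏ l, w (ω l)) * D (fun l => X (ω l)) ^ 2 := by
    rw [pi_finLaw hw hw1, integral_finLaw fun ω => Finset.prod_nonneg fun l _ => hw _]
    rfl
  have hinta : ∀ a, ∫ x, F a x ^ 2 ∂(Measure.pi fun _ : Fin n => finLaw (fun ω => w ω * h a ω) X)
      = ∑ ω : Fin n → Ω, (∏ l, w (ω l)) * ((∏ l, h a (ω l)) * F a (fun l => X (ω l)) ^ 2) := by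
    intro a
    rw [pi_finLaw (hwh a) (hh1 a), integral_finLaw fun ω => Finset.prod_nonneg fun l _ => hwh a _]
    refine Finset.sum_congr rfl fun ω _ => ?_
    rw [Finset.prod_mul_distrib, smul_eq_mul, mul_assoc]
  set W : (Fin n → Ω) → ℝ := fun ω => ∏ l, w (ω l) with hW
  set g : (Fin n → Ω) → ℝ := fun ω => N⁻¹ * ∑ a, ∏ l, h a (ω l) with hg
  have hg0 : ∀ ω, 0 ≤ g ω := fun ω => mul_nonneg (inv_pos.2 hA).le
    (Finset.sum_nonneg fun a _ => Finset.prod_nonneg fun l _ => hh a _)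
  have hg1 : ∑ ω, W ω * g ω = 1 := by
    have e : ∀ ω, W ω * g ω = N⁻¹ * ∑ a, ∏ l, (w (ω l) * h a (ω l)) := by
      intro ω
      simp only [hW, hg, Finset.prod_mul_distrib, ← Finset.mul_sum]
      ring
    have e1 : ∀ a, ∑ ω : Fin n → Ω, ∏ l, (w (ω l) * h a (ω l)) = 1 := by
      intro a
      rw [sum_prod_fun (fun _ : Fin n => fun o => w o * h a o)]
      simp [hh1]
    rw [Finset.sum_congr rfl fun ω _ => e ω, ← Finset.mul_sum, Finset.sum_comm,
      Finset.sum_congr rfl fun a _ => e1 a, Finset.sum_const, Finset.card_univ, nsmul_eq_mul,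
      mul_one]
    exact inv_mul_cancel₀ hA.ne'
  have hg2 : ∑ ω, W ω * g ω ^ 2 ≤ B := by
    have e : ∀ ω, W ω * g ω ^ 2
        = (N ^ 2)⁻¹ * ∑ a, ∑ b, ∏ l, (w (ω l) * h a (ω l) * h b (ω l)) := by
      intro ω
      simp only [hW, hg, Finset.prod_mul_distrib]
      rw [mul_pow, sq (∑ a, _), Finset.sum_mul_sum, inv_pow]
      simp only [mul_assoc, ← Finset.mul_sum]
      ring
    have e2 : ∀ a b, ∑ ω : Fin n → Ω, ∏ l, (w (ω l) * h a (ω l) * h b (ω l))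
        = (∑ ω, w ω * h a ω * h b ω) ^ n := by
      intro a b
      rw [sum_prod_fun (fun _ : Fin n => fun o => w o * h a o * h b o)]
      simp
    rw [Finset.sum_congr rfl fun ω _ => e ω, ← Finset.mul_sum, Finset.sum_comm,
      Finset.sum_congr rfl fun a _ => Finset.sum_comm,
      Finset.sum_congr rfl fun a _ => Finset.sum_congr rfl fun b _ => e2 a b,
      inv_mul_le_iff₀ (by positivity), mul_comm]
    exact hpair
  have hmain := sum_sq_add_mixture_ge (w := W)
    (fun ω => Finset.prod_nonneg fun l _ => hw _) hg0 hg1 hB hg2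
    (D := fun ω => D (fun l => X (ω l))) hδ
  have hmain2 := mul_le_mul_of_nonneg_left hmain hA.le
  refine hmain2.trans ?_
  rw [hint0]
  simp only [hinta]
  rw [Finset.sum_comm, Finset.mul_sum, Finset.mul_sum, ← Finset.sum_add_distrib]
  refine Finset.sum_le_sum fun ω _ => ?_
  have hW0 : 0 ≤ W ω := Finset.prod_nonneg fun l _ => hw _
  rw [← Finset.mul_sum, mul_left_comm, mul_left_comm N, ← mul_add]
  refine mul_le_mul_of_nonneg_left ?_ hW0
  rw [mul_add]
  refine add_le_add le_rfl ?_
  simp only [hg]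
  rw [← mul_assoc, mul_inv_cancel_left₀ hA.ne', Finset.sum_mul]
  refine Finset.sum_le_sum fun a _ => ?_
  refine mul_le_mul_of_nonneg_left ?_ (Finset.prod_nonneg fun l _ => hh a _)
  -- Each |F a| is at least the shortfall max(0, δ - |D|), which does not depend on a and can be
  -- weighted by the mixture ratio.
  rw [← sq_abs (F a _)]
  refine pow_le_pow_left₀ (le_max_left _ _) (max_le (abs_nonneg _) ?_) 2
  linarith [hF a (fun l => X (ω l))]

/-! ### Discrete subgaussian laws with an atom at the origin -/

/-- The weights of the law that is degenerate with probability one half. -/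
noncomputable def atomWeight {Ω : Type*} (w : Ω → ℝ) (b : Bool × Ω) : ℝ := w b.2 / 2

theorem atomWeight_nonneg {Ω : Type*} {w : Ω → ℝ} (hw : ∀ ω, 0 ≤ w ω) (b : Bool × Ω) :
    0 ≤ atomWeight w b :=
  div_nonneg (hw _) (by norm_num)

section

variable {Ω : Type*} [Fintype Ω] {p : ℕ} {τ : ℝ}

/-- The vector that equals a multiple of `Y` with probability one half and `0` otherwise. -/
noncomputable def atomVec (τ : ℝ) (Y : Ω → Fin p → ℝ) (b : Bool × Ω) :
    EuclideanSpace ℝ (Fin p) :=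
  if b.1 then WithLp.toLp 2 (fun i => √τ / 2 * Y b.2 i) else 0

/-- The equal mixture of the point mass at `0` and the law of `(√τ / 2) Y`. -/
noncomputable def atomLaw (τ : ℝ) (w : Ω → ℝ) (Y : Ω → Fin p → ℝ) :
    Measure (EuclideanSpace ℝ (Fin p)) :=
  finLaw (atomWeight w) (atomVec τ Y)

theorem integrable_atomLaw (w : Ω → ℝ) (Y : Ω → Fin p → ℝ) {F : Type*} [NormedAddCommGroup F]
    (f : EuclideanSpace ℝ (Fin p) → F) : Integrable f (atomLaw τ w Y) :=
  integrable_finLaw _ _ _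

theorem sum_atomWeight_mul (w : Ω → ℝ) (f : Bool × Ω → ℝ) :
    ∑ b, atomWeight w b * f b
      = ((∑ ω, w ω * f (true, ω)) + ∑ ω, w ω * f (false, ω)) / 2 := by
  rw [Fintype.sum_prod_type, Fintype.sum_bool, add_div, Finset.sum_div, Finset.sum_div]
  congr 1 <;> exact Finset.sum_congr rfl fun ω _ => by simp only [atomWeight]; ring

theorem sum_atomWeight {w : Ω → ℝ} (h1 : ∑ ω, w ω = 1) : ∑ b, atomWeight w b = 1 := by
  have := sum_atomWeight_mul w fun _ => 1
  simp only [mul_one, h1] at this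
  rw [this]
  norm_num

theorem integral_atomLaw {w : Ω → ℝ} (hw : ∀ ω, 0 ≤ w ω) (h1 : ∑ ω, w ω = 1)
    (Y : Ω → Fin p → ℝ) (f : EuclideanSpace ℝ (Fin p) → ℝ) :
    ∫ x, f x ∂(atomLaw τ w Y)
      = ((∑ ω, w ω * f (WithLp.toLp 2 fun i => √τ / 2 * Y ω i)) + f 0) / 2 := by
  unfold atomLaw
  rw [integral_finLaw (atomWeight_nonneg hw)]
  simp only [smul_eq_mul]
  rw [sum_atomWeight_mul]
  simp only [atomVec, ↓reduceIte, Bool.false_eq_true, ← Finset.sum_mul, h1, one_mul]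

theorem integral_id_atomLaw {w : Ω → ℝ} (hw : ∀ ω, 0 ≤ w ω) (h1 : ∑ ω, w ω = 1)
    {Y : Ω → Fin p → ℝ} (hY : ∀ i, ∑ ω, w ω * Y ω i = 0) :
    ∫ x, x ∂(atomLaw τ w Y) = 0 := by
  ext i
  rw [eval_integral_piLp (f := fun y : EuclideanSpace ℝ (Fin p) => y)
    fun i => integrable_atomLaw _ _ _, integral_atomLaw hw h1]
  simp only [PiLp.zero_apply, add_zero]
  have : ∀ ω, w ω * (√τ / 2 * Y ω i) = √τ / 2 * (w ω * Y ω i) := fun ω => by ring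
  simp only [this, ← Finset.mul_sum, hY, mul_zero, zero_div]

theorem covMat_atomLaw (hτ : 0 ≤ τ) {w : Ω → ℝ} (hw : ∀ ω, 0 ≤ w ω) (h1 : ∑ ω, w ω = 1)
    {Y : Ω → Fin p → ℝ} (hY : ∀ i, ∑ ω, w ω * Y ω i = 0) (i j : Fin p) :
    covMat (atomLaw τ w Y) i j = τ / 8 * ∑ ω, w ω * (Y ω i * Y ω j) := by
  have hm : ∀ k : Fin p, ∫ x, x k ∂(atomLaw τ w Y) = 0 := by
    intro k
    rw [← eval_integral_piLp (f := fun y : EuclideanSpace ℝ (Fin p) => y)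
      fun i => integrable_atomLaw _ _ _, integral_id_atomLaw hw h1 hY]
    rfl
  rw [covMat_apply]
  simp only [centered, hm, sub_zero]
  rw [integral_atomLaw hw h1]
  simp only [PiLp.zero_apply, mul_zero, add_zero]
  have : ∀ ω, w ω * (√τ / 2 * Y ω i * (√τ / 2 * Y ω j)) = τ / 4 * (w ω * (Y ω i * Y ω j)) := by
    intro ω
    have h := Real.mul_self_sqrt hτ
    calc _ = (√τ * √τ) / 4 * (w ω * (Y ω i * Y ω j)) := by ring
      _ = _ := by rw [h]
  simp only [this, ← Finset.mul_sum]
  ring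

/-- Markov's inequality for both signs gives twice the required tail for the scaled vector. The atom
at 0 contributes nothing to it, and its weight 1/2 cancels the factor 2. -/
theorem isSubgaussian_atomLaw (hτ : 0 < τ) {w : Ω → ℝ} (hw : ∀ ω, 0 ≤ w ω) (h1 : ∑ ω, w ω = 1)
    {Y : Ω → Fin p → ℝ} (hY : ∀ i, ∑ ω, w ω * Y ω i = 0)
    (hmgf : ∀ v : Fin p → ℝ, ∑ i, v i ^ 2 = 1 → ∀ l : ℝ,
      ∑ ω, w ω * Real.exp (l * ∑ i, v i * Y ω i) ≤ Real.exp (2 * l ^ 2)) :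
    IsSubgaussian (atomLaw τ w Y) τ where
  isProb := isProbabilityMeasure_finLaw (atomWeight_nonneg hw) (sum_atomWeight h1) _
  integrable := integrable_finLaw _ _ _
  tail := by
    intro v hv t ht
    have := isProbabilityMeasure_finLaw (atomWeight_nonneg hw) (sum_atomWeight h1) (atomVec τ Y)
    have hv2 : ∑ i, v i ^ 2 = 1 := by
      have := EuclideanSpace.norm_sq_eq v
      rw [hv] at this
      simpa using this.symm
    simp only [integral_id_atomLaw hw h1 hY, sub_zero]
    have hms : MeasurableSet {x : EuclideanSpace ℝ (Fin p) | t < |inner ℝ v x|} :=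
      measurableSet_lt measurable_const (by fun_prop)
    rw [← integral_indicator_one hms, integral_atomLaw hw h1,
      Set.indicator_of_notMem (by simpa using ht.le), add_zero]
    set s := √τ / 2 with hs
    have hs0 : 0 < s := by positivity
    have hs2 : s ^ 2 = τ / 4 := by
      rw [hs, div_pow, Real.sq_sqrt hτ.le]
      norm_num
    -- The minimizer of 2l² - l t/s; the value -t²/(8s²) equals -t²/(2τ).
    set l := t / (4 * s) with hl
    have hl0 : 0 < l := by positivity
    have hpt : ∀ ω, {x : EuclideanSpace ℝ (Fin p) | t < |inner ℝ v x|}.indicator 1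
          (WithLp.toLp 2 fun i => s * Y ω i)
        ≤ Real.exp (-(l * (t / s))) * (Real.exp (l * ∑ i, v i * Y ω i)
          + Real.exp (-l * ∑ i, v i * Y ω i)) := by
      intro ω
      by_cases h : (WithLp.toLp 2 fun i => s * Y ω i)
          ∈ {x : EuclideanSpace ℝ (Fin p) | t < |inner ℝ v x|}
      · rw [Set.indicator_of_mem h, Pi.one_apply]
        have he : inner ℝ v (WithLp.toLp 2 fun i => s * Y ω i) = s * ∑ i, v i * Y ω i := by
          rw [PiLp.inner_apply, Finset.mul_sum]
          refine Finset.sum_congr rfl fun i _ => ?_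
          simp only [RCLike.inner_apply, conj_trivial]
          ring
        rw [Set.mem_ofPred_eq, he, abs_mul, abs_of_pos hs0] at h
        set Z := ∑ i, v i * Y ω i
        have hZ : t / s < |Z| := by
          rw [div_lt_iff₀ hs0]
          linarith
        have h3 : 1 ≤ Real.exp (-(l * (t / s))) * Real.exp (l * |Z|) := by
          rw [← Real.exp_add]
          refine Real.one_le_exp ?_
          nlinarith
        refine h3.trans (mul_le_mul_of_nonneg_left ?_ (Real.exp_pos _).le)
        rcases abs_cases Z with ⟨h4, -⟩ | ⟨h4, -⟩
        · rw [h4]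
          linarith [Real.exp_pos (-l * Z)]
        · rw [h4, mul_neg, ← neg_mul]
          linarith [Real.exp_pos (l * Z)]
      · rw [Set.indicator_of_notMem h]
        positivity
    have hsum : ∑ ω, w ω * {x : EuclideanSpace ℝ (Fin p) | t < |inner ℝ v x|}.indicator 1
          (WithLp.toLp 2 fun i => s * Y ω i)
        ≤ Real.exp (-(l * (t / s))) * (Real.exp (2 * l ^ 2) + Real.exp (2 * (-l) ^ 2)) := by
      calc _ ≤ ∑ ω, w ω * (Real.exp (-(l * (t / s))) * (Real.exp (l * ∑ i, v i * Y ω i)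
          + Real.exp (-l * ∑ i, v i * Y ω i))) :=
            Finset.sum_le_sum fun ω _ => mul_le_mul_of_nonneg_left (hpt ω) (hw ω)
        _ = Real.exp (-(l * (t / s))) * (∑ ω, w ω * Real.exp (l * ∑ i, v i * Y ω i)
            + ∑ ω, w ω * Real.exp (-l * ∑ i, v i * Y ω i)) := by
            rw [← Finset.sum_add_distrib, Finset.mul_sum]
            exact Finset.sum_congr rfl fun ω _ => by ring
        _ ≤ _ := by
            gcongr
            · exact hmgf v hv2 l
            · exact hmgf v hv2 (-l)
    have hfin : Real.exp (-(l * (t / s))) * (Real.exp (2 * l ^ 2) + Real.exp (2 * (-l) ^ 2))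
        = 2 * Real.exp (-t ^ 2 / (2 * τ)) := by
      rw [neg_sq, ← two_mul, mul_left_comm, ← Real.exp_add]
      congr 2
      have hτ4 : τ = 4 * s ^ 2 := by linarith
      rw [hl, hτ4]
      field_simp
      ring
    rw [hfin] at hsum
    linarith

theorem integrable_sampleLaw_atomLaw {w : Ω → ℝ} (hw : ∀ ω, 0 ≤ w ω) (h1 : ∑ ω, w ω = 1)
    (Y : Ω → Fin p → ℝ) {n : ℕ} (f : Sample n p → ℝ) :
    Integrable f (sampleLaw n (atomLaw τ w Y)) := by
  unfold sampleLaw atomLaw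
  rw [pi_finLaw (atomWeight_nonneg hw) (sum_atomWeight h1)]
  exact integrable_finLaw _ _ _

theorem integral_specNorm_sq_le_of_maxRisk_le {w : Ω → ℝ} (hw : ∀ ω, 0 ≤ w ω) (h1 : ∑ ω, w ω = 1)
    {Y : Ω → Fin p → ℝ} {n : ℕ} {q c r : ℝ} (hr : 0 ≤ r)
    {T : Sample n p → Matrix (Fin p) (Fin p) ℝ} (hT : maxRisk T q τ c ≤ ENNReal.ofReal r)
    (hmem : atomLaw τ w Y ∈ distClass p q τ c) :
    ∫ X, specNorm (T X - covMat (atomLaw τ w Y)) ^ 2 ∂(sampleLaw n (atomLaw τ w Y)) ≤ r := by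
  have h2 : risk T (atomLaw τ w Y) ≤ ENNReal.ofReal r :=
    (le_iSup₂ (f := fun μ (_ : μ ∈ distClass p q τ c) => risk T μ) _ hmem).trans hT
  unfold risk at h2
  rw [← ofReal_integral_eq_lintegral_ofReal (integrable_sampleLaw_atomLaw hw h1 Y _)
    (Filter.Eventually.of_forall fun X => sq_nonneg _)] at h2
  exact (ENNReal.ofReal_le_ofReal_iff hr).1 h2

/-- The two-point-mixture bound for laws with an atom at the origin. -/
theorem card_mul_sq_le_integral_atomLaw {A : Type*} [Nonempty A] [Fintype A] {w : Ω → ℝ}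
    (hw : ∀ ω, 0 ≤ w ω) (hw1 : ∑ ω, w ω = 1) {h : A → Ω → ℝ} (hh : ∀ a ω, 0 ≤ h a ω)
    (hh1 : ∀ a, ∑ ω, w ω * h a ω = 1) {n : ℕ} {B : ℝ} (hB : 0 ≤ B)
    (hpair : ∑ a, ∑ b, (∑ ω, w ω * h a ω * h b ω) ^ n ≤ B * (Fintype.card A : ℝ) ^ 2)
    (Y : Ω → Fin p → ℝ) {D : Sample n p → ℝ} {F : A → Sample n p → ℝ} {δ : ℝ} (hδ : 0 ≤ δ)
    (hF : ∀ a x, δ ≤ |D x| + |F a x|) :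
    (Fintype.card A : ℝ) * (δ ^ 2 / (1 + B))
      ≤ Fintype.card A * ∫ x, D x ^ 2 ∂(sampleLaw n (atomLaw τ w Y))
        + ∑ a, ∫ x, F a x ^ 2 ∂(sampleLaw n (atomLaw τ (fun ω => w ω * h a ω) Y)) := by
  have hmul : ∀ a, (fun b => atomWeight w b * h a b.2) = atomWeight fun ω => w ω * h a ω := by
    intro a
    ext b
    simp only [atomWeight]
    ring
  have hsum : ∀ f : Ω → ℝ, ∑ b, atomWeight w b * f b.2 = ∑ ω, w ω * f ω := by
    intro f
    rw [sum_atomWeight_mul]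
    simp
  have key := card_mul_sq_le_integral_add_sum (n := n) (atomWeight_nonneg hw) (sum_atomWeight hw1)
    (h := fun a b => h a b.2) (fun a b => hh a b.2) (fun a => by rw [hsum, hh1]) hB
    (by
      refine le_trans (le_of_eq ?_) hpair
      refine Finset.sum_congr rfl fun a _ => Finset.sum_congr rfl fun b _ => ?_
      have := hsum fun ω => h a ω * h b ω
      simp only [← mul_assoc] at this
      rw [this]) (atomVec τ Y) hδ hF
  simp only [hmul] at key
  exact key

end

/-- Reduces to a finite worst-case risk r, an infinite one being trivial. Measurability of T is
dropped, since finite laws do not need it. -/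
theorem le_minimaxRisk_of_forall {n p : ℕ} {q τ c x : ℝ}
    (h : ∀ (T : Sample n p → Matrix (Fin p) (Fin p) ℝ) (r : ℝ), 0 ≤ r →
      maxRisk T q τ c ≤ ENNReal.ofReal r → x ≤ r) :
    ENNReal.ofReal x ≤ minimaxRisk n p q τ c := by
  refine le_iInf₂ fun T _ => ?_
  rcases eq_or_ne (maxRisk T q τ c) ⊤ with htop | htop
  · rw [htop]
    exact le_top
  · rw [← ENNReal.ofReal_toReal htop]
    exact ENNReal.ofReal_le_ofReal (h T _ ENNReal.toReal_nonneg (ENNReal.ofReal_toReal htop).ge)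

/-! ### The parametric lower bound -/

section

variable {p : ℕ}

/-- The sign of a bit. -/
noncomputable def bitSign (b : Bool) : ℝ := if b then 1 else -1

/-- A random sign multiplied by a random bit. -/
noncomputable def signedBit (a : Bool × Bool) : ℝ := if a.2 then bitSign a.1 else 0

/-- Product weights under which the `i`-th bit is set with probability `(1 + r i) / 2`. -/
noncomputable def bitWeight (r : Fin p → ℝ) (ω : Fin p → Bool × Bool) : ℝ :=
  ∏ i, (1 / 4 * (1 + r i * bitSign (ω i).2))

theorem sum_prod_mul_apply {ι α : Type*} [Fintype ι] [DecidableEq ι] [Fintype α] {φ : ι → α → ℝ}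
    (hφ : ∀ i, ∑ a, φ i a = 1) (i : ι) (f : α → ℝ) :
    ∑ ω : ι → α, (∏ k, φ k (ω k)) * f (ω i) = ∑ a, φ i a * f a := by
  have e : ∀ ω : ι → α, (∏ k, φ k (ω k)) * f (ω i)
      = ∏ k, (φ k (ω k) * if k = i then f (ω k) else 1) := by
    intro ω
    rw [Finset.prod_mul_distrib, Finset.prod_ite_eq' Finset.univ i fun k => f (ω k)]
    simp
  simp only [e]
  rw [sum_prod_fun (fun k a => φ k a * if k = i then f a else 1), Finset.prod_eq_single i]
  · simp
  · intro k _ hk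
    simp [hk, hφ]
  · simp

theorem sum_prod_mul_apply_mul_apply {ι α : Type*} [Fintype ι] [DecidableEq ι] [Fintype α]
    {φ : ι → α → ℝ} (hφ : ∀ i, ∑ a, φ i a = 1) {i j : ι} (hij : i ≠ j) (f g : α → ℝ) :
    ∑ ω : ι → α, (∏ k, φ k (ω k)) * (f (ω i) * g (ω j))
      = (∑ a, φ i a * f a) * ∑ a, φ j a * g a := by
  have e : ∀ ω : ι → α, (∏ k, φ k (ω k)) * (f (ω i) * g (ω j))
      = ∏ k, (φ k (ω k) * ((if k = i then f (ω k) else 1) * if k = j then g (ω k) else 1)) := by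
    intro ω
    rw [Finset.prod_mul_distrib, Finset.prod_mul_distrib,
      Finset.prod_ite_eq' Finset.univ i fun k => f (ω k),
      Finset.prod_ite_eq' Finset.univ j fun k => g (ω k)]
    simp
  simp only [e]
  rw [sum_prod_fun (fun k a => φ k a * ((if k = i then f a else 1) * if k = j then g a else 1)),
    Fintype.prod_eq_mul i j hij]
  · simp [hij, hij.symm]
  · intro k ⟨hki, hkj⟩
    simp [hki, hkj, hφ]

theorem bitWeight_nonneg {r : Fin p → ℝ} (hr : ∀ i, |r i| ≤ 1) (ω : Fin p → Bool × Bool) :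
    0 ≤ bitWeight r ω := by
  refine Finset.prod_nonneg fun i _ => ?_
  have := abs_le.1 (hr i)
  unfold bitSign
  split_ifs <;> linarith

theorem sum_bitFactor (s : ℝ) : ∑ a : Bool × Bool, (1 / 4 * (1 + s * bitSign a.2)) = 1 := by
  simp [Fintype.sum_prod_type, bitSign]
  ring

theorem sum_bitFactor_mul_signedBit (s : ℝ) :
    ∑ a : Bool × Bool, (1 / 4 * (1 + s * bitSign a.2)) * signedBit a = 0 := by
  simp [Fintype.sum_prod_type, bitSign, signedBit]

theorem sum_bitFactor_mul_signedBit_sq (s : ℝ) :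
    ∑ a : Bool × Bool, (1 / 4 * (1 + s * bitSign a.2)) * (signedBit a * signedBit a)
      = (1 + s) / 2 := by
  simp [Fintype.sum_prod_type, bitSign, signedBit]
  ring

/-- The sum is a convex combination of cosh x and 1, both at most e^{x²/2}. -/
theorem sum_bitFactor_mul_exp_le {s : ℝ} (hs : |s| ≤ 1) (x : ℝ) :
    ∑ a : Bool × Bool, (1 / 4 * (1 + s * bitSign a.2)) * Real.exp (x * signedBit a)
      ≤ Real.exp (x ^ 2 / 2) := by
  have h1 : ∑ a : Bool × Bool, (1 / 4 * (1 + s * bitSign a.2)) * Real.exp (x * signedBit a)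
      = (1 + s) / 2 * Real.cosh x + (1 - s) / 2 := by
    simp [Fintype.sum_prod_type, bitSign, signedBit, Real.cosh_eq]
    ring
  have h2 := Real.cosh_le_exp_half_sq x
  have h3 : 1 ≤ Real.exp (x ^ 2 / 2) := Real.one_le_exp (by positivity)
  have := abs_le.1 hs
  rw [h1]
  nlinarith

theorem sum_bitWeight (r : Fin p → ℝ) : ∑ ω, bitWeight r ω = 1 := by
  unfold bitWeight
  rw [sum_prod_fun (fun i (a : Bool × Bool) => 1 / 4 * (1 + r i * bitSign a.2))]
  simp only [sum_bitFactor, Finset.prod_const_one]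

/-- The random vector of independent signed bits. -/
noncomputable def bitVec (ω : Fin p → Bool × Bool) (i : Fin p) : ℝ := signedBit (ω i)

theorem sum_bitWeight_mul_bitVec (r : Fin p → ℝ) (i : Fin p) :
    ∑ ω, bitWeight r ω * bitVec ω i = 0 := by
  unfold bitWeight bitVec
  rw [sum_prod_mul_apply (φ := fun i (a : Bool × Bool) => 1 / 4 * (1 + r i * bitSign a.2))
    (fun i => sum_bitFactor (r i)), sum_bitFactor_mul_signedBit]

theorem atomLaw_bitWeight_isSubgaussian {τ : ℝ} (hτ : 0 < τ) {r : Fin p → ℝ}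
    (hr : ∀ i, |r i| ≤ 1) : IsSubgaussian (atomLaw τ (bitWeight r) bitVec) τ := by
  refine isSubgaussian_atomLaw hτ (bitWeight_nonneg hr) (sum_bitWeight r)
    (sum_bitWeight_mul_bitVec r) fun v hv l => ?_
  have e : ∀ ω : Fin p → Bool × Bool, bitWeight r ω * Real.exp (l * ∑ i, v i * bitVec ω i)
      = ∏ i, ((1 / 4 * (1 + r i * bitSign (ω i).2))
        * Real.exp ((l * v i) * signedBit (ω i))) := by
    intro ω
    rw [Finset.prod_mul_distrib, ← Real.exp_sum, Finset.mul_sum]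
    simp only [mul_assoc, bitWeight, bitVec]
  simp only [e]
  rw [sum_prod_fun (fun i (a : Bool × Bool) => (1 / 4 * (1 + r i * bitSign a.2))
        * Real.exp ((l * v i) * signedBit a))]
  calc _ ≤ ∏ i, Real.exp ((l * v i) ^ 2 / 2) := by
        refine Finset.prod_le_prod (fun i _ => Finset.sum_nonneg fun a _ => ?_)
          fun i _ => sum_bitFactor_mul_exp_le (hr i) _
        have := abs_le.1 (hr i)
        refine mul_nonneg ?_ (Real.exp_pos _).le
        unfold bitSign
        split_ifs <;> linarith
    _ ≤ _ := by
        rw [← Real.exp_sum, Real.exp_le_exp]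
        simp only [mul_pow, ← Finset.sum_div, ← Finset.mul_sum, hv]
        nlinarith [sq_nonneg l]

theorem covMat_atomLaw_bitWeight {τ : ℝ} (hτ : 0 < τ) {r : Fin p → ℝ} (hr : ∀ i, |r i| ≤ 1)
    (i j : Fin p) :
    covMat (atomLaw τ (bitWeight r) bitVec) i j = if i = j then τ / 16 * (1 + r i) else 0 := by
  rw [covMat_atomLaw hτ.le (bitWeight_nonneg hr) (sum_bitWeight r) (sum_bitWeight_mul_bitVec r)]
  unfold bitWeight bitVec
  split_ifs with hij
  · subst hij
    rw [sum_prod_mul_apply (φ := fun i (a : Bool × Bool) => 1 / 4 * (1 + r i * bitSign a.2))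
      (fun i => sum_bitFactor (r i)) i fun a => signedBit a * signedBit a,
      sum_bitFactor_mul_signedBit_sq]
    ring
  · rw [sum_prod_mul_apply_mul_apply
      (φ := fun i (a : Bool × Bool) => 1 / 4 * (1 + r i * bitSign a.2))
      (fun i => sum_bitFactor (r i)) hij signedBit signedBit, sum_bitFactor_mul_signedBit,
      zero_mul, mul_zero]

theorem atomLaw_bitWeight_mem_distClass {q τ c : ℝ} (hq : 0 ≤ q) (hτ : 0 < τ) (hc : 0 ≤ c)
    {r : Fin p → ℝ} (hr : ∀ i, |r i| ≤ 1) :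
    atomLaw τ (bitWeight r) bitVec ∈ distClass p q τ c := by
  refine ⟨atomLaw_bitWeight_isSubgaussian hτ hr, fun j => ?_⟩
  have h0 : ∀ i : {i : Fin p // i ≠ j}, covMat (atomLaw τ (bitWeight r) bitVec) i j = 0 := by
    intro i
    rw [covMat_atomLaw_bitWeight hτ hr, if_neg i.2]
  refine mem_weakBall_of_card_le (d := 0) (b := 0) hq hc ?_ ?_ (by simpa using hc)
  · simp [h0]
  · simp [h0]

/-- The alternative a raises the variance of the single coordinate a by τρ/16. Distinct alternatives
are orthogonal (cross moment 1), and equal ones give (1 + ρ²)^n ≤ p, which is harmless among p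
alternatives. -/
theorem parametric_le_of_maxRisk_le {n : ℕ} {q τ c ρ : ℝ} (hq : 0 ≤ q) (hτ : 0 < τ) (hc : 0 ≤ c)
    (hp : 0 < p) (hρ0 : 0 ≤ ρ) (hρ1 : ρ ≤ 1) (hρn : (1 + ρ ^ 2) ^ n ≤ p)
    {T : Sample n p → Matrix (Fin p) (Fin p) ℝ} {r : ℝ} (hr : 0 ≤ r)
    (hT : maxRisk T q τ c ≤ ENNReal.ofReal r) : (τ / 16 * ρ) ^ 2 / 6 ≤ r := by
  have hpr : (0 : ℝ) < p := by exact_mod_cast hp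
  have : Nonempty (Fin p) := ⟨⟨0, hp⟩⟩
  set R : Fin p → Fin p → ℝ := fun a => Pi.single a ρ with hR
  have hR1 : ∀ a i, |R a i| ≤ 1 := by
    intro a i
    simp only [hR, Pi.single_apply]
    split_ifs
    · rwa [abs_of_nonneg hρ0]
    · simp
  have h01 : ∀ i : Fin p, |(0 : Fin p → ℝ) i| ≤ 1 := by simp
  set h : Fin p → (Fin p → Bool × Bool) → ℝ := fun a ω => ∏ i, (1 + R a i * bitSign (ω i).2) with hh
  have hwh : ∀ a, (fun ω => bitWeight 0 ω * h a ω) = bitWeight (R a) := by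
    intro a
    ext ω
    simp only [bitWeight, hh, ← Finset.prod_mul_distrib]
    refine Finset.prod_congr rfl fun i _ => ?_
    simp
  have hh0 : ∀ a ω, 0 ≤ h a ω := by
    intro a ω
    refine Finset.prod_nonneg fun i _ => ?_
    have := abs_le.1 (hR1 a i)
    unfold bitSign
    split_ifs <;> linarith
  have hpair : ∀ a b, ∑ ω, bitWeight 0 ω * h a ω * h b ω = if a = b then 1 + ρ ^ 2 else 1 := by
    intro a b
    have e : ∀ ω, bitWeight 0 ω * h a ω * h b ω = ∏ i, ((1 / 4 * (1 + R a i * bitSign (ω i).2))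
        * (1 + R b i * bitSign (ω i).2)) := by
      intro ω
      rw [Finset.prod_mul_distrib]
      exact congrArg (· * h b ω) (congrFun (hwh a) ω)
    simp only [e]
    rw [sum_prod_fun (fun i (x : Bool × Bool) => (1 / 4 * (1 + R a i * bitSign x.2))
        * (1 + R b i * bitSign x.2))]
    have e2 : ∀ s t : ℝ, ∑ x : Bool × Bool, (1 / 4 * (1 + s * bitSign x.2))
        * (1 + t * bitSign x.2) = 1 + s * t := by
      intro s t
      simp [Fintype.sum_prod_type, bitSign]
      ring
    simp only [e2, hR]
    rw [Finset.prod_eq_single a]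
    · split_ifs with hab
      · subst hab
        simp [sq]
      · simp [hab]
    · intro i _ hi
      simp [hi]
    · simp
  set μ0 := atomLaw τ (bitWeight (0 : Fin p → ℝ)) bitVec with hμ0
  have key := card_mul_sq_le_integral_atomLaw (τ := τ) (n := n) (bitWeight_nonneg h01)
    (sum_bitWeight 0) hh0 (fun a => by
      have := sum_bitWeight (R a)
      rwa [← hwh a] at this) (B := 2) (by norm_num) (by
      simp only [hpair]
      -- The p² pairs contribute 1 each and the p diagonal ones at most p more, hence B = 2.
      have : ∀ a b : Fin p, (if a = b then 1 + ρ ^ 2 else (1 : ℝ)) ^ n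
          ≤ 1 + if a = b then (p : ℝ) else 0 := by
        intro a b
        split_ifs
        · linarith
        · simp
      refine (Finset.sum_le_sum fun a _ => Finset.sum_le_sum fun b _ => this a b).trans ?_
      simp only [Finset.sum_add_distrib, Finset.sum_const, Finset.card_univ, Fintype.card_fin,
        nsmul_eq_mul, mul_one, Finset.sum_ite_eq, Finset.mem_univ, if_true]
      nlinarith) bitVec
    (D := fun X => specNorm (T X - covMat μ0))
    (F := fun a X => specNorm (T X - covMat (atomLaw τ (bitWeight (R a)) bitVec)))
    (δ := τ / 16 * ρ) (by positivity) (by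
      intro a X
      rw [abs_of_nonneg (specNorm_nonneg _), abs_of_nonneg (specNorm_nonneg _)]
      have h1 := abs_entry_le_specNorm (T X - covMat μ0) a a
      have h2 := abs_entry_le_specNorm (T X - covMat (atomLaw τ (bitWeight (R a)) bitVec)) a a
      rw [Matrix.sub_apply, hμ0, covMat_atomLaw_bitWeight hτ h01, if_pos rfl] at h1
      rw [Matrix.sub_apply, covMat_atomLaw_bitWeight hτ (hR1 a), if_pos rfl] at h2
      simp only [hR, Pi.single_eq_same, Pi.zero_apply] at h1 h2
      rw [abs_le] at h1 h2
      linarith [h1.2, h2.1])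
  simp only [hwh, Fintype.card_fin] at key
  have b0 := integral_specNorm_sq_le_of_maxRisk_le (bitWeight_nonneg h01) (sum_bitWeight 0) hr hT
    (atomLaw_bitWeight_mem_distClass hq hτ hc h01)
  have ba := fun a => integral_specNorm_sq_le_of_maxRisk_le (bitWeight_nonneg (hR1 a))
    (sum_bitWeight (R a)) hr hT (atomLaw_bitWeight_mem_distClass hq hτ hc (hR1 a))
  have hs := Finset.sum_le_sum fun a (_ : a ∈ Finset.univ) => ba a
  simp only [Finset.sum_const, Finset.card_univ, Fintype.card_fin, nsmul_eq_mul] at hs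
  have h4 : (p : ℝ) * ((τ / 16 * ρ) ^ 2 / (1 + 2)) ≤ p * (r + r) := by
    refine key.trans ?_
    rw [mul_add]
    exact add_le_add (mul_le_mul_of_nonneg_left b0 hpr.le) hs
  have h5 := le_of_mul_le_mul_left h4 hpr
  linarith

end

/-! ### Products of random phases -/

section

variable {ι : Type*} [Fintype ι]

/-- The random phase product `∏ j, (1 + i a_j ξ_j)` with signs `ξ`. -/
noncomputable def signPhase (a : ι → ℝ) (ξ : ι → Bool) : ℂ :=
  ∏ j, (1 + (a j * bitSign (ξ j) : ℝ) * Complex.I)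

theorem bitSign_sq (b : Bool) : bitSign b ^ 2 = 1 := by
  cases b <;> simp [bitSign]

/-- The modulus does not depend on the signs. This is the point of the complex product: its
imaginary part is to first order ∑ a_j ξ_j, yet it is uniformly bounded and can serve as a
conditional mean. -/
theorem normSq_signPhase (a : ι → ℝ) (ξ : ι → Bool) :
    Complex.normSq (signPhase a ξ) = ∏ j, (1 + a j ^ 2) := by
  unfold signPhase
  rw [map_prod]
  refine Finset.prod_congr rfl fun j _ => ?_
  rw [← Complex.ofReal_one, Complex.normSq_add_mul_I, mul_pow, bitSign_sq]
  ring

theorem sum_half_mul_signPhase [DecidableEq ι] (a : ι → ℝ) :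
    ∑ ξ : ι → Bool, ((∏ _j : ι, (1 / 2 : ℝ) : ℝ) : ℂ) * signPhase a ξ = 1 := by
  have e : ∀ ξ : ι → Bool, ((∏ _j : ι, (1 / 2 : ℝ) : ℝ) : ℂ) * signPhase a ξ
      = ∏ j, (1 / 2 * (1 + (a j * bitSign (ξ j) : ℝ) * Complex.I)) := by
    intro ξ
    rw [Finset.prod_mul_distrib]
    simp [signPhase]
  simp only [e]
  rw [sum_prod_fun (fun j b => (1 / 2 * (1 + (a j * bitSign b : ℝ) * Complex.I) : ℂ))]
  refine Finset.prod_eq_one fun j _ => ?_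
  simp [bitSign]
  ring

theorem sum_half_mul_im_signPhase [DecidableEq ι] (a : ι → ℝ) :
    ∑ ξ : ι → Bool, (∏ _j : ι, (1 / 2 : ℝ)) * (signPhase a ξ).im = 0 := by
  have h := congrArg Complex.im (sum_half_mul_signPhase a)
  simp only [Complex.im_sum, Complex.im_ofReal_mul, Complex.one_im] at h
  exact h

theorem sum_half [DecidableEq ι] : ∑ _ξ : ι → Bool, (∏ _j : ι, (1 / 2 : ℝ)) = 1 := by
  rw [sum_prod_fun (fun (_ : ι) (_ : Bool) => (1 / 2 : ℝ))]
  exact Finset.prod_eq_one fun j _ => by simp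

end

/-! ### A discrete model with prescribed cross-covariances -/

section

variable {R C : Type*} [Fintype R] [DecidableEq R] [Fintype C] [DecidableEq C]

/-- The phase product attached to a row or a column of a matrix of signs. -/
noncomputable def phase (η : R → C → ℝ) (u : R → C → Bool) : R ⊕ C → ℂ
  | .inl m => signPhase (η m) (u m)
  | .inr j => signPhase (fun m => η m j) (fun m => u m j)

/-- The conditional mean of an observed sign given the latent signs. -/
noncomputable def condMean (η : R → C → ℝ) (u : R → C → Bool) (i : R ⊕ C) : ℝ :=
  (phase η u i).im / 2

/-- The joint weights of the latent signs `u` and the observed signs `y`: the latent signs are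
uniform, and given them the observed signs are independent with means `condMean η u`. -/
noncomputable def latentWeight (η : R → C → ℝ) (ω : (R → C → Bool) × (R ⊕ C → Bool)) : ℝ :=
  (∏ _m : R, ∏ _j : C, (1 / 2 : ℝ))
    * ∏ i, (1 / 2 * (1 + bitSign (ω.2 i) * condMean η ω.1 i))

/-- The rows and columns of `η` are small enough for the phases to have modulus at most `√2`. -/
structure SmallPhases (η : R → C → ℝ) : Prop where
  row : ∀ m, ∏ j, (1 + η m j ^ 2) ≤ 2
  col : ∀ j, ∏ m, (1 + η m j ^ 2) ≤ 2

theorem SmallPhases.normSq_phase_le {η : R → C → ℝ} (hη : SmallPhases η) (u : R → C → Bool)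
    (i : R ⊕ C) : Complex.normSq (phase η u i) ≤ 2 := by
  cases i with
  | inl m => exact (normSq_signPhase _ _).trans_le (hη.row m)
  | inr j => exact (normSq_signPhase _ _).trans_le (hη.col j)

theorem SmallPhases.condMean_sq_le {η : R → C → ℝ} (hη : SmallPhases η) (u : R → C → Bool)
    (i : R ⊕ C) : condMean η u i ^ 2 ≤ 1 / 2 := by
  have h := hη.normSq_phase_le u i
  rw [Complex.normSq_apply] at h
  unfold condMean
  nlinarith [mul_self_nonneg (phase η u i).re]

theorem SmallPhases.abs_condMean_lt {η : R → C → ℝ} (hη : SmallPhases η) (u : R → C → Bool)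
    (i : R ⊕ C) : |condMean η u i| < 1 := by
  have h := hη.condMean_sq_le u i
  rw [← sq_lt_one_iff_abs_lt_one]
  linarith

theorem one_add_bitSign_mul_pos {x : ℝ} (hx : |x| < 1) (b : Bool) : 0 < 1 + bitSign b * x := by
  have := abs_lt.1 hx
  unfold bitSign
  split_ifs <;> linarith

theorem latentWeight_nonneg {η : R → C → ℝ} (hη : SmallPhases η)
    (ω : (R → C → Bool) × (R ⊕ C → Bool)) : 0 ≤ latentWeight η ω := by
  refine mul_nonneg (by positivity) (Finset.prod_nonneg fun i _ => ?_)
  have := one_add_bitSign_mul_pos (hη.abs_condMean_lt ω.1 i) (ω.2 i)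
  positivity

theorem sum_half_bitSign (x : ℝ) : ∑ b : Bool, (1 / 2 * (1 + bitSign b * x)) = 1 := by
  simp [bitSign]
  ring

theorem sum_half_bitSign_mul_bitSign (x : ℝ) :
    ∑ b : Bool, (1 / 2 * (1 + bitSign b * x)) * bitSign b = x := by
  simp [bitSign]
  ring

theorem sum_latentWeight_mul (η : R → C → ℝ) (F : (R → C → Bool) → (R ⊕ C → Bool) → ℝ) :
    ∑ ω, latentWeight η ω * F ω.1 ω.2 = ∑ u : R → C → Bool, (∏ _m : R, ∏ _j : C, (1 / 2 : ℝ))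
      * ∑ y, (∏ i, (1 / 2 * (1 + bitSign (y i) * condMean η u i))) * F u y := by
  rw [Fintype.sum_prod_type]
  refine Finset.sum_congr rfl fun u _ => ?_
  rw [Finset.mul_sum]
  exact Finset.sum_congr rfl fun y _ => by rw [latentWeight, mul_assoc]

theorem sum_matrix_prod {K : Type*} [CommSemiring K] (f : R → C → Bool → K) :
    ∑ u : R → C → Bool, ∏ m, ∏ j, f m j (u m j) = ∏ m, ∏ j, ∑ b, f m j b := by
  rw [sum_prod_fun (fun m (ξ : C → Bool) => ∏ j, f m j (ξ j))]
  exact Finset.prod_congr rfl fun m _ => sum_prod_fun _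

theorem sum_matrix_half : ∑ _u : R → C → Bool, (∏ _m : R, ∏ _j : C, (1 / 2 : ℝ)) = 1 := by
  rw [sum_matrix_prod (fun (_ : R) (_ : C) (_ : Bool) => (1 / 2 : ℝ))]
  exact Finset.prod_eq_one fun _ _ => Finset.prod_eq_one fun _ _ => by simp

theorem sum_prod_half_bitSign (x : R ⊕ C → ℝ) :
    ∑ y : R ⊕ C → Bool, (∏ i, (1 / 2 * (1 + bitSign (y i) * x i))) = 1 := by
  rw [sum_prod_fun (fun i b => (1 / 2 * (1 + bitSign b * x i)))]
  exact Finset.prod_eq_one fun i _ => sum_half_bitSign _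

theorem sum_latentWeight (η : R → C → ℝ) : ∑ ω, latentWeight η ω = 1 := by
  have h := sum_latentWeight_mul η fun _ _ => 1
  simp only [mul_one] at h
  rw [h]
  simp only [sum_prod_half_bitSign, mul_one, sum_matrix_half]

/-- Incidence of entries with rows and columns. -/
def Incident : R ⊕ C → R → C → Prop
  | .inl a, m, _ => m = a
  | .inr b, _, j => j = b

instance (i : R ⊕ C) (m : R) (j : C) : Decidable (Incident i m j) := by
  cases i <;> unfold Incident <;> infer_instance

theorem phase_eq_prod (η : R → C → ℝ) (u : R → C → Bool) (i : R ⊕ C) :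
    phase η u i = ∏ m, ∏ j, if Incident i m j then
      (1 + (η m j * bitSign (u m j) : ℝ) * Complex.I) else 1 := by
  cases i with
  | inl a =>
    simp only [Incident]
    rw [Finset.prod_eq_single a]
    · simp [phase, signPhase]
    · intro m _ hm
      simp [hm]
    · simp
  | inr b =>
    simp only [Incident]
    rw [Finset.prod_comm, Finset.prod_eq_single b]
    · simp [phase, signPhase]
    · intro m _ hm
      simp [hm]
    · simp

theorem sum_half_mul_phase (η : R → C → ℝ) (i : R ⊕ C) :
    ∑ u : R → C → Bool, ((∏ _m : R, ∏ _j : C, (1 / 2 : ℝ) : ℝ) : ℂ) * phase η u i = 1 := by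
  have e : ∀ u : R → C → Bool, ((∏ _m : R, ∏ _j : C, (1 / 2 : ℝ) : ℝ) : ℂ) * phase η u i
      = ∏ m, ∏ j, (1 / 2 * if Incident i m j then
        (1 + (η m j * bitSign (u m j) : ℝ) * Complex.I) else 1) := by
    intro u
    simp only [Finset.prod_mul_distrib, phase_eq_prod]
    simp
  simp only [e]
  rw [sum_matrix_prod (fun m j b => (1 / 2 * if Incident i m j then
        (1 + (η m j * bitSign b : ℝ) * Complex.I) else 1))]
  refine Finset.prod_eq_one fun m _ => Finset.prod_eq_one fun j _ => ?_
  split_ifs <;> (simp [bitSign]; try ring)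

/-- Latent signs occurring in one factor only average to 1; a shared sign gives the mean of (1 +
iηu)², which is 1 - η². With a conjugate on one factor it would be 1 + η². -/
theorem sum_half_mul_phase_mul_phase (η : R → C → ℝ) (i i' : R ⊕ C) :
    ∑ u : R → C → Bool, ((∏ _m : R, ∏ _j : C, (1 / 2 : ℝ) : ℝ) : ℂ)
      * (phase η u i * phase η u i')
      = ((∏ m, ∏ j, if Incident i m j ∧ Incident i' m j then (1 - η m j ^ 2) else 1 : ℝ) : ℂ) := by
  have e : ∀ u : R → C → Bool, ((∏ _m : R, ∏ _j : C, (1 / 2 : ℝ) : ℝ) : ℂ)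
      * (phase η u i * phase η u i')
      = ∏ m, ∏ j, (1 / 2 * ((if Incident i m j then
        (1 + (η m j * bitSign (u m j) : ℝ) * Complex.I) else 1)
        * (if Incident i' m j then
        (1 + (η m j * bitSign (u m j) : ℝ) * Complex.I) else 1))) := by
    intro u
    simp only [Finset.prod_mul_distrib, phase_eq_prod]
    simp
  simp only [e]
  rw [sum_matrix_prod (fun m j b => (1 / 2 * ((if Incident i m j then
        (1 + (η m j * bitSign b : ℝ) * Complex.I) else 1)
        * (if Incident i' m j then
        (1 + (η m j * bitSign b : ℝ) * Complex.I) else 1))))]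
  push_cast
  refine Finset.prod_congr rfl fun m _ => Finset.prod_congr rfl fun j _ => ?_
  have hI : Complex.I ^ 2 = -1 := Complex.I_sq
  by_cases h1 : Incident i m j <;> by_cases h2 : Incident i' m j <;>
    simp [h1, h2, bitSign] <;> ring_nf
  rw [hI]
  ring

theorem sum_half_mul_phase_mul_conj (η : R → C → ℝ) (i i' : R ⊕ C) :
    ∑ u : R → C → Bool, ((∏ _m : R, ∏ _j : C, (1 / 2 : ℝ) : ℝ) : ℂ)
      * (phase η u i * (starRingEnd ℂ) (phase η u i'))
      = ((∏ m, ∏ j, if Incident i m j ∧ Incident i' m j then (1 + η m j ^ 2) else 1 : ℝ) : ℂ) := by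
  have e : ∀ u : R → C → Bool, ((∏ _m : R, ∏ _j : C, (1 / 2 : ℝ) : ℝ) : ℂ)
      * (phase η u i * (starRingEnd ℂ) (phase η u i'))
      = ∏ m, ∏ j, (1 / 2 * ((if Incident i m j then
        (1 + (η m j * bitSign (u m j) : ℝ) * Complex.I) else 1)
        * (if Incident i' m j then
        (1 - (η m j * bitSign (u m j) : ℝ) * Complex.I) else 1))) := by
    intro u
    simp only [Finset.prod_mul_distrib, phase_eq_prod, map_prod]
    simp only [apply_ite (starRingEnd ℂ), map_add, map_one, map_mul, Complex.conj_ofReal,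
      Complex.conj_I, mul_neg, ← sub_eq_add_neg]
    simp
  simp only [e]
  rw [sum_matrix_prod (fun m j b => (1 / 2 * ((if Incident i m j then
        (1 + (η m j * bitSign b : ℝ) * Complex.I) else 1)
        * (if Incident i' m j then
        (1 - (η m j * bitSign b : ℝ) * Complex.I) else 1))))]
  push_cast
  refine Finset.prod_congr rfl fun m _ => Finset.prod_congr rfl fun j _ => ?_
  have hI : Complex.I ^ 2 = -1 := Complex.I_sq
  by_cases h1 : Incident i m j <;> by_cases h2 : Incident i' m j <;>
    simp [h1, h2, bitSign] <;> ring_nf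
  rw [hI]
  ring

theorem im_mul_im (z z' : ℂ) :
    z.im * z'.im = ((z * (starRingEnd ℂ) z').re - (z * z').re) / 2 := by
  simp [Complex.mul_re]

theorem sum_half_mul_condMean (η : R → C → ℝ) (i : R ⊕ C) :
    ∑ u : R → C → Bool, (∏ _m : R, ∏ _j : C, (1 / 2 : ℝ)) * condMean η u i = 0 := by
  have h := congrArg Complex.im (sum_half_mul_phase η i)
  simp only [Complex.im_sum, Complex.im_ofReal_mul, Complex.one_im] at h
  simp only [condMean, ← mul_div_assoc, ← Finset.sum_div, h, zero_div]

/-- Since Im z Im z' = (Re(z z̄') - Re(z z'))/2, the two product formulas combine; the two factors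
1/2 of the conditional means make the denominator 8. -/
theorem sum_half_mul_condMean_mul_condMean (η : R → C → ℝ) (i i' : R ⊕ C) :
    ∑ u : R → C → Bool, (∏ _m : R, ∏ _j : C, (1 / 2 : ℝ)) * (condMean η u i * condMean η u i')
      = ((∏ m, ∏ j, if Incident i m j ∧ Incident i' m j then (1 + η m j ^ 2) else 1)
        - ∏ m, ∏ j, if Incident i m j ∧ Incident i' m j then (1 - η m j ^ 2) else 1) / 8 := by
  have h1 := congrArg Complex.re (sum_half_mul_phase_mul_phase η i i')
  have h2 := congrArg Complex.re (sum_half_mul_phase_mul_conj η i i')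
  rw [Complex.ofReal_re, Complex.re_sum] at h1 h2
  simp only [Complex.re_ofReal_mul] at h1 h2
  rw [← h1, ← h2, ← Finset.sum_sub_distrib, Finset.sum_div]
  refine Finset.sum_congr rfl fun u _ => ?_
  have h3 := im_mul_im (phase η u i) (phase η u i')
  unfold condMean
  linear_combination (∏ _m : R, ∏ _j : C, (1 / 2 : ℝ)) / 4 * h3

theorem sum_latentWeight_mul_bitSign (η : R → C → ℝ) (i : R ⊕ C) :
    ∑ ω, latentWeight η ω * bitSign (ω.2 i) = 0 := by
  rw [sum_latentWeight_mul η fun _ y => bitSign (y i), ← sum_half_mul_condMean η i]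
  refine Finset.sum_congr rfl fun u _ => ?_
  rw [sum_prod_mul_apply (φ := fun i b => (1 / 2 * (1 + bitSign b * condMean η u i)))
    (fun i => sum_half_bitSign _), sum_half_bitSign_mul_bitSign]

theorem sum_latentWeight_mul_bitSign_mul_bitSign (η : R → C → ℝ) {i i' : R ⊕ C} (hi : i ≠ i') :
    ∑ ω, latentWeight η ω * (bitSign (ω.2 i) * bitSign (ω.2 i'))
      = ((∏ m, ∏ j, if Incident i m j ∧ Incident i' m j then (1 + η m j ^ 2) else 1)
        - ∏ m, ∏ j, if Incident i m j ∧ Incident i' m j then (1 - η m j ^ 2) else 1) / 8 := by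
  rw [sum_latentWeight_mul η fun _ y => bitSign (y i) * bitSign (y i'),
    ← sum_half_mul_condMean_mul_condMean η i i']
  refine Finset.sum_congr rfl fun u _ => ?_
  rw [sum_prod_mul_apply_mul_apply
    (φ := fun i b => (1 / 2 * (1 + bitSign b * condMean η u i)))
    (fun i => sum_half_bitSign _) hi, sum_half_bitSign_mul_bitSign, sum_half_bitSign_mul_bitSign]

/-- A row and a column share exactly one latent sign, so both products reduce to a single factor:
((1 + η²) - (1 - η²))/8. -/
theorem sum_latentWeight_inl_inr (η : R → C → ℝ) (a : R) (b : C) :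
    ∑ ω, latentWeight η ω * (bitSign (ω.2 (.inl a)) * bitSign (ω.2 (.inr b))) = η a b ^ 2 / 4 := by
  rw [sum_latentWeight_mul_bitSign_mul_bitSign η (by simp)]
  have e : ∀ f : R → C → ℝ, (∏ m, ∏ j, if Incident (.inl a : R ⊕ C) m j
      ∧ Incident (.inr b : R ⊕ C) m j then f m j else 1) = f a b := by
    intro f
    simp only [Incident]
    rw [Finset.prod_eq_single a, Finset.prod_eq_single b]
    · simp
    · intro j _ hj
      simp [hj]
    · simp
    · intro m _ hm
      simp [hm]
    · simp
  rw [e, e]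
  ring

theorem sum_latentWeight_inl_inl (η : R → C → ℝ) {a b : R} (hab : a ≠ b) :
    ∑ ω, latentWeight η ω * (bitSign (ω.2 (.inl a)) * bitSign (ω.2 (.inl b))) = 0 := by
  rw [sum_latentWeight_mul_bitSign_mul_bitSign η (by simpa using hab)]
  have h : ∀ (m : R) (j : C),
      ¬ (Incident (.inl a : R ⊕ C) m j ∧ Incident (.inl b : R ⊕ C) m j) := by
    rintro m j ⟨h1, h2⟩
    exact hab (h1.symm.trans h2)
  simp only [h, if_false, sub_self, zero_div]

theorem sum_latentWeight_inr_inr (η : R → C → ℝ) {a b : C} (hab : a ≠ b) :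
    ∑ ω, latentWeight η ω * (bitSign (ω.2 (.inr a)) * bitSign (ω.2 (.inr b))) = 0 := by
  rw [sum_latentWeight_mul_bitSign_mul_bitSign η (by simpa using hab)]
  have h : ∀ (m : R) (j : C),
      ¬ (Incident (.inr a : R ⊕ C) m j ∧ Incident (.inr b : R ⊕ C) m j) := by
    rintro m j ⟨h1, h2⟩
    exact hab (h1.symm.trans h2)
  simp only [h, if_false, sub_self, zero_div]

/-! ### Exponential moments -/

/-- Different rows use disjoint sets of latent signs, so their phases are independent, and their
imaginary parts have mean zero. -/
theorem sum_half_prod_row (η : R → C → ℝ) (c s : R → ℝ) :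
    ∑ u : R → C → Bool, (∏ _m : R, ∏ _j : C, (1 / 2 : ℝ))
      * ∏ m, (c m + (signPhase (η m) (u m)).im / 2 * s m) = ∏ m, c m := by
  simp only [← Finset.prod_mul_distrib]
  rw [sum_prod_fun (fun m (ξ : C → Bool) => (∏ _j : C, (1 / 2 : ℝ))
    * (c m + (signPhase (η m) ξ).im / 2 * s m))]
  refine Finset.prod_congr rfl fun m _ => ?_
  have e : ∀ ξ : C → Bool, (∏ _j : C, (1 / 2 : ℝ)) * (c m + (signPhase (η m) ξ).im / 2 * s m)
      = (∏ _j : C, (1 / 2 : ℝ)) * c m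
        + (∏ _j : C, (1 / 2 : ℝ)) * (signPhase (η m) ξ).im * (s m / 2) := fun ξ => by ring
  simp only [e, Finset.sum_add_distrib, ← Finset.sum_mul, sum_half, sum_half_mul_im_signPhase]
  ring

theorem sum_half_prod_col (η : R → C → ℝ) (c s : C → ℝ) :
    ∑ u : R → C → Bool, (∏ _m : R, ∏ _j : C, (1 / 2 : ℝ))
      * ∏ j, (c j + (signPhase (fun m => η m j) (fun m => u m j)).im / 2 * s j) = ∏ j, c j := by
  rw [← sum_half_prod_row (fun j m => η m j) c s]
  refine Fintype.sum_equiv (Equiv.piComm fun _ _ => Bool) _ _ fun u => ?_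
  rw [Finset.prod_comm]
  rfl

theorem sum_half_bitSign_mul_exp (x l : ℝ) :
    ∑ b : Bool, (1 / 2 * (1 + bitSign b * x)) * Real.exp (l * bitSign b)
      = Real.cosh l + x * Real.sinh l := by
  simp [bitSign, Real.cosh_eq, Real.sinh_eq]
  ring

/-- The conditional factor is cosh plus the conditional mean times sinh, and the means average out.
The row signs on their own are thus independent fair signs. -/
theorem sum_latentWeight_mul_exp_row (η : R → C → ℝ) (x : R → ℝ) :
    ∑ ω, latentWeight η ω * Real.exp (∑ m, x m * bitSign (ω.2 (.inl m))) = ∏ m, Real.cosh (x m) := by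
  rw [sum_latentWeight_mul η fun _ y => Real.exp (∑ m, x m * bitSign (y (.inl m))),
    ← sum_half_prod_row η (fun m => Real.cosh (x m)) fun m => Real.sinh (x m)]
  refine Finset.sum_congr rfl fun u _ => ?_
  congr 1
  have e : ∀ y : R ⊕ C → Bool, (∏ i, (1 / 2 * (1 + bitSign (y i) * condMean η u i)))
      * Real.exp (∑ m, x m * bitSign (y (.inl m)))
      = ∏ i, ((1 / 2 * (1 + bitSign (y i) * condMean η u i))
        * Real.exp (Sum.elim x (fun _ => 0) i * bitSign (y i))) := by
    intro y
    have h : Real.exp (∑ m, x m * bitSign (y (.inl m)))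
        = ∏ i, Real.exp (Sum.elim x (fun _ => 0) i * bitSign (y i)) := by
      rw [← Real.exp_sum, Fintype.sum_sum_type]
      simp
    rw [h, ← Finset.prod_mul_distrib]
  simp only [e]
  rw [sum_prod_fun (fun i (b : Bool) => (1 / 2 * (1 + bitSign b * condMean η u i))
        * Real.exp (Sum.elim x (fun _ => (0 : ℝ)) i * bitSign b))]
  simp only [sum_half_bitSign_mul_exp, Fintype.prod_sum_type, Sum.elim_inl, Sum.elim_inr,
    Real.cosh_zero, Real.sinh_zero, mul_zero, add_zero, Finset.prod_const_one, mul_one]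
  rfl

theorem sum_latentWeight_mul_exp_col (η : R → C → ℝ) (x : C → ℝ) :
    ∑ ω, latentWeight η ω * Real.exp (∑ j, x j * bitSign (ω.2 (.inr j))) = ∏ j, Real.cosh (x j) := by
  rw [sum_latentWeight_mul η fun _ y => Real.exp (∑ j, x j * bitSign (y (.inr j))),
    ← sum_half_prod_col η (fun j => Real.cosh (x j)) fun j => Real.sinh (x j)]
  refine Finset.sum_congr rfl fun u _ => ?_
  congr 1
  have e : ∀ y : R ⊕ C → Bool, (∏ i, (1 / 2 * (1 + bitSign (y i) * condMean η u i)))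
      * Real.exp (∑ j, x j * bitSign (y (.inr j)))
      = ∏ i, ((1 / 2 * (1 + bitSign (y i) * condMean η u i))
        * Real.exp (Sum.elim (fun _ => 0) x i * bitSign (y i))) := by
    intro y
    have h : Real.exp (∑ j, x j * bitSign (y (.inr j)))
        = ∏ i, Real.exp (Sum.elim (fun _ => 0) x i * bitSign (y i)) := by
      rw [← Real.exp_sum, Fintype.sum_sum_type]
      simp
    rw [h, ← Finset.prod_mul_distrib]
  simp only [e]
  rw [sum_prod_fun (fun i (b : Bool) => (1 / 2 * (1 + bitSign b * condMean η u i))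
        * Real.exp (Sum.elim (fun _ => (0 : ℝ)) x i * bitSign b))]
  simp only [sum_half_bitSign_mul_exp, Fintype.prod_sum_type, Sum.elim_inl, Sum.elim_inr,
    Real.cosh_zero, Real.sinh_zero, mul_zero, add_zero, Finset.prod_const_one, one_mul]
  rfl

theorem prod_cosh_le {ι : Type*} [Fintype ι] (l : ℝ) {x : ι → ℝ} (hx : ∑ i, x i ^ 2 ≤ 1) :
    ∏ i, Real.cosh (2 * l * x i) ≤ Real.exp (2 * l ^ 2) := by
  calc _ ≤ ∏ i, Real.exp ((2 * l * x i) ^ 2 / 2) :=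
        Finset.prod_le_prod (fun i _ => (Real.cosh_pos _).le) fun i _ => Real.cosh_le_exp_half_sq _
    _ ≤ _ := by
        rw [← Real.exp_sum, Real.exp_le_exp]
        simp only [mul_pow, ← Finset.sum_div, ← Finset.mul_sum]
        nlinarith [sq_nonneg l]

/-- Rows and columns are dependent, but e^{(x+y)/2} ≤ (e^x + e^y)/2 separates them at the price of
doubling the exponent. This is why 2l² stands where independent signs would have l²/2. -/
theorem sum_latentWeight_mul_exp_le {η : R → C → ℝ} (hη : SmallPhases η) {x : R ⊕ C → ℝ}
    (hx : ∑ i, x i ^ 2 ≤ 1) (l : ℝ) :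
    ∑ ω, latentWeight η ω * Real.exp (l * ∑ i, x i * bitSign (ω.2 i)) ≤ Real.exp (2 * l ^ 2) := by
  rw [Fintype.sum_sum_type] at hx
  have hrow : ∑ m, x (.inl m) ^ 2 ≤ 1 :=
    le_trans (le_add_of_nonneg_right (Finset.sum_nonneg fun j _ => sq_nonneg _)) hx
  have hcol : ∑ j, x (.inr j) ^ 2 ≤ 1 :=
    le_trans (le_add_of_nonneg_left (Finset.sum_nonneg fun j _ => sq_nonneg _)) hx
  have h1 := (sum_latentWeight_mul_exp_row η fun m => 2 * l * x (.inl m)).trans_le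
    (prod_cosh_le l hrow)
  have h2 := (sum_latentWeight_mul_exp_col η fun j => 2 * l * x (.inr j)).trans_le
    (prod_cosh_le l hcol)
  have h3 : ∀ ω : (R → C → Bool) × (R ⊕ C → Bool),
      latentWeight η ω * Real.exp (l * ∑ i, x i * bitSign (ω.2 i))
      ≤ (latentWeight η ω * Real.exp (∑ m, 2 * l * x (.inl m) * bitSign (ω.2 (.inl m)))
        + latentWeight η ω * Real.exp (∑ j, 2 * l * x (.inr j) * bitSign (ω.2 (.inr j)))) / 2 := by
    intro ω
    rw [← mul_add, mul_div_assoc]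
    refine mul_le_mul_of_nonneg_left ?_ (latentWeight_nonneg hη ω)
    refine le_trans (le_of_eq ?_) (exp_half_add_le _ _)
    congr 1
    rw [Fintype.sum_sum_type]
    simp only [mul_assoc, ← Finset.mul_sum]
    ring
  calc _ ≤ _ := Finset.sum_le_sum fun ω _ => h3 ω
    _ ≤ _ := by
      rw [← Finset.sum_div, Finset.sum_add_distrib]
      linarith

/-! ### The law of the embedded vector -/

/-- The signs `y` placed at the coordinates `e`. -/
noncomputable def embVec {p : ℕ} (e : R ⊕ C → Fin p) (ω : (R → C → Bool) × (R ⊕ C → Bool)) :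
    Fin p → ℝ :=
  Function.extend e (fun s => bitSign (ω.2 s)) 0

/-- The law of the discrete model. -/
noncomputable def modelLaw {p : ℕ} (τ : ℝ) (e : R ⊕ C → Fin p) (η : R → C → ℝ) :
    Measure (EuclideanSpace ℝ (Fin p)) :=
  atomLaw τ (latentWeight η) (embVec e)

variable {p : ℕ} {τ : ℝ} {e : R ⊕ C → Fin p} {η : R → C → ℝ}

theorem embVec_apply (he : Function.Injective e) (ω : (R → C → Bool) × (R ⊕ C → Bool))
    (s : R ⊕ C) : embVec e ω (e s) = bitSign (ω.2 s) :=
  he.extend_apply _ _ _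

theorem embVec_apply_of_notMem (ω : (R → C → Bool) × (R ⊕ C → Bool)) {i : Fin p}
    (hi : i ∉ Set.range e) : embVec e ω i = 0 :=
  Function.extend_apply' _ _ _ hi

theorem sum_latentWeight_mul_embVec (he : Function.Injective e) (i : Fin p) :
    ∑ ω, latentWeight η ω * embVec e ω i = 0 := by
  by_cases hi : i ∈ Set.range e
  · obtain ⟨s, rfl⟩ := hi
    simp only [embVec_apply he]
    exact sum_latentWeight_mul_bitSign η s
  · simp only [embVec_apply_of_notMem _ hi, mul_zero, Finset.sum_const_zero]

theorem modelLaw_isSubgaussian (hτ : 0 < τ) (he : Function.Injective e) (hη : SmallPhases η) :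
    IsSubgaussian (modelLaw τ e η) τ := by
  refine isSubgaussian_atomLaw hτ (latentWeight_nonneg hη) (sum_latentWeight η)
    (sum_latentWeight_mul_embVec he) fun v hv l => ?_
  have h1 : ∀ ω : (R → C → Bool) × (R ⊕ C → Bool),
      ∑ i, v i * embVec e ω i = ∑ s, v (e s) * bitSign (ω.2 s) := by
    intro ω
    refine (Fintype.sum_of_injective e he _ _ ?_ ?_).symm
    · intro i hi
      rw [embVec_apply_of_notMem _ hi, mul_zero]
    · intro s
      rw [embVec_apply he]
  simp only [h1]
  refine sum_latentWeight_mul_exp_le hη (x := fun s => v (e s)) ?_ l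
  rw [← hv, ← Finset.sum_image (s := Finset.univ) (f := fun i => v i ^ 2) (g := e)
    (fun a _ b _ h => he h)]
  exact Finset.sum_le_sum_of_subset_of_nonneg (Finset.subset_univ _) fun i _ _ => sq_nonneg _

theorem covMat_modelLaw (hτ : 0 < τ) (he : Function.Injective e) (hη : SmallPhases η)
    (i j : Fin p) :
    covMat (modelLaw τ e η) i j = τ / 8 * ∑ ω, latentWeight η ω * (embVec e ω i * embVec e ω j) :=
  covMat_atomLaw hτ.le (latentWeight_nonneg hη) (sum_latentWeight η)
    (sum_latentWeight_mul_embVec he) i j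

theorem covMat_modelLaw_inl_inr (hτ : 0 < τ) (he : Function.Injective e) (hη : SmallPhases η)
    (a : R) (b : C) : covMat (modelLaw τ e η) (e (.inl a)) (e (.inr b)) = τ / 32 * η a b ^ 2 := by
  rw [covMat_modelLaw hτ he hη]
  simp only [embVec_apply he]
  rw [sum_latentWeight_inl_inr]
  ring

theorem covMat_modelLaw_eq_zero_of_notMem (hτ : 0 < τ) (he : Function.Injective e)
    (hη : SmallPhases η) {i : Fin p} (hi : i ∉ Set.range e) (j : Fin p) :
    covMat (modelLaw τ e η) i j = 0 := by
  rw [covMat_modelLaw hτ he hη]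
  simp only [embVec_apply_of_notMem _ hi, zero_mul, mul_zero, Finset.sum_const_zero]

theorem covMat_modelLaw_inl_inl (hτ : 0 < τ) (he : Function.Injective e) (hη : SmallPhases η)
    {a b : R} (hab : a ≠ b) : covMat (modelLaw τ e η) (e (.inl a)) (e (.inl b)) = 0 := by
  rw [covMat_modelLaw hτ he hη]
  simp only [embVec_apply he]
  rw [sum_latentWeight_inl_inl η hab, mul_zero]

theorem covMat_modelLaw_inr_inr (hτ : 0 < τ) (he : Function.Injective e) (hη : SmallPhases η)
    {a b : C} (hab : a ≠ b) : covMat (modelLaw τ e η) (e (.inr a)) (e (.inr b)) = 0 := by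
  rw [covMat_modelLaw hτ he hη]
  simp only [embVec_apply he]
  rw [sum_latentWeight_inr_inr η hab, mul_zero]

/-- Off the diagonal, the covariance is nonzero only between a row and a column with η ≠ 0, where it
equals τt²/32. Sparse rows and columns of η therefore give columns of Σ with at most d nonzero
entries. -/
theorem modelLaw_mem_distClass {q c t : ℝ} {d : ℕ} (hq : 0 ≤ q) (hc : 0 ≤ c) (hτ : 0 < τ)
    (he : Function.Injective e) (hη : SmallPhases η)
    (hη2 : ∀ a b, η a b = 0 ∨ η a b = t)
    (hrow : ∀ a, (Finset.univ.filter fun b => η a b ≠ 0).card ≤ d)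
    (hcol : ∀ b, (Finset.univ.filter fun a => η a b ≠ 0).card ≤ d)
    (hdc : (τ / 32 * t ^ 2) ^ q * d ≤ c) : modelLaw τ e η ∈ distClass p q τ c := by
  refine ⟨modelLaw_isSubgaussian hτ he hη, fun j => ?_⟩
  set S := covMat (modelLaw τ e η) with hS
  have hsymm : ∀ i j, S i j = S j i := covMat_comm
  have hval : ∀ a b, |S (e (.inl a)) (e (.inr b))| ≤ τ / 32 * t ^ 2 := by
    intro a b
    rw [hS, covMat_modelLaw_inl_inr hτ he hη]
    rcases hη2 a b with h | h <;> rw [h]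
    · simp only [ne_eq, OfNat.ofNat_ne_zero, not_false_eq_true, zero_pow, mul_zero, abs_zero]
      positivity
    · rw [abs_of_nonneg (by positivity)]
  have hne : ∀ a b, S (e (.inl a)) (e (.inr b)) ≠ 0 → η a b ≠ 0 := by
    intro a b h h0
    rw [hS, covMat_modelLaw_inl_inr hτ he hη, h0] at h
    simp at h
  refine mem_weakBall_of_card_le (d := d) (b := τ / 32 * t ^ 2) hq hc ?_ ?_ hdc
  · by_cases hj : j ∈ Set.range e
    · obtain ⟨s, rfl⟩ := hj
      cases s with
      | inl a =>
        refine le_trans ?_ (hrow a)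
        refine le_trans ?_ (Finset.card_image_le
          (s := Finset.univ.filter fun b => η a b ≠ 0) (f := fun b => e (.inr b)))
        refine Finset.card_le_card_of_injOn (fun i => (i : Fin p)) ?_
          (fun x _ y _ h => Subtype.ext h)
        intro i hi
        simp only [Finset.coe_filter, Finset.mem_univ, true_and, Set.mem_ofPred_eq] at hi
        by_cases hr : (i : Fin p) ∈ Set.range e
        · obtain ⟨s, hs⟩ := hr
          cases s with
          | inl a' =>
            refine absurd ?_ hi
            rw [← hs]
            exact covMat_modelLaw_inl_inl hτ he hη fun h => i.2 (by rw [← hs, h])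
          | inr b =>
            simp only [Finset.coe_image, Set.mem_image, Finset.coe_filter, Finset.mem_univ,
              true_and, Set.mem_ofPred_eq]
            refine ⟨b, hne a b ?_, hs⟩
            rwa [hsymm, hs]
        · exact absurd (covMat_modelLaw_eq_zero_of_notMem hτ he hη hr _) hi
      | inr b =>
        refine le_trans ?_ (hcol b)
        refine le_trans ?_ (Finset.card_image_le
          (s := Finset.univ.filter fun a => η a b ≠ 0) (f := fun a => e (.inl a)))
        refine Finset.card_le_card_of_injOn (fun i => (i : Fin p)) ?_
          (fun x _ y _ h => Subtype.ext h)
        intro i hi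
        simp only [Finset.coe_filter, Finset.mem_univ, true_and, Set.mem_ofPred_eq] at hi
        by_cases hr : (i : Fin p) ∈ Set.range e
        · obtain ⟨s, hs⟩ := hr
          cases s with
          | inr b' =>
            refine absurd ?_ hi
            rw [← hs]
            exact covMat_modelLaw_inr_inr hτ he hη fun h => i.2 (by rw [← hs, h])
          | inl a =>
            simp only [Finset.coe_image, Set.mem_image, Finset.coe_filter, Finset.mem_univ,
              true_and, Set.mem_ofPred_eq]
            refine ⟨a, hne a b ?_, hs⟩
            rwa [hs]
        · exact absurd (covMat_modelLaw_eq_zero_of_notMem hτ he hη hr _) hi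
    · have h0 : ∀ i : {i : Fin p // i ≠ j}, S i j = 0 := fun i => by
        rw [hsymm]
        exact covMat_modelLaw_eq_zero_of_notMem hτ he hη hj _
      simp [h0]
  · intro i
    have hb0 : 0 ≤ τ / 32 * t ^ 2 := by positivity
    by_cases hj : j ∈ Set.range e
    · by_cases hi : (i : Fin p) ∈ Set.range e
      · have hij := i.2
        obtain ⟨s, hs⟩ := hi
        obtain ⟨s', rfl⟩ := hj
        rw [← hs] at hij ⊢
        cases s <;> cases s'
        · rw [hS, covMat_modelLaw_inl_inl hτ he hη fun h => hij (by rw [h]), abs_zero]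
          exact hb0
        · exact hval _ _
        · rw [hsymm]
          exact hval _ _
        · rw [hS, covMat_modelLaw_inr_inr hτ he hη fun h => hij (by rw [h]), abs_zero]
          exact hb0
      · rw [hS, covMat_modelLaw_eq_zero_of_notMem hτ he hη hi, abs_zero]
        exact hb0
    · rw [hsymm, hS, covMat_modelLaw_eq_zero_of_notMem hτ he hη hj, abs_zero]
      exact hb0

end

/-! ### The likelihood ratio of a change of one row -/

section

/-- Swapping the m-th value of u with ξ is an involution of the pairs (u, ξ). It expresses that
resampling one coordinate preserves the uniform law. -/
theorem sum_sum_update {R X M : Type*} [Fintype R] [DecidableEq R] [Fintype X] [AddCommMonoid M]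
    (m : R) (g : (R → X) → X → M) :
    ∑ u : R → X, ∑ ξ, g (Function.update u m ξ) (u m) = ∑ u, ∑ ξ, g u ξ := by
  rw [← Fintype.sum_prod_type', ← Fintype.sum_prod_type']
  have hinv : Function.Involutive
      fun x : (R → X) × X => (Function.update x.1 m x.2, x.1 m) := by
    rintro ⟨u, ξ⟩
    simp
  exact Fintype.sum_equiv hinv.toPerm _ _ fun x => rfl

theorem sum_sum_prod_fun {ι X Y K : Type*} [Fintype ι] [DecidableEq ι] [Fintype X] [Fintype Y]
    [CommSemiring K] (f : ι → X → Y → K) :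
    ∑ ξ : ι → X, ∑ ξ' : ι → Y, ∏ l, f l (ξ l) (ξ' l) = ∏ l, ∑ a, ∑ b, f l a b := by
  rw [← sum_prod_fun fun l a => ∑ b, f l a b]
  exact Finset.sum_congr rfl fun ξ _ => sum_prod_fun fun l b => f l (ξ l) b

theorem one_sub_sum_le_prod_one_sub {ι : Type*} (s : Finset ι) {x : ι → ℝ}
    (h0 : ∀ i, 0 ≤ x i) (h1 : ∀ i, x i ≤ 1) : 1 - ∑ i ∈ s, x i ≤ ∏ i ∈ s, (1 - x i) := by
  classical
  induction s using Finset.induction_on with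
  | empty => simp
  | insert i s hi ih =>
    rw [Finset.sum_insert hi, Finset.prod_insert hi]
    have h2 : ∏ j ∈ s, (1 - x j) ≤ 1 := Finset.prod_le_one (fun j _ => by linarith [h1 j])
      fun j _ => by linarith [h0 j]
    nlinarith [h0 i, h1 i, mul_nonneg (h0 i) (sub_nonneg.2 h2)]

theorem one_add_sum_le_prod_one_add {ι : Type*} (s : Finset ι) {x : ι → ℝ}
    (h0 : ∀ i, 0 ≤ x i) : 1 + ∑ i ∈ s, x i ≤ ∏ i ∈ s, (1 + x i) := by
  classical
  induction s using Finset.induction_on with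
  | empty => simp
  | insert i s hi ih =>
    rw [Finset.sum_insert hi, Finset.prod_insert hi]
    have h2 : 0 ≤ ∑ j ∈ s, x j := Finset.sum_nonneg fun j _ => h0 j
    nlinarith [h0 i, mul_nonneg (h0 i) h2]

/-- The mixed second moment of the likelihood ratios of two random sign patterns. -/
theorem sum_half_signPhase_pair_le {ι : Type*} [Fintype ι] [DecidableEq ι] {a b κ : ι → ℝ}
    (ha : ∀ j, 0 ≤ a j * b j) (ha1 : ∀ j, a j * b j ≤ 1) (hκ0 : ∀ j, 0 ≤ κ j)
    (hκ : ∀ j, κ j ≤ a j * b j) :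
    ∑ ξ : ι → Bool, ∑ ξ' : ι → Bool, (∏ _j : ι, (1 / 2 : ℝ)) * (∏ _j : ι, (1 / 2 : ℝ))
      * ((1 + (signPhase a ξ).im / 2 * ((signPhase b ξ').im / 2))
        * ∏ j, (1 + bitSign (ξ j) * bitSign (ξ' j) * κ j)) ≤ Real.exp (∑ j, (a j * b j) ^ 2) := by
  set c : (ι → Bool) → (ι → Bool) → ℝ := fun ξ ξ' => (∏ _j : ι, (1 / 2 : ℝ))
    * (∏ _j : ι, (1 / 2 : ℝ)) * ∏ j, (1 + bitSign (ξ j) * bitSign (ξ' j) * κ j) with hc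
  have hc' : ∀ ξ ξ', c ξ ξ' = ∏ j, (1 / 2 * (1 / 2)
      * (1 + bitSign (ξ j) * bitSign (ξ' j) * κ j)) := by
    intro ξ ξ'
    simp only [hc, Finset.prod_mul_distrib]
  have e0 : ∑ ξ, ∑ ξ', c ξ ξ' = 1 := by
    simp only [hc']
    rw [sum_sum_prod_fun fun j x y => 1 / 2 * (1 / 2) * (1 + bitSign x * bitSign y * κ j)]
    refine Finset.prod_eq_one fun j _ => ?_
    simp [bitSign]
    ring
  have hI : Complex.I ^ 2 = -1 := Complex.I_sq
  have e1 : ∑ ξ, ∑ ξ', (c ξ ξ' : ℂ) * (signPhase a ξ * signPhase b ξ')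
      = ((∏ j, (1 - a j * b j * κ j) : ℝ) : ℂ) := by
    have e : ∀ ξ ξ', (c ξ ξ' : ℂ) * (signPhase a ξ * signPhase b ξ')
        = ∏ j, (1 / 2 * (1 / 2) * (1 + bitSign (ξ j) * bitSign (ξ' j) * κ j)
          * ((1 + (a j * bitSign (ξ j) : ℝ) * Complex.I)
          * (1 + (b j * bitSign (ξ' j) : ℝ) * Complex.I))) := by
      intro ξ ξ'
      rw [hc', signPhase, signPhase, ← Finset.prod_mul_distrib]
      push_cast
      rw [← Finset.prod_mul_distrib]
    simp only [e]
    rw [sum_sum_prod_fun fun j x y => (1 / 2 * (1 / 2) * (1 + bitSign x * bitSign y * κ j)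
          * ((1 + (a j * bitSign x : ℝ) * Complex.I)
          * (1 + (b j * bitSign y : ℝ) * Complex.I)) : ℂ)]
    push_cast
    refine Finset.prod_congr rfl fun j _ => ?_
    simp [bitSign]
    ring_nf
    rw [hI]
    ring
  have e2 : ∑ ξ, ∑ ξ', (c ξ ξ' : ℂ) * (signPhase a ξ * (starRingEnd ℂ) (signPhase b ξ'))
      = ((∏ j, (1 + a j * b j * κ j) : ℝ) : ℂ) := by
    have e : ∀ ξ ξ', (c ξ ξ' : ℂ) * (signPhase a ξ * (starRingEnd ℂ) (signPhase b ξ'))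
        = ∏ j, (1 / 2 * (1 / 2) * (1 + bitSign (ξ j) * bitSign (ξ' j) * κ j)
          * ((1 + (a j * bitSign (ξ j) : ℝ) * Complex.I)
          * (1 - (b j * bitSign (ξ' j) : ℝ) * Complex.I))) := by
      intro ξ ξ'
      rw [hc', signPhase, signPhase, map_prod, ← Finset.prod_mul_distrib]
      push_cast
      rw [← Finset.prod_mul_distrib]
      refine Finset.prod_congr rfl fun j _ => ?_
      simp only [map_add, map_one, map_mul, Complex.conj_ofReal, Complex.conj_I]
      ring
    simp only [e]
    rw [sum_sum_prod_fun fun j x y => (1 / 2 * (1 / 2) * (1 + bitSign x * bitSign y * κ j)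
          * ((1 + (a j * bitSign x : ℝ) * Complex.I)
          * (1 - (b j * bitSign y : ℝ) * Complex.I)) : ℂ)]
    push_cast
    refine Finset.prod_congr rfl fun j _ => ?_
    simp [bitSign]
    ring_nf
    rw [hI]
    ring
  have r1 := congrArg Complex.re e1
  have r2 := congrArg Complex.re e2
  simp only [Complex.re_sum, Complex.re_ofReal_mul, Complex.ofReal_re] at r1 r2
  -- For κ = 0 the excess over 1 vanishes: the row factor and the column factors carry information
  -- only jointly. This makes the bound quadratic in a_j b_j.
  have e3 : ∑ ξ, ∑ ξ', (∏ _j : ι, (1 / 2 : ℝ)) * (∏ _j : ι, (1 / 2 : ℝ))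
      * ((1 + (signPhase a ξ).im / 2 * ((signPhase b ξ').im / 2))
        * ∏ j, (1 + bitSign (ξ j) * bitSign (ξ' j) * κ j))
      = 1 + (∏ j, (1 + a j * b j * κ j) - ∏ j, (1 - a j * b j * κ j)) / 8 := by
    rw [← r1, ← r2]
    refine Eq.trans ?_ (congrArg (· + _) e0)
    rw [← Finset.sum_sub_distrib, Finset.sum_div, ← Finset.sum_add_distrib]
    refine Finset.sum_congr rfl fun ξ _ => ?_
    rw [← Finset.sum_sub_distrib, Finset.sum_div, ← Finset.sum_add_distrib]
    refine Finset.sum_congr rfl fun ξ' _ => ?_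
    have h3 := im_mul_im (signPhase a ξ) (signPhase b ξ')
    simp only [hc]
    linear_combination ((∏ _j : ι, (1 / 2 : ℝ))
      * (∏ _j : ι, (1 / 2 : ℝ)) * ∏ j, (1 + bitSign (ξ j) * bitSign (ξ' j) * κ j)) / 4 * h3
  rw [e3]
  have hx0 : ∀ j, 0 ≤ a j * b j * κ j := fun j => mul_nonneg (ha j) (hκ0 j)
  have hx2 : ∀ j, a j * b j * κ j ≤ (a j * b j) ^ 2 := by
    intro j
    rw [sq]
    exact mul_le_mul_of_nonneg_left (hκ j) (ha j)
  have hx1 : ∀ j, a j * b j * κ j ≤ 1 := fun j => (hx2 j).trans (pow_le_one₀ (ha j) (ha1 j))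
  have h1 := one_sub_sum_le_prod_one_sub Finset.univ hx0 hx1
  have h2 := one_add_sum_le_prod_one_add Finset.univ hx0
  have h3 : ∏ j, (1 + a j * b j * κ j) ≤ Real.exp (∑ j, (a j * b j) ^ 2) := by
    rw [Real.exp_sum]
    refine Finset.prod_le_prod (fun j _ => by linarith [hx0 j]) fun j _ => ?_
    rw [add_comm]
    exact (Real.add_one_le_exp _).trans (Real.exp_le_exp.2 (hx2 j))
  -- With P = ∏(1 + x) and S = ∑ x, the excess is at most (P - 1 + S)/8 ≤ (P - 1)/4, so the whole is
  -- at most P.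
  have h4 : 0 ≤ ∑ j, a j * b j * κ j := Finset.sum_nonneg fun j _ => hx0 j
  linarith

end

section

variable {R C : Type*} [Fintype R] [DecidableEq R] [Fintype C] [DecidableEq C]

/-- The conditional mean of the sign of column `j` after the row `m` of latent coefficients has
been changed from zero to `a`. -/
noncomputable def shiftedMean (η : R → C → ℝ) (a : C → ℝ) (ξ : C → Bool) (u : R → C → Bool)
    (j : C) : ℝ :=
  ((1 + (a j * bitSign (ξ j) : ℝ) * Complex.I) * phase η u (.inr j)).im / 2

/-- The conditional likelihood ratio for changing the row `m` from zero to `a`. -/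
noncomputable def likRatio (η : R → C → ℝ) (m : R) (a : C → ℝ) (ξ : C → Bool)
    (u : R → C → Bool) (y : R ⊕ C → Bool) : ℝ :=
  (1 + bitSign (y (.inl m)) * ((signPhase a ξ).im / 2))
    * ∏ j, ((1 + bitSign (y (.inr j)) * shiftedMean η a ξ u j)
      / (1 + bitSign (y (.inr j)) * condMean η u (.inr j)))

/-- The likelihood ratio for changing the row `m` from zero to `a`. -/
noncomputable def rowRatio (η : R → C → ℝ) (m : R) (a : C → ℝ)
    (ω : (R → C → Bool) × (R ⊕ C → Bool)) : ℝ :=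
  ∑ ξ : C → Bool, (∏ _j : C, (1 / 2 : ℝ)) * likRatio η m a ξ ω.1 ω.2

variable {η : R → C → ℝ} {m : R}

theorem condMean_inl_self (h0 : η m = 0) (u : R → C → Bool) : condMean η u (.inl m) = 0 := by
  simp [condMean, phase, signPhase, h0]

theorem condMean_update_inl_self (a : C → ℝ) (ξ : C → Bool) (u : R → C → Bool) :
    condMean (Function.update η m a) (Function.update u m ξ) (.inl m) = (signPhase a ξ).im / 2 := by
  simp [condMean, phase]

theorem condMean_update_inl_of_ne (a : C → ℝ) (ξ : C → Bool) (u : R → C → Bool) {m' : R}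
    (hm : m' ≠ m) :
    condMean (Function.update η m a) (Function.update u m ξ) (.inl m') = condMean η u (.inl m') := by
  simp [condMean, phase, hm]

theorem condMean_update_inr (h0 : η m = 0) (a : C → ℝ) (ξ : C → Bool) (u : R → C → Bool) (j : C) :
    condMean (Function.update η m a) (Function.update u m ξ) (.inr j) = shiftedMean η a ξ u j := by
  unfold condMean shiftedMean
  congr 2
  simp only [phase, signPhase]
  rw [Fintype.prod_eq_mul_prod_compl m, Fintype.prod_eq_mul_prod_compl m fun i =>
    (1 + ((η i j * bitSign (u i j) : ℝ) : ℂ) * Complex.I)]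
  simp only [Function.update_self, h0, Pi.zero_apply, zero_mul, Complex.ofReal_zero, add_zero,
    one_mul]
  congr 1
  refine Finset.prod_congr rfl fun i hi => ?_
  have hi' : i ≠ m := by simpa using hi
  simp [hi']

/-- Changing row m affects the mean of the sign of row m and multiplies each column phase by one
factor; all other row signs keep their law. -/
theorem prod_condMean_update (hη : SmallPhases η) (h0 : η m = 0) (a : C → ℝ) (ξ : C → Bool)
    (u : R → C → Bool) (y : R ⊕ C → Bool) :
    ∏ i, (1 / 2 * (1 + bitSign (y i)
      * condMean (Function.update η m a) (Function.update u m ξ) i))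
      = (∏ i, (1 / 2 * (1 + bitSign (y i) * condMean η u i))) * likRatio η m a ξ u y := by
  rw [Fintype.prod_sum_type, Fintype.prod_sum_type, likRatio, mul_mul_mul_comm]
  congr 1
  · rw [Fintype.prod_eq_mul_prod_compl m, Fintype.prod_eq_mul_prod_compl m fun i =>
      (1 / 2 * (1 + bitSign (y (.inl i)) * condMean η u (.inl i)) : ℝ),
      condMean_update_inl_self, condMean_inl_self h0, mul_zero, add_zero, mul_one, mul_right_comm]
    congr 2
    refine Finset.prod_congr rfl fun i hi => ?_
    rw [condMean_update_inl_of_ne _ _ _ (by simpa using hi)]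
  · rw [← Finset.prod_mul_distrib]
    refine Finset.prod_congr rfl fun j _ => ?_
    have := one_add_bitSign_mul_pos (hη.abs_condMean_lt u (.inr j)) (y (.inr j))
    rw [condMean_update_inr h0]
    field_simp

theorem likRatio_nonneg (hη : SmallPhases η) (h0 : η m = 0) {a : C → ℝ}
    (ha : SmallPhases (Function.update η m a)) (ξ : C → Bool) (u : R → C → Bool)
    (y : R ⊕ C → Bool) : 0 ≤ likRatio η m a ξ u y := by
  refine mul_nonneg ?_ (Finset.prod_nonneg fun j _ => div_nonneg ?_ ?_)
  · rw [← condMean_update_inl_self (η := η) (m := m) a ξ u]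
    exact (one_add_bitSign_mul_pos (ha.abs_condMean_lt _ _) _).le
  · rw [← condMean_update_inr h0]
    exact (one_add_bitSign_mul_pos (ha.abs_condMean_lt _ _) _).le
  · exact (one_add_bitSign_mul_pos (hη.abs_condMean_lt _ _) _).le

theorem rowRatio_nonneg (hη : SmallPhases η) (h0 : η m = 0) {a : C → ℝ}
    (ha : SmallPhases (Function.update η m a)) (ω : (R → C → Bool) × (R ⊕ C → Bool)) :
    0 ≤ rowRatio η m a ω :=
  Finset.sum_nonneg fun ξ _ => mul_nonneg (by positivity) (likRatio_nonneg hη h0 ha _ _ _)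

/-- With η m = 0 the latent signs of row m play no role in the base law, so they can be exchanged
with the averaged signs ξ. The weights agree only after summing over u, which is all that the law of
the observations sees. -/
theorem sum_latentWeight_update (hη : SmallPhases η) (h0 : η m = 0) (a : C → ℝ)
    (y : R ⊕ C → Bool) :
    ∑ u, latentWeight (Function.update η m a) (u, y)
      = ∑ u, latentWeight η (u, y) * rowRatio η m a (u, y) := by
  have h := sum_sum_update m fun (u : R → C → Bool) (_ : C → Bool) =>
    (∏ _j : C, (1 / 2 : ℝ)) * latentWeight (Function.update η m a) (u, y)
  have h1 : ∀ u, ∑ _ξ : C → Bool, (∏ _j : C, (1 / 2 : ℝ))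
      * latentWeight (Function.update η m a) (u, y) = latentWeight (Function.update η m a) (u, y) := by
    intro u
    rw [← Finset.sum_mul, sum_half, one_mul]
  simp only [h1] at h
  rw [← h]
  refine Finset.sum_congr rfl fun u _ => ?_
  rw [rowRatio, Finset.mul_sum]
  refine Finset.sum_congr rfl fun ξ _ => ?_
  simp only [latentWeight]
  rw [prod_condMean_update hη h0]
  ring

theorem sum_latentWeight_mul_rowRatio (hη : SmallPhases η) (h0 : η m = 0) (a : C → ℝ) :
    ∑ ω, latentWeight η ω * rowRatio η m a ω = 1 := by
  rw [Fintype.sum_prod_type_right, ← sum_latentWeight (Function.update η m a),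
    Fintype.sum_prod_type_right]
  exact Finset.sum_congr rfl fun y _ => (sum_latentWeight_update hη h0 a y).symm

theorem atomLaw_latentWeight_eq {p : ℕ} (τ : ℝ) (e : R ⊕ C → Fin p)
    {w w' : (R → C → Bool) × (R ⊕ C → Bool) → ℝ} (hw : ∀ ω, 0 ≤ w ω) (hw' : ∀ ω, 0 ≤ w' ω)
    (h : ∀ y, ∑ u, w (u, y) = ∑ u, w' (u, y)) :
    atomLaw τ w (embVec e) = atomLaw τ w' (embVec e) := by
  unfold atomLaw finLaw
  rw [Fintype.sum_prod_type, Fintype.sum_prod_type]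
  refine Finset.sum_congr rfl fun b _ => ?_
  have hw2 : ∀ ω, 0 ≤ atomWeight w (b, ω) := fun ω => atomWeight_nonneg hw _
  have hw2' : ∀ ω, 0 ≤ atomWeight w' (b, ω) := fun ω => atomWeight_nonneg hw' _
  refine finLaw_eq_of_marginal (w := fun ω => atomWeight w (b, ω))
    (w' := fun ω => atomWeight w' (b, ω)) hw2 hw2'
    (fun y => atomVec τ (embVec e) (b, ((fun _ _ => true), y))) fun y => ?_
  simp only [atomWeight, ← Finset.sum_div, h]

theorem modelLaw_update {p : ℕ} (τ : ℝ) (e : R ⊕ C → Fin p) (hη : SmallPhases η) (h0 : η m = 0)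
    {a : C → ℝ} (ha : SmallPhases (Function.update η m a)) :
    modelLaw τ e (Function.update η m a)
      = atomLaw τ (fun ω => latentWeight η ω * rowRatio η m a ω) (embVec e) :=
  atomLaw_latentWeight_eq τ e (latentWeight_nonneg ha)
    (fun ω => mul_nonneg (latentWeight_nonneg hη ω) (rowRatio_nonneg hη h0 ha ω))
    (sum_latentWeight_update hη h0 a)

/-- The χ² inner product of two sign distributions relative to a third with mean β and variance 1 -
β². -/
theorem sum_half_ratio {β b b' : ℝ} (hβ : |β| < 1) :
    ∑ w : Bool, (1 / 2 * (1 + bitSign w * β)) * (((1 + bitSign w * b) / (1 + bitSign w * β))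
      * ((1 + bitSign w * b') / (1 + bitSign w * β)))
      = 1 + (b - β) * (b' - β) / (1 - β ^ 2) := by
  have h := abs_lt.1 hβ
  have h1 : 1 + β ≠ 0 := by linarith
  have h2 : 1 - β ≠ 0 := by linarith
  have h3 : 1 - β ^ 2 = (1 + β) * (1 - β) := by ring
  rw [h3]
  simp only [Fintype.sum_bool, bitSign, if_true, Bool.false_eq_true, if_false, one_mul,
    neg_mul, ← sub_eq_add_neg]
  field_simp
  ring

/-- The conditional correlation coefficients of two changes of a row. -/
noncomputable def pairCoef (η : R → C → ℝ) (a b : C → ℝ) (u : R → C → Bool) (j : C) : ℝ :=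
  a j * b j * ((phase η u (.inr j)).re ^ 2 / 4) / (1 - condMean η u (.inr j) ^ 2)

theorem pairCoef_nonneg (hη : SmallPhases η) {a b : C → ℝ} (hab : ∀ j, 0 ≤ a j * b j)
    (u : R → C → Bool) (j : C) : 0 ≤ pairCoef η a b u j := by
  have := hη.condMean_sq_le u (.inr j)
  exact div_nonneg (mul_nonneg (hab j) (by positivity)) (by linarith)

/-- Since Re² + Im² ≤ 2 for a column phase, Re²/4 ≤ 1 - Im²/4, and the factor besides a_j b_j is at
most 1. -/
theorem pairCoef_le (hη : SmallPhases η) {a b : C → ℝ} (hab : ∀ j, 0 ≤ a j * b j)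
    (u : R → C → Bool) (j : C) : pairCoef η a b u j ≤ a j * b j := by
  have h := hη.condMean_sq_le u (.inr j)
  have h2 := hη.normSq_phase_le u (.inr j)
  rw [Complex.normSq_apply] at h2
  unfold pairCoef
  rw [mul_div_assoc]
  refine mul_le_of_le_one_right (hab j) ?_
  rw [div_le_one (by linarith)]
  nlinarith [mul_self_nonneg (phase η u (.inr j)).im]

theorem shiftedMean_sub (a : C → ℝ) (ξ : C → Bool) (u : R → C → Bool) (j : C) :
    shiftedMean η a ξ u j - condMean η u (.inr j)
      = a j * bitSign (ξ j) * ((phase η u (.inr j)).re / 2) := by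
  simp only [shiftedMean, condMean, Complex.mul_im, Complex.add_im, Complex.add_re, Complex.one_re,
    Complex.one_im, Complex.re_ofReal_mul, Complex.ofReal_re, Complex.ofReal_im, Complex.I_re, Complex.I_im]
  ring

/-- Given the latent signs, the observed signs are independent. Row m gives the first factor, each
column gives an inner product as in `sum_half_ratio`, and the other rows integrate to 1. -/
theorem sum_prod_mul_likRatio_mul_likRatio (hη : SmallPhases η) (h0 : η m = 0) (a b : C → ℝ)
    (ξ ξ' : C → Bool) (u : R → C → Bool) :
    ∑ y, (∏ i, (1 / 2 * (1 + bitSign (y i) * condMean η u i)))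
      * (likRatio η m a ξ u y * likRatio η m b ξ' u y)
      = (1 + (signPhase a ξ).im / 2 * ((signPhase b ξ').im / 2))
        * ∏ j, (1 + bitSign (ξ j) * bitSign (ξ' j) * pairCoef η a b u j) := by
  set f : R ⊕ C → Bool → ℝ := fun i w => match i with
    | .inl m' => if m' = m then (1 + bitSign w * ((signPhase a ξ).im / 2))
        * (1 + bitSign w * ((signPhase b ξ').im / 2)) else 1
    | .inr j => (1 + bitSign w * shiftedMean η a ξ u j) / (1 + bitSign w * condMean η u (.inr j))
        * ((1 + bitSign w * shiftedMean η b ξ' u j) / (1 + bitSign w * condMean η u (.inr j)))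
    with hf
  have e : ∀ y : R ⊕ C → Bool, (∏ i, (1 / 2 * (1 + bitSign (y i) * condMean η u i)))
      * (likRatio η m a ξ u y * likRatio η m b ξ' u y)
      = ∏ i, ((1 / 2 * (1 + bitSign (y i) * condMean η u i)) * f i (y i)) := by
    intro y
    rw [Finset.prod_mul_distrib (f := fun i => 1 / 2 * (1 + bitSign (y i) * condMean η u i))]
    congr 1
    rw [Fintype.prod_sum_type, likRatio, likRatio, mul_mul_mul_comm, ← Finset.prod_mul_distrib]
    congr 1
    simp only [hf]
    rw [Finset.prod_ite_eq' Finset.univ m fun m' => (1 + bitSign (y (.inl m')) * ((signPhase a ξ).im / 2))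
        * (1 + bitSign (y (.inl m')) * ((signPhase b ξ').im / 2))]
    simp
  simp only [e]
  rw [sum_prod_fun fun i w => (1 / 2 * (1 + bitSign w * condMean η u i)) * f i w,
    Fintype.prod_sum_type]
  congr 1
  · rw [Finset.prod_eq_single m]
    · simp only [hf, condMean_inl_self h0, if_true]
      simp [bitSign]
      ring
    · intro m' _ hm
      simp only [hf, hm, if_false, mul_one]
      exact sum_half_bitSign _
    · simp
  · refine Finset.prod_congr rfl fun j _ => ?_
    simp only [hf]
    rw [sum_half_ratio (hη.abs_condMean_lt u _), shiftedMean_sub, shiftedMean_sub, pairCoef]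
    ring

/-- The ratio is allowed to depend on the latent signs, which makes its conditional moments
explicit. The bound holds for each u separately and is then averaged. -/
theorem sum_latentWeight_mul_rowRatio_mul_rowRatio_le (hη : SmallPhases η) (h0 : η m = 0)
    {a b : C → ℝ} (hab : ∀ j, 0 ≤ a j * b j) (hab1 : ∀ j, a j * b j ≤ 1) :
    ∑ ω, latentWeight η ω * rowRatio η m a ω * rowRatio η m b ω
      ≤ Real.exp (∑ j, (a j * b j) ^ 2) := by
  have e := sum_latentWeight_mul η fun u y => rowRatio η m a (u, y) * rowRatio η m b (u, y)
  simp only [← mul_assoc] at e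
  rw [e]
  have h1 : ∀ u : R → C → Bool,
      ∑ y, (∏ i, (1 / 2 * (1 + bitSign (y i) * condMean η u i)))
        * rowRatio η m a (u, y) * rowRatio η m b (u, y) ≤ Real.exp (∑ j, (a j * b j) ^ 2) := by
    intro u
    refine le_trans (le_of_eq ?_) (sum_half_signPhase_pair_le hab hab1
      (pairCoef_nonneg hη hab u) (pairCoef_le hη hab u))
    simp only [← sum_prod_mul_likRatio_mul_likRatio hη h0, rowRatio]
    simp only [mul_assoc, Finset.sum_mul_sum]
    simp only [Finset.mul_sum]
    rw [Finset.sum_comm]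
    refine Finset.sum_congr rfl fun ξ _ => ?_
    rw [Finset.sum_comm]
    refine Finset.sum_congr rfl fun ξ' _ => Finset.sum_congr rfl fun y _ => ?_
    ring
  calc _ ≤ ∑ _u : R → C → Bool, (∏ _m : R, ∏ _j : C, (1 / 2 : ℝ))
        * Real.exp (∑ j, (a j * b j) ^ 2) :=
        Finset.sum_le_sum fun u _ => mul_le_mul_of_nonneg_left (h1 u) (by positivity)
    _ = _ := by rw [← Finset.sum_mul, sum_matrix_half, one_mul]

end

/-! ### Matrices with balanced rows and columns -/

section

variable {R I J : Type*} [Fintype R] [DecidableEq R] [Fintype I] [DecidableEq I] [Fintype J]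
  [DecidableEq J]

theorem prod_one_add_sq_le {ι : Type*} [Fintype ι] {x : ι → ℝ} {t : ℝ} {d : ℕ}
    (hx : ∀ i, x i = 0 ∨ x i = t) (hd : (Finset.univ.filter fun i => x i ≠ 0).card ≤ d)
    (h2 : (1 + t ^ 2) ^ d ≤ 2) : ∏ i, (1 + x i ^ 2) ≤ 2 := by
  have e : ∀ i, 1 + x i ^ 2 = if x i ≠ 0 then 1 + t ^ 2 else 1 := by
    intro i
    split_ifs with h
    · rw [(hx i).resolve_left h]
    · rw [not_ne_iff.1 h]
      simp
  simp only [e]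
  rw [Finset.prod_ite, Finset.prod_const, Finset.prod_const_one, mul_one]
  exact (pow_le_pow_right₀ (by nlinarith [sq_nonneg t]) hd).trans h2

/-- The row with entries `t` at the graph of `s`. -/
def graphRow (t : ℝ) (s : I → J) (b : I × J) : ℝ := if s b.1 = b.2 then t else 0

/-- The matrix whose rows are `graphRow t (l m)` where `g m` is set, and zero elsewhere. -/
def graphMatrix (t : ℝ) (g : R → Bool) (l : R → I → J) (m : R) : I × J → ℝ :=
  if g m then graphRow t (l m) else 0

/-- Families of maps `I → J` that take each value at each point at most `d` times. -/
def balanced (R I J : Type*) [Fintype R] [DecidableEq R] [Fintype I] [DecidableEq I] [Fintype J]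
    [DecidableEq J] (d : ℕ) : Finset (R → I → J) :=
  Finset.univ.filter fun l => ∀ i j, (Finset.univ.filter fun m => l m i = j).card ≤ d

theorem mem_balanced {d : ℕ} {l : R → I → J} :
    l ∈ balanced R I J d ↔ ∀ i j, (Finset.univ.filter fun m => l m i = j).card ≤ d := by
  simp [balanced]

variable {t : ℝ} {g : R → Bool} {l : R → I → J} {d : ℕ}

theorem graphMatrix_apply (a : R) (b : I × J) :
    graphMatrix t g l a b = if g a = true ∧ l a b.1 = b.2 then t else 0 := by
  unfold graphMatrix
  by_cases hg : g a = true <;> simp [hg, graphRow]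

theorem graphMatrix_eq_or (a : R) (b : I × J) :
    graphMatrix t g l a b = 0 ∨ graphMatrix t g l a b = t := by
  rw [graphMatrix_apply]
  split_ifs <;> simp

theorem card_graphMatrix_row_le (hI : Fintype.card I ≤ d) (a : R) :
    (Finset.univ.filter fun b => graphMatrix t g l a b ≠ 0).card ≤ d := by
  refine le_trans ?_ hI
  refine Finset.card_le_card_of_injOn (t := Finset.univ) Prod.fst (fun _ _ => Finset.mem_univ _) ?_
  have h : ∀ b, graphMatrix t g l a b ≠ 0 → l a b.1 = b.2 := by
    intro b hb
    by_contra h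
    exact hb (by rw [graphMatrix_apply, if_neg fun h' => h h'.2])
  intro x hx y hy hxy
  simp only [Finset.coe_filter, Finset.mem_univ, true_and, Set.mem_ofPred_eq] at hx hy
  exact Prod.ext hxy (by rw [← h x hx, ← h y hy, hxy])

theorem card_graphMatrix_col_le (hl : l ∈ balanced R I J d) (b : I × J) :
    (Finset.univ.filter fun a => graphMatrix t g l a b ≠ 0).card ≤ d := by
  refine le_trans (Finset.card_le_card fun a ha => ?_) (mem_balanced.1 hl b.1 b.2)
  simp only [Finset.mem_filter, Finset.mem_univ, true_and] at ha ⊢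
  by_contra h
  exact ha (by rw [graphMatrix_apply, if_neg fun h' => h h'.2])

theorem smallPhases_graphMatrix (hI : Fintype.card I ≤ d) (ht : (1 + t ^ 2) ^ d ≤ 2)
    (hl : l ∈ balanced R I J d) : SmallPhases (graphMatrix t g l) where
  row a := prod_one_add_sq_le (graphMatrix_eq_or a) (card_graphMatrix_row_le hI a) ht
  col b := prod_one_add_sq_le (fun a => graphMatrix_eq_or a b) (card_graphMatrix_col_le hl b) ht

theorem graphMatrix_update_true (m : R) (s : I → J) :
    graphMatrix t (Function.update g m true) (Function.update l m s)
      = Function.update (graphMatrix t (Function.update g m false) l) m (graphRow t s) := by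
  funext a
  by_cases h : a = m
  · subst h
    simp [graphMatrix]
  · simp [graphMatrix, h]

theorem graphMatrix_update_false (m : R) (s : I → J) :
    graphMatrix t (Function.update g m false) (Function.update l m s)
      = graphMatrix t (Function.update g m false) l := by
  funext a
  by_cases h : a = m
  · subst h
    simp [graphMatrix]
  · simp [graphMatrix, h]

theorem graphMatrix_update_false_self (m : R) :
    graphMatrix t (Function.update g m false) l m = 0 := by
  simp [graphMatrix]

theorem sum_graphRow_sq (s : I → J) : ∑ b, graphRow t s b ^ 2 = Fintype.card I * t ^ 2 := by
  rw [Fintype.sum_prod_type]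
  simp [graphRow, ite_pow]

/-- Two graphs meet in one column for each argument where the maps agree, so only agreements carry
information. -/
theorem sum_graphRow_mul_graphRow_sq (s s' : I → J) :
    ∑ b, (graphRow t s b * graphRow t s' b) ^ 2
      = ∑ i, if s i = s' i then t ^ 4 else 0 := by
  rw [Fintype.sum_prod_type]
  refine Finset.sum_congr rfl fun i _ => ?_
  rw [Finset.sum_eq_single (s i)]
  · simp only [graphRow, if_true]
    by_cases h : s i = s' i
    · rw [if_pos h.symm, if_pos h]
      ring
    · rw [if_neg fun h' => h h'.symm, if_neg h]
      ring
  · intro j _ hj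
    simp [graphRow, hj.symm]
  · simp

/-- The rows that can replace row `m` of a balanced family. -/
def replacements (d : ℕ) (l : R → I → J) (m : R) : Finset (I → J) :=
  Finset.univ.filter fun s => Function.update l m s ∈ balanced R I J d

theorem mem_replacements {m : R} {s : I → J} :
    s ∈ replacements d l m ↔ Function.update l m s ∈ balanced R I J d := by
  simp [replacements]

/-- The values that row `m` of a balanced family can take at `i`. -/
def freeValues (d : ℕ) (l : R → I → J) (m : R) (i : I) : Finset J :=
  Finset.univ.filter fun j => (Finset.univ.filter fun m' => m' ≠ m ∧ l m' i = j).card < d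

theorem card_filter_update (m : R) (s : I → J) (i : I) (j : J) :
    (Finset.univ.filter fun m' => Function.update l m s m' i = j).card
      = (Finset.univ.filter fun m' => m' ≠ m ∧ l m' i = j).card + if s i = j then 1 else 0 := by
  rw [← Finset.card_filter_add_card_filter_not
    (s := Finset.univ.filter fun m' => Function.update l m s m' i = j) (· ≠ m)]
  congr 1
  · rw [Finset.filter_filter]
    congr 1
    ext m'
    simp only [Finset.mem_filter, Finset.mem_univ, true_and]
    constructor
    · rintro ⟨h1, h2⟩
      rw [Function.update_of_ne h2] at h1
      exact ⟨h2, h1⟩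
    · rintro ⟨h2, h1⟩
      rw [Function.update_of_ne h2]
      exact ⟨h1, h2⟩
  · rw [Finset.filter_filter]
    split_ifs with h
    · rw [Finset.card_eq_one]
      refine ⟨m, ?_⟩
      ext m'
      simp only [Finset.mem_filter, Finset.mem_univ, true_and, Finset.mem_singleton, not_not]
      constructor
      · exact fun h => h.2
      · rintro rfl
        simp [h]
    · rw [Finset.card_eq_zero]
      ext m'
      simp only [Finset.mem_filter, Finset.mem_univ, true_and, not_not, Finset.notMem_empty,
        iff_false]
      rintro ⟨h1, rfl⟩
      simp [h] at h1

/-- The balance condition constrains each point i separately, so the admissible replacements form a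
product set and a uniform one has independent values. -/
theorem replacements_eq_piFinset (hl : l ∈ balanced R I J d) (m : R) :
    replacements d l m = Fintype.piFinset (freeValues d l m) := by
  have hle : ∀ i j, (Finset.univ.filter fun m' => m' ≠ m ∧ l m' i = j).card ≤ d := by
    intro i j
    refine le_trans (Finset.card_le_card fun m' h => ?_) (mem_balanced.1 hl i j)
    simp only [Finset.mem_filter, Finset.mem_univ, true_and] at h ⊢
    exact h.2
  ext s
  rw [mem_replacements, mem_balanced, Fintype.mem_piFinset]
  simp only [card_filter_update, freeValues, Finset.mem_filter, Finset.mem_univ, true_and]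
  constructor
  · intro h i
    have := h i (s i)
    rw [if_pos rfl] at this
    exact this
  · intro h i j
    split_ifs with hj
    · subst hj
      exact h i
    · exact hle i j

/-- A value that is not free is already taken by d other rows, so there are at most |R|/d ≤ |J|/2 of
them. -/
theorem card_le_two_mul_card_freeValues (hR : 2 * Fintype.card R ≤ d * Fintype.card J) (hd : 0 < d)
    (m : R) (i : I) : Fintype.card J ≤ 2 * (freeValues d l m i).card := by
  have h1 : (freeValues d l m i).card
      + (Finset.univ.filter fun j => ¬
        (Finset.univ.filter fun m' => m' ≠ m ∧ l m' i = j).card < d).card = Fintype.card J :=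
    Finset.card_filter_add_card_filter_not _
  set bad := Finset.univ.filter fun j => ¬
        (Finset.univ.filter fun m' => m' ≠ m ∧ l m' i = j).card < d with hbad
  have h2 : bad.card * d ≤ Fintype.card R := by
    calc bad.card * d = ∑ _j ∈ bad, d := by simp
      _ ≤ ∑ j ∈ bad, (Finset.univ.filter fun m' => m' ≠ m ∧ l m' i = j).card := by
          refine Finset.sum_le_sum fun j hj => ?_
          simpa [hbad] using hj
      _ ≤ ∑ j, (Finset.univ.filter fun m' => l m' i = j).card := by
          refine le_trans (Finset.sum_le_sum fun j _ => Finset.card_le_card fun m' h => ?_)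
            (Finset.sum_le_sum_of_subset (Finset.subset_univ _))
          simp only [Finset.mem_filter, Finset.mem_univ, true_and] at h ⊢
          exact h.2
      _ = Fintype.card R := (Finset.card_eq_sum_card_fiberwise (s := Finset.univ)
          (t := Finset.univ) (f := fun m' => l m' i) fun _ _ => Finset.mem_univ _).symm
  have h3 : d * (2 * bad.card) ≤ d * Fintype.card J := by
    calc _ = 2 * (bad.card * d) := by ring
      _ ≤ _ := (Nat.mul_le_mul_left 2 h2).trans hR
  have h4 := Nat.le_of_mul_le_mul_left h3 hd
  omega

/-- Two independent uniform elements of a product set seldom agree in many coordinates. -/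
theorem sum_piFinset_prod_le {A : I → Finset J} {L Q : ℝ} (hL : 0 < L) (hQ : 0 ≤ Q)
    (hA : ∀ i, L ≤ (A i).card) :
    ∑ s ∈ Fintype.piFinset A, ∑ s' ∈ Fintype.piFinset A, ∏ i, (if s i = s' i then Q else 1)
      ≤ Real.exp (Fintype.card I * (Q / L)) * ((Fintype.piFinset A).card : ℝ) ^ 2 := by
  have e1 : ∑ s ∈ Fintype.piFinset A, ∑ s' ∈ Fintype.piFinset A,
      ∏ i, (if s i = s' i then Q else 1)
      = ∏ i, ∑ a ∈ A i, ∑ b ∈ A i, if a = b then Q else 1 := by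
    rw [Finset.prod_univ_sum]
    refine Finset.sum_congr rfl fun s _ => ?_
    rw [Finset.prod_univ_sum]
  have e2 : ∀ i, ∑ a ∈ A i, ∑ b ∈ A i, (if a = b then Q else 1)
      ≤ Real.exp (Q / L) * ((A i).card : ℝ) ^ 2 := by
    intro i
    have hc : L ≤ (A i).card := hA i
    have hcp : (0 : ℝ) < (A i).card := hL.trans_le hc
    have h1 : ∑ a ∈ A i, ∑ b ∈ A i, (if a = b then Q else 1)
        ≤ ∑ a ∈ A i, ∑ b ∈ A i, ((if a = b then Q else 0) + 1) := by
      refine Finset.sum_le_sum fun a _ => Finset.sum_le_sum fun b _ => ?_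
      split_ifs <;> linarith
    have h2 : ∑ a ∈ A i, ∑ b ∈ A i, ((if a = b then Q else 0) + 1)
        = (A i).card * Q + (A i).card ^ 2 := by
      simp only [Finset.sum_add_distrib, Finset.sum_ite_eq, Finset.sum_const, nsmul_eq_mul, mul_one]
      rw [Finset.sum_congr rfl fun a ha => if_pos ha, Finset.sum_const, nsmul_eq_mul]
      ring
    rw [h2] at h1
    refine h1.trans ?_
    -- Coordinatewise the double sum is at most |A|² + |A|Q ≤ |A|²(1 + Q/L); the product over the
    -- coordinates gives the exponential.
    have h3 : Q / L + 1 ≤ Real.exp (Q / L) := Real.add_one_le_exp _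
    have h4 : Q ≤ Q / L * (A i).card := by
      rw [div_mul_eq_mul_div, le_div_iff₀ hL]
      exact mul_le_mul_of_nonneg_left hc hQ
    nlinarith [mul_le_mul_of_nonneg_right h3 (sq_nonneg ((A i).card : ℝ))]
  rw [e1]
  refine (Finset.prod_le_prod (fun i _ => Finset.sum_nonneg fun a _ => Finset.sum_nonneg fun b _ =>
    by split_ifs <;> linarith) fun i _ => e2 i).trans (le_of_eq ?_)
  rw [Finset.prod_mul_distrib, Finset.prod_const, ← Real.exp_nat_mul, Fintype.card_piFinset,
    Nat.cast_prod, Finset.prod_pow, Finset.card_univ]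

theorem replacements_update (m : R) (s : I → J) :
    replacements d (Function.update l m s) m = replacements d l m := by
  ext s'
  simp [mem_replacements]

/-- Averaging over replacements of a row preserves sums over balanced families. -/
theorem sum_balanced_average (m : R) (G : (R → I → J) → ℝ)
    (hne : ∀ l ∈ balanced R I J d, (replacements d l m).Nonempty) :
    ∑ l ∈ balanced R I J d, ((replacements d l m).card : ℝ)⁻¹
      * ∑ s ∈ replacements d l m, G (Function.update l m s) = ∑ l ∈ balanced R I J d, G l := by
  -- The exchange of the old and the new row preserves pairs of balanced families, and both members
  -- have the same set of replacements.
  have h := sum_sum_update m fun (l : R → I → J) (s : I → J) =>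
    if l ∈ balanced R I J d ∧ Function.update l m s ∈ balanced R I J d then
      ((replacements d l m).card : ℝ)⁻¹ * G l else 0
  simp only [Function.update_idem, Function.update_eq_self, replacements_update] at h
  have h1 : ∀ l : R → I → J, ∑ s : I → J,
      (if Function.update l m s ∈ balanced R I J d ∧ l ∈ balanced R I J d then
      ((replacements d l m).card : ℝ)⁻¹ * G (Function.update l m s) else 0)
      = if l ∈ balanced R I J d then ((replacements d l m).card : ℝ)⁻¹
      * ∑ s ∈ replacements d l m, G (Function.update l m s) else 0 := by
    intro l
    split_ifs with hl
    · rw [Finset.mul_sum, replacements, Finset.sum_filter]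
      simp [hl]
    · simp [hl]
  have h2 : ∀ l : R → I → J, ∑ s : I → J,
      (if l ∈ balanced R I J d ∧ Function.update l m s ∈ balanced R I J d then
      ((replacements d l m).card : ℝ)⁻¹ * G l else 0)
      = if l ∈ balanced R I J d then G l else 0 := by
    intro l
    split_ifs with hl
    · simp only [hl, true_and]
      rw [← Finset.sum_filter, Finset.sum_const, nsmul_eq_mul, ← mul_assoc]
      change ((replacements d l m).card : ℝ) * ((replacements d l m).card : ℝ)⁻¹ * G l = G l
      rw [mul_inv_cancel₀, one_mul]
      exact_mod_cast (Finset.card_pos.2 (hne l hl)).ne'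
    · simp [hl]
  simp only [h1, h2] at h
  rw [← Finset.sum_filter, ← Finset.sum_filter] at h
  simpa using h

/-! ### The lower bound over balanced families -/

/-- The squared error of the sum of row `m` of the cross-covariance block. -/
noncomputable def rowError {n p : ℕ} {C : Type*} [Fintype C] [DecidableEq C] (τ : ℝ)
    (e : R ⊕ C → Fin p) (T : Sample n p → Matrix (Fin p) (Fin p) ℝ) (η : R → C → ℝ) (m : R) : ℝ :=
  ∫ X, ((∑ b, T X (e (.inl m)) (e (.inr b))) - τ / 32 * ∑ b, η m b ^ 2) ^ 2
    ∂(sampleLaw n (modelLaw τ e η))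

variable {n p : ℕ} {q τ c r : ℝ} {e : R ⊕ (I × J) → Fin p}
  {T : Sample n p → Matrix (Fin p) (Fin p) ℝ}

/-- Apply the error matrix to the indicator of the column coordinates, of squared norm |C|. The
entries of the result at the row coordinates are the errors of the row sums. -/
theorem sum_rowError_le {C : Type*} [Fintype C] [DecidableEq C] {e : R ⊕ C → Fin p}
    {η : R → C → ℝ} (hτ : 0 < τ) (he : Function.Injective e)
    (hη : SmallPhases η) (hr : 0 ≤ r) (hT : maxRisk T q τ c ≤ ENNReal.ofReal r)
    (hmem : modelLaw τ e η ∈ distClass p q τ c) :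
    ∑ m, rowError τ e T η m ≤ Fintype.card C * r := by
  have hint : ∀ f : Sample n p → ℝ, Integrable f (sampleLaw n (modelLaw τ e η)) := fun f =>
    integrable_sampleLaw_atomLaw (latentWeight_nonneg hη) (sum_latentWeight η) _ f
  have h1 := integral_specNorm_sq_le_of_maxRisk_le (latentWeight_nonneg hη) (sum_latentWeight η)
    (Y := embVec e) (n := n) hr hT hmem
  unfold rowError
  rw [← integral_finsetSum _ fun m _ => hint _]
  refine le_trans ?_ (mul_le_mul_of_nonneg_left h1 (Nat.cast_nonneg (Fintype.card C)))
  rw [← integral_const_mul]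
  refine integral_mono (hint _) (hint _) fun X => ?_
  change _ ≤ (Fintype.card C : ℝ) * specNorm (T X - covMat (modelLaw τ e η)) ^ 2
  set v : EuclideanSpace ℝ (Fin p) :=
    WithLp.toLp 2 fun i => if i ∈ Finset.univ.image (fun b => e (.inr b)) then 1 else 0 with hv
  have hinj : Function.Injective fun b : C => e (.inr b) := he.comp Sum.inr_injective
  have hinl : Function.Injective fun a : R => e (.inl a) := he.comp Sum.inl_injective
  have hv2 : ‖v‖ ^ 2 = Fintype.card C := by
    rw [EuclideanSpace.norm_sq_eq]
    simp only [hv, Real.norm_eq_abs, sq_abs, ite_pow, one_pow, ne_eq, OfNat.ofNat_ne_zero,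
      not_false_eq_true, zero_pow]
    rw [Finset.sum_ite_mem, Finset.univ_inter, Finset.sum_const, nsmul_eq_mul, mul_one,
      Finset.card_image_of_injective _ hinj, Finset.card_univ]
  have h2 := norm_sq_mulVec_le (T X - covMat (modelLaw τ e η)) v
  rw [hv2] at h2
  rw [mul_comm]
  refine le_trans ?_ h2
  have h3 : ∀ i, ∑ j, (T X - covMat (modelLaw τ e η)) i j * v j
      = ∑ b, (T X - covMat (modelLaw τ e η)) i (e (.inr b)) := by
    intro i
    simp only [hv, mul_ite, mul_one, mul_zero]
    rw [Finset.sum_ite_mem, Finset.univ_inter, Finset.sum_image fun a _ b _ h => hinj h]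
  simp only [h3]
  calc _ = ∑ m, (∑ b, (T X - covMat (modelLaw τ e η)) (e (.inl m)) (e (.inr b))) ^ 2 := by
        refine Finset.sum_congr rfl fun m _ => ?_
        simp only [Matrix.sub_apply, covMat_modelLaw_inl_inr hτ he hη, Finset.sum_sub_distrib,
          Finset.mul_sum]
    _ = ∑ i ∈ Finset.univ.image (fun a => e (.inl a)),
        (∑ b, (T X - covMat (modelLaw τ e η)) i (e (.inr b))) ^ 2 := by
        rw [Finset.sum_image fun a _ b _ h => hinl h]
    _ ≤ _ := Finset.sum_le_sum_of_subset_of_nonneg (Finset.subset_univ _) fun i _ _ => sq_nonneg _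

/-- Row m absent is tested against row m present in a uniformly random admissible position, the
other rows being fixed. The n-th power of the cross moment is a product of e^{n t⁴} over the
agreements of two positions, which `sum_piFinset_prod_le` averages. -/
theorem card_replacements_mul_le (ht1 : t ^ 2 ≤ 1) (hI : Fintype.card I ≤ d)
    (hd : 0 < d) (ht : (1 + t ^ 2) ^ d ≤ 2) (hR : 2 * Fintype.card R ≤ d * Fintype.card J)
    (hJ : 0 < Fintype.card J) (hτ : 0 < τ) {B : ℝ}
    (hB : Real.exp (Fintype.card I * (Real.exp (n * t ^ 4) / (Fintype.card J / 2))) ≤ B)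
    (hl : l ∈ balanced R I J d) (m : R) :
    ((replacements d l m).card : ℝ) * ((τ / 32 * (Fintype.card I * t ^ 2)) ^ 2 / (1 + B))
      ≤ ∑ s ∈ replacements d l m,
        (rowError τ e T (graphMatrix t (Function.update g m false) (Function.update l m s)) m
        + rowError τ e T (graphMatrix t (Function.update g m true) (Function.update l m s)) m) := by
  set η := graphMatrix t (Function.update g m false) l with hη_def
  have hη : SmallPhases η := smallPhases_graphMatrix hI ht hl
  have h0 : η m = 0 := graphMatrix_update_false_self m
  have hηs : ∀ s ∈ replacements d l m, SmallPhases (Function.update η m (graphRow t s)) := by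
    intro s hs
    rw [hη_def, ← graphMatrix_update_true]
    exact smallPhases_graphMatrix hI ht (mem_replacements.1 hs)
  have hfree : ∀ i, (Fintype.card J / 2 : ℝ) ≤ (freeValues d l m i).card := by
    intro i
    have h : (Fintype.card J : ℝ) ≤ 2 * (freeValues d l m i).card := by
      exact_mod_cast card_le_two_mul_card_freeValues hR hd m i
    linarith
  have hJr : (0 : ℝ) < Fintype.card J := by exact_mod_cast hJ
  have hne : (replacements d l m).Nonempty := by
    rw [replacements_eq_piFinset hl, Fintype.piFinset_nonempty]
    intro i
    rw [← Finset.card_pos]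
    have := hfree i
    exact_mod_cast (half_pos hJr).trans_le this
  have : Nonempty (replacements d l m) := hne.to_subtype
  have hB0 : 0 ≤ B := (Real.exp_pos _).le.trans hB
  have hnn : ∀ (s s' : I → J) b, 0 ≤ graphRow t s b * graphRow t s' b := by
    intro s s' b
    unfold graphRow
    split_ifs <;> simp [mul_self_nonneg]
  have hle1 : ∀ (s s' : I → J) b, graphRow t s b * graphRow t s' b ≤ 1 := by
    intro s s' b
    unfold graphRow
    split_ifs <;> simp [← sq, ht1]
  have hpair : ∑ a : replacements d l m, ∑ b : replacements d l m,
      (∑ ω, latentWeight η ω * rowRatio η m (graphRow t a.1) ω * rowRatio η m (graphRow t b.1) ω) ^ n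
      ≤ B * (Fintype.card (replacements d l m) : ℝ) ^ 2 := by
    have h1 : ∀ a b : replacements d l m,
        (∑ ω, latentWeight η ω * rowRatio η m (graphRow t a.1) ω
          * rowRatio η m (graphRow t b.1) ω) ^ n
        ≤ ∏ i, (if a.1 i = b.1 i then Real.exp (n * t ^ 4) else 1) := by
      intro a b
      have h2 := sum_latentWeight_mul_rowRatio_mul_rowRatio_le hη h0 (hnn a.1 b.1) (hle1 a.1 b.1)
      refine (pow_le_pow_left₀ (Finset.sum_nonneg fun ω _ => mul_nonneg (mul_nonneg
        (latentWeight_nonneg hη ω) (rowRatio_nonneg hη h0 (hηs _ a.2) ω))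
        (rowRatio_nonneg hη h0 (hηs _ b.2) ω)) h2 n).trans (le_of_eq ?_)
      rw [sum_graphRow_mul_graphRow_sq, ← Real.exp_nat_mul, Finset.mul_sum, Real.exp_sum]
      refine Finset.prod_congr rfl fun i _ => ?_
      split_ifs <;> simp
    refine (Finset.sum_le_sum fun a _ => Finset.sum_le_sum fun b _ => h1 a b).trans ?_
    rw [Fintype.card_coe]
    rw [Finset.sum_coe_sort (replacements d l m) fun s : I → J =>
      ∑ b : replacements d l m, ∏ i, (if s i = b.1 i then Real.exp (n * t ^ 4) else 1),
      Finset.sum_congr rfl fun s _ => Finset.sum_coe_sort (replacements d l m) fun s' : I → J =>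
      ∏ i, (if s i = s' i then Real.exp (n * t ^ 4) else 1), replacements_eq_piFinset hl]
    refine (sum_piFinset_prod_le (half_pos hJr) (Real.exp_pos _).le hfree).trans ?_
    exact mul_le_mul_of_nonneg_right hB (sq_nonneg _)
  have key := card_mul_sq_le_integral_atomLaw (τ := τ) (n := n) (latentWeight_nonneg hη)
    (sum_latentWeight η) (h := fun (a : replacements d l m) ω => rowRatio η m (graphRow t a.1) ω)
    (fun a ω => rowRatio_nonneg hη h0 (hηs _ a.2) ω)
    (fun a => sum_latentWeight_mul_rowRatio hη h0 _) hB0 hpair (embVec e)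
    (D := fun X => ∑ b, T X (e (.inl m)) (e (.inr b)))
    (F := fun _ X => (∑ b, T X (e (.inl m)) (e (.inr b))) - τ / 32 * (Fintype.card I * t ^ 2))
    (δ := τ / 32 * (Fintype.card I * t ^ 2)) (by positivity) (by
      intro a X
      have h1 := neg_abs_le ((∑ b, T X (e (.inl m)) (e (.inr b)))
        - τ / 32 * (Fintype.card I * t ^ 2))
      have h2 := le_abs_self (∑ b, T X (e (.inl m)) (e (.inr b)))
      linarith)
  rw [Fintype.card_coe] at key
  refine key.trans (le_of_eq ?_)
  rw [Finset.sum_add_distrib, ← Finset.sum_coe_sort (replacements d l m) fun s =>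
    rowError τ e T (graphMatrix t (Function.update g m true) (Function.update l m s)) m]
  congr 1
  · simp only [graphMatrix_update_false]
    rw [Finset.sum_const, nsmul_eq_mul, ← hη_def, rowError]
    simp only [h0, Pi.zero_apply, ne_eq, OfNat.ofNat_ne_zero, not_false_eq_true, zero_pow,
      Finset.sum_const_zero, mul_zero, sub_zero]
    rfl
  · refine Finset.sum_congr rfl fun a _ => ?_
    rw [graphMatrix_update_true, ← hη_def, rowError, modelLaw_update τ e hη h0 (hηs _ a.2)]
    simp only [Function.update_self, sum_graphRow_sq]

/-- Assouad's argument: switch patterns g and balanced families l are averaged uniformly. Resampling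
one switch and one row preserves both averages, so every row contributes its testing error, while
the sum over rows is at most |C| times the risk. -/
theorem card_mul_le_of_maxRisk_le (hq : 0 ≤ q) (hc : 0 ≤ c) (hτ : 0 < τ)
    (he : Function.Injective e) (ht1 : t ^ 2 ≤ 1) (hI : Fintype.card I ≤ d)
    (hd : 0 < d) (ht : (1 + t ^ 2) ^ d ≤ 2) (hR : 2 * Fintype.card R ≤ d * Fintype.card J)
    (hJ : 0 < Fintype.card J) (hdc : (τ / 32 * t ^ 2) ^ q * d ≤ c) {B : ℝ}
    (hB : Real.exp (Fintype.card I * (Real.exp (n * t ^ 4) / (Fintype.card J / 2))) ≤ B)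
    (hne : (balanced R I J d).Nonempty) (hr : 0 ≤ r) (hT : maxRisk T q τ c ≤ ENNReal.ofReal r) :
    Fintype.card R * ((τ / 32 * (Fintype.card I * t ^ 2)) ^ 2 / (1 + B))
      ≤ 2 * (Fintype.card (I × J) * r) := by
  set δ := (τ / 32 * (Fintype.card I * t ^ 2)) ^ 2 / (1 + B) with hδ
  set E : (R → Bool) → (R → I → J) → R → ℝ := fun g l m =>
    rowError τ e T (graphMatrix t g l) m with hE
  have hJr : (0 : ℝ) < Fintype.card J := by exact_mod_cast hJ
  have hrep : ∀ m : R, ∀ l ∈ balanced R I J d, (replacements d l m).Nonempty := by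
    intro m l hl
    rw [replacements_eq_piFinset hl, Fintype.piFinset_nonempty]
    intro i
    rw [← Finset.card_pos]
    have := card_le_two_mul_card_freeValues (l := l) hR hd m i
    omega
  have h1 : ∀ m : R, ∀ g : R → Bool, (balanced R I J d).card * δ
      ≤ ∑ l ∈ balanced R I J d, (E (Function.update g m false) l m
        + E (Function.update g m true) l m) := by
    intro m g
    rw [← sum_balanced_average m _ (hrep m), ← nsmul_eq_mul, ← Finset.sum_const]
    refine Finset.sum_le_sum fun l hl => ?_
    have h2 := card_replacements_mul_le (e := e) (T := T) (g := g) ht1 hI hd ht hR hJ hτ hB hl m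
    have h3 : (0 : ℝ) < (replacements d l m).card := by
      exact_mod_cast Finset.card_pos.2 (hrep m l hl)
    rw [le_inv_mul_iff₀ h3]
    exact h2
  have h2 : ∀ m : R, (Fintype.card (R → Bool) : ℝ) * ((balanced R I J d).card * δ)
      ≤ 2 * ∑ g, ∑ l ∈ balanced R I J d, E g l m := by
    intro m
    have h3 := Finset.sum_le_sum fun g (_ : g ∈ Finset.univ) => h1 m g
    rw [Finset.sum_const, nsmul_eq_mul, Finset.card_univ] at h3
    refine h3.trans (le_of_eq ?_)
    -- Switching bit m off or on, averaged over all g, covers every pattern twice.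
    have h4 := sum_sum_update m fun (g : R → Bool) (_ : Bool) => ∑ l ∈ balanced R I J d, E g l m
    simp only [Fintype.sum_bool] at h4
    simp only [Finset.sum_add_distrib] at h4 ⊢
    linarith
  have h5 : (Fintype.card R : ℝ) * ((Fintype.card (R → Bool) : ℝ) * ((balanced R I J d).card * δ))
      ≤ 2 * ∑ g : R → Bool, ∑ l ∈ balanced R I J d, ∑ m, E g l m := by
    have h3 := Finset.sum_le_sum fun m (_ : m ∈ Finset.univ) => h2 m
    rw [Finset.sum_const, nsmul_eq_mul, Finset.card_univ, ← Finset.mul_sum] at h3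
    refine h3.trans (le_of_eq ?_)
    rw [Finset.sum_comm]
    congr 1
    exact Finset.sum_congr rfl fun g _ => Finset.sum_comm
  have h6 : ∑ g : R → Bool, ∑ l ∈ balanced R I J d, ∑ m, E g l m
      ≤ (Fintype.card (R → Bool) : ℝ) * ((balanced R I J d).card * (Fintype.card (I × J) * r)) := by
    have h7 : ∀ g : R → Bool, ∀ l ∈ balanced R I J d, ∑ m, E g l m ≤ Fintype.card (I × J) * r := by
      intro g l hl
      have hη : SmallPhases (graphMatrix t g l) := smallPhases_graphMatrix hI ht hl
      exact sum_rowError_le hτ he hη hr hT (modelLaw_mem_distClass hq hc hτ he hη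
        graphMatrix_eq_or (card_graphMatrix_row_le hI) (card_graphMatrix_col_le hl) hdc)
    refine (Finset.sum_le_sum fun g _ => Finset.sum_le_sum (h7 g)).trans (le_of_eq ?_)
    simp only [Finset.sum_const, nsmul_eq_mul, Finset.card_univ]
  have hpos : (0 : ℝ) < Fintype.card (R → Bool) * (balanced R I J d).card := by
    have h8 : 0 < Fintype.card (R → Bool) * (balanced R I J d).card :=
      Nat.mul_pos Fintype.card_pos (Finset.card_pos.2 hne)
    exact_mod_cast h8
  refine le_of_mul_le_mul_left ?_ hpos
  linarith

end

/-! ### Lower bounds on the minimax risk -/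

/-- The constant maps suffice: each value is taken by k rows, within the allowance 2k. -/
theorem balanced_nonempty (k L : ℕ) :
    (balanced (Fin k × Fin L) (Fin k) (Fin L) (2 * k)).Nonempty := by
  refine ⟨fun m _ => m.2, mem_balanced.2 fun i j => ?_⟩
  have h : (Finset.univ.filter fun m : Fin k × Fin L => m.2 = j).card
      ≤ (Finset.univ : Finset (Fin k)).card := by
    refine Finset.card_le_card_of_injOn Prod.fst (fun _ _ => Finset.mem_univ _) ?_
    intro x hx y hy hxy
    simp only [Finset.coe_filter, Finset.mem_univ, true_and, Set.mem_ofPred_eq] at hx hy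
    exact Prod.ext hxy (hx.trans hy.symm)
  rw [Finset.card_univ, Fintype.card_fin] at h
  omega

theorem sparse_le_of_maxRisk_le {n p k : ℕ} {q τ c r ε : ℝ} (hq : 0 ≤ q) (hc : 0 ≤ c)
    (hτ : 0 < τ) (hk : 0 < k) (hε0 : 0 ≤ ε) (hε1 : ε ≤ 1) (hkε : k * ε ≤ 1 / 4)
    (hkn : 16 * (k : ℝ) ^ 2 ≤ n) (hnp : n * Real.exp (n * ε ^ 2) ≤ p)
    (hkc : (τ / 32 * ε) ^ q * (2 * k) ≤ c) {T : Sample n p → Matrix (Fin p) (Fin p) ℝ}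
    (hr : 0 ≤ r) (hT : maxRisk T q τ c ≤ ENNReal.ofReal r) :
    (τ / 32 * (k * ε)) ^ 2 / 8 ≤ r := by
  have hk1 : (1 : ℝ) ≤ k := by exact_mod_cast hk
  have hQ1 : 1 ≤ Real.exp (n * ε ^ 2) := Real.one_le_exp (by positivity)
  have hnp' : (n : ℝ) ≤ p := by
    have : (0 : ℝ) ≤ n := Nat.cast_nonneg n
    nlinarith
  have hkp : 2 * k ≤ p := by
    have : (2 * k : ℝ) ≤ p := by nlinarith
    exact_mod_cast this
  -- There are kL rows and kL columns, which fit into p coordinates. Equal numbers make the factors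
  -- |R| and |C| cancel, and the allowance d = 2k leaves half of the L values free.
  set L := p / (2 * k) with hL
  have hL0 : 0 < L := Nat.div_pos hkp (by omega)
  have hLp : 2 * k * L ≤ p := Nat.mul_div_le p (2 * k)
  have hpL : p < 2 * k * (L + 1) := Nat.lt_mul_div_succ p (by omega)
  have hpL' : (p : ℝ) ≤ 4 * k * L := by
    have h1 : p ≤ 4 * k * L := by nlinarith
    exact_mod_cast h1
  have hLr : (0 : ℝ) < L := by exact_mod_cast hL0
  obtain ⟨e⟩ : Nonempty ((Fin k × Fin L) ⊕ (Fin k × Fin L) ↪ Fin p) := by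
    refine Function.Embedding.nonempty_of_card_le ?_
    simp only [Fintype.card_sum, Fintype.card_prod, Fintype.card_fin]
    linarith
  have ht2 : √ε ^ 2 = ε := Real.sq_sqrt hε0
  have ht4 : √ε ^ 4 = ε ^ 2 := by
    rw [show 4 = 2 * 2 from rfl, pow_mul, ht2]
  have h := card_mul_le_of_maxRisk_le (R := Fin k × Fin L) (I := Fin k) (J := Fin L)
    (t := √ε) (d := 2 * k) (B := 3) (e := e) hq hc hτ e.injective (by rwa [ht2])
    (by rw [Fintype.card_fin]; omega) (by omega)
    (by
      rw [ht2]
      calc (1 + ε) ^ (2 * k) ≤ Real.exp ε ^ (2 * k) :=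
            pow_le_pow_left₀ (by linarith) (by rw [add_comm]; exact Real.add_one_le_exp ε) _
        _ = Real.exp (2 * (k * ε)) := by
            rw [← Real.exp_nat_mul]
            push_cast
            ring_nf
        _ ≤ Real.exp (Real.log 2) := Real.exp_le_exp.2 (by linarith [Real.log_two_gt_d9])
        _ = 2 := Real.exp_log two_pos)
    (by
      simp only [Fintype.card_prod, Fintype.card_fin]
      linarith)
    (by rwa [Fintype.card_fin])
    (by
      rw [ht2]
      push_cast
      exact hkc)
    (by
      rw [ht4, Fintype.card_fin, Fintype.card_fin]
      -- From 16k² ≤ n, n e^{nε²} ≤ p and p ≤ 4kL: the exponent is at most 1, and e ≤ 3 = B.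
      have h1 : k * (Real.exp (n * ε ^ 2) / (L / 2)) ≤ 1 := by
        rw [mul_div_assoc', div_le_one (by positivity)]
        have h2 : 16 * (k : ℝ) ^ 2 * Real.exp (n * ε ^ 2) ≤ 4 * k * L :=
          (mul_le_mul_of_nonneg_right hkn (by positivity)).trans (hnp.trans hpL')
        have h3 : k * (k * Real.exp (n * ε ^ 2)) ≤ k * (L / 2 : ℝ) := by nlinarith
        exact le_of_mul_le_mul_left h3 (by linarith)
      exact (Real.exp_le_exp.2 h1).trans (by linarith [Real.exp_one_lt_d9]))
    (balanced_nonempty k L) hr hT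
  simp only [Fintype.card_prod, Fintype.card_fin, ht2] at h
  have hN : (0 : ℝ) < (k * L : ℕ) := by exact_mod_cast Nat.mul_pos hk hL0
  have h5 := le_of_mul_le_mul_left (h.trans_eq (mul_left_comm _ _ _)) hN
  linarith

/-- With x = n and y = log p this isolates √(log p / n)^q in the bound on c, leaving a bound on k
free of q. -/
theorem rpow_mul_rpow_neg_eq {x y q : ℝ} (hx : 0 < x) (hy : 0 < y) :
    x ^ ((1 - q) / 2) * y ^ (-((3 - q) / 2)) = √x / (y * √y) * √(y / x) ^ q := by
  obtain ⟨a, rfl⟩ : ∃ a, Real.exp a = x := ⟨_, Real.exp_log hx⟩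
  obtain ⟨b, rfl⟩ : ∃ b, Real.exp b = y := ⟨_, Real.exp_log hy⟩
  rw [← Real.exp_sub, ← Real.exp_half, ← Real.exp_half, ← Real.exp_half, ← Real.exp_mul,
    ← Real.exp_mul, ← Real.exp_mul, ← Real.exp_add, ← Real.exp_add, ← Real.exp_sub, ← Real.exp_add]
  congr 1
  ring

set_option maxHeartbeats 1000000 in
theorem le_minimaxRisk {q τ β M K : ℝ} (hq0 : 0 ≤ q) (hτ : 0 < τ) (hβ : 1 < β)
    (hM : 0 < M) (hK : 0 < K) :
    ∃ c₀ : ℝ, 0 < c₀ ∧ ∀ (n p : ℕ) (c : ℝ), 1 < n → (n : ℝ) ^ β ≤ p → 0 ≤ c →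
      c ≤ M * (n : ℝ) ^ ((1 - q) / 2) * Real.log p ^ (-((3 - q) / 2)) →
      Real.log p ≤ K * n →
      ENNReal.ofReal (c₀ * rate n p q c) ≤ minimaxRisk n p q τ c := by
  have hβ' : 0 < 1 - 1 / β := by
    rw [sub_pos, div_lt_one (by linarith)]
    exact hβ
  -- With ε = υ√(log p / n), the three terms ensure e^{nε²} ≤ p, ε ≤ 1, and n e^{nε²} ≤ p.
  set υ : ℝ := min 1 (min (√(1 / K)) (√(1 - 1 / β))) with hυ
  have hυ0 : 0 < υ := lt_min one_pos (lt_min (by positivity) (Real.sqrt_pos.2 hβ'))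
  have hυ1 : υ ≤ 1 := min_le_left _ _
  have hυK : υ ^ 2 * K ≤ 1 := by
    have h1 : υ ≤ √(1 / K) := (min_le_right _ _).trans (min_le_left _ _)
    have h2 : υ ^ 2 ≤ 1 / K := (Real.le_sqrt hυ0.le (by positivity)).1 h1
    rwa [le_div_iff₀ hK] at h2
  have hυβ : υ ^ 2 ≤ 1 - 1 / β :=
    (Real.le_sqrt hυ0.le hβ'.le).1 ((min_le_right _ _).trans (min_le_right _ _))
  have hυ2 : υ ^ 2 ≤ 1 := pow_le_one₀ hυ0.le hυ1
  have hυq : 0 < υ ^ q := Real.rpow_pos_of_pos hυ0 q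
  have hτq : 0 < (τ / 32) ^ q := Real.rpow_pos_of_pos (by positivity) q
  -- For k ≤ κc/ε^q, the first term keeps the planted covariances in the weak ball of radius c; the
  -- second converts the bound on c into 16k² ≤ n and kε ≤ 1/4.
  set κ : ℝ := min (1 / (2 * (τ / 32) ^ q)) (υ ^ q / (4 * M)) with hκ
  have hκ0 : 0 < κ := lt_min (by positivity) (by positivity)
  have hκ1 : (τ / 32) ^ q * (2 * κ) ≤ 1 := by
    have := min_le_left (1 / (2 * (τ / 32) ^ q)) (υ ^ q / (4 * M))
    rw [← hκ, le_div_iff₀ (by positivity)] at this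
    linarith
  have hκ2 : κ * (4 * M) ≤ υ ^ q := by
    have := min_le_right (1 / (2 * (τ / 32) ^ q)) (υ ^ q / (4 * M))
    rwa [← hκ, le_div_iff₀ (by positivity)] at this
  set A₀ : ℝ := (τ / 16 * υ) ^ 2 / 6 with hA₀
  set A₁ : ℝ := (τ / 32 * (κ / 2) * υ ^ (1 - q)) ^ 2 / 8 with hA₁
  have hυq' : 0 < υ ^ (1 - q) := Real.rpow_pos_of_pos hυ0 _
  have hA₀0 : 0 < A₀ := by positivity
  have hA₁0 : 0 < A₁ := by positivity
  refine ⟨min A₀ (min A₁ (A₀ * κ ^ 2)) / 2,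
    half_pos (lt_min hA₀0 (lt_min hA₁0 (by positivity))), ?_⟩
  intro n p c hn hnp hc hcM hpK
  refine le_minimaxRisk_of_forall fun T r hr hT => ?_
  have hn1 : (1 : ℝ) < n := by exact_mod_cast hn
  have hn0 : (0 : ℝ) < n := by linarith
  have hnltp : (n : ℝ) < p := by
    refine lt_of_lt_of_le ?_ hnp
    calc (n : ℝ) = (n : ℝ) ^ (1 : ℝ) := (Real.rpow_one _).symm
      _ < (n : ℝ) ^ β := Real.rpow_lt_rpow_of_exponent_lt hn1 hβ
  have hp3 : 3 ≤ p := by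
    have : n < p := by exact_mod_cast hnltp
    omega
  have hp3' : (3 : ℝ) ≤ p := by exact_mod_cast hp3
  have hp0 : (0 : ℝ) < p := by linarith
  set l := Real.log p with hl
  have hl1 : 1 ≤ l := by
    rw [hl, Real.le_log_iff_exp_le hp0]
    linarith [Real.exp_one_lt_d9]
  have hl0 : 0 < l := by linarith
  have hel : Real.exp l = p := Real.exp_log hp0
  set x := l / n with hx
  have hx0 : 0 < x := by positivity
  have hnx : n * x = l := mul_div_cancel₀ _ hn0.ne'
  have hxK : x ≤ K := by
    rw [hx, div_le_iff₀ hn0]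
    exact hpK
  set s := √x with hs
  have hs0 : 0 < s := Real.sqrt_pos.2 hx0
  have hs2 : s ^ 2 = x := Real.sq_sqrt hx0.le
  set ε := υ * s with hε
  have hε0 : 0 < ε := by positivity
  have hε2 : ε ^ 2 = υ ^ 2 * x := by rw [hε, mul_pow, hs2]
  have hε1 : ε ≤ 1 := by
    rw [← sq_le_one_iff₀ hε0.le, hε2]
    nlinarith [sq_nonneg υ]
  have hnε : n * ε ^ 2 = υ ^ 2 * l := by
    rw [hε2, ← hnx]
    ring
  have hparam : A₀ * x ≤ r := by
    have h := parametric_le_of_maxRisk_le (n := n) (ρ := ε) hq0 hτ hc (by omega) hε0.le hε1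
      (by
        calc (1 + ε ^ 2) ^ n ≤ Real.exp (ε ^ 2) ^ n :=
              pow_le_pow_left₀ (by positivity)
                (by rw [add_comm]; exact Real.add_one_le_exp _) n
          _ = Real.exp (υ ^ 2 * l) := by rw [← Real.exp_nat_mul, hnε]
          _ ≤ Real.exp l := Real.exp_le_exp.2 (by nlinarith)
          _ = p := hel) hr hT
    refine le_trans (le_of_eq ?_) h
    rw [mul_pow, hε2, hA₀]
    ring
  have hεq : ε ^ q = υ ^ q * s ^ q := Real.mul_rpow hυ0.le hs0.le
  have hsq : 0 < s ^ q := Real.rpow_pos_of_pos hs0 q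
  have hεq0 : 0 < ε ^ q := Real.rpow_pos_of_pos hε0 q
  have hxq : x ^ (1 - q) = (s ^ (1 - q)) ^ 2 := by
    rw [← hs2, ← Real.rpow_natCast, ← Real.rpow_natCast, ← Real.rpow_mul hs0.le,
      ← Real.rpow_mul hs0.le, mul_comm]
  have hss : s ^ q * s ^ (1 - q) = s := by
    rw [← Real.rpow_add hs0]
    simp
  have hsq' : 0 < s ^ (1 - q) := Real.rpow_pos_of_pos hs0 _
  have hsparse : min A₁ (A₀ * κ ^ 2) * (c ^ 2 * x ^ (1 - q)) ≤ r := by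
    have hcx : 0 ≤ c ^ 2 * x ^ (1 - q) := by positivity
    -- If not even one planted entry per row is allowed, then c is at most of order ε^q and the
    -- sparse term is dominated by log p / n, already handled.
    rcases le_or_gt 1 (κ * c / ε ^ q) with h1 | h1
    · set z := κ * c / ε ^ q with hz
      have hzε : z * ε ^ q = κ * c := div_mul_cancel₀ _ hεq0.ne'
      set k := ⌊z⌋₊ with hk
      have hkz : (k : ℝ) ≤ z := Nat.floor_le (by linarith)
      have hzk : z < k + 1 := Nat.lt_floor_add_one z
      have hk0 : 0 < k := Nat.floor_pos.2 h1
      have hk1 : (1 : ℝ) ≤ k := by exact_mod_cast hk0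
      have hzn : z ≤ √n / (l * √l) / 4 := by
        rw [mul_assoc, rpow_mul_rpow_neg_eq hn0 hl0] at hcM
        rw [hz, div_le_iff₀ hεq0, hεq]
        calc κ * c ≤ κ * (M * (√n / (l * √l) * s ^ q)) := mul_le_mul_of_nonneg_left hcM hκ0.le
          _ = κ * (4 * M) * (√n / (l * √l) / 4 * s ^ q) := by ring
          _ ≤ υ ^ q * (√n / (l * √l) / 4 * s ^ q) :=
              mul_le_mul_of_nonneg_right hκ2 (by positivity)
          _ = _ := by ring
      have hlow : √n / (l * √l) * s ≤ 1 := by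
        rw [hs, hx, Real.sqrt_div hl0.le]
        have h2 : 0 < √(n : ℝ) := Real.sqrt_pos.2 hn0
        have h3 : 0 < √l := Real.sqrt_pos.2 hl0
        have h4 : √n / (l * √l) * (√l / √n) = 1 / l := by field_simp
        rw [h4, div_le_one hl0]
        exact hl1
      have hzs : z * s ≤ 1 / 4 := by
        calc z * s ≤ √n / (l * √l) / 4 * s := mul_le_mul_of_nonneg_right hzn hs0.le
          _ = √n / (l * √l) * s / 4 := by ring
          _ ≤ 1 / 4 := by linarith
      have hkε : k * ε ≤ 1 / 4 := by
        have h2 : k * ε ≤ z * s := by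
          refine mul_le_mul hkz ?_ hε0.le (by linarith)
          rw [hε]
          exact mul_le_of_le_one_left hs0.le hυ1
        exact h2.trans hzs
      have hkn : 16 * (k : ℝ) ^ 2 ≤ n := by
        have h2 : √n / (l * √l) ≤ √n := by
          refine div_le_self (Real.sqrt_nonneg _) ?_
          have : 1 ≤ √l := Real.one_le_sqrt.2 hl1
          nlinarith
        have h3 : 4 * (k : ℝ) ≤ √n := by linarith
        have h4 := (Real.le_sqrt (by positivity) hn0.le).1 h3
        linarith
      -- Here n ≤ p^(1/β) and e^{nε²} ≤ p^(1 - 1/β).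
      have hnQ : n * Real.exp (n * ε ^ 2) ≤ p := by
        have h2 : (n : ℝ) ≤ Real.exp (l / β) := by
          have h3 : Real.log n * β ≤ l := by
            have h4 := Real.log_le_log (by positivity) hnp
            rw [Real.log_rpow hn0] at h4
            linarith
          rw [← Real.log_le_iff_le_exp hn0, le_div_iff₀ (by linarith)]
          exact h3
        calc n * Real.exp (n * ε ^ 2) ≤ Real.exp (l / β) * Real.exp (υ ^ 2 * l) := by
              rw [hnε]
              exact mul_le_mul_of_nonneg_right h2 (Real.exp_pos _).le
          _ = Real.exp (l / β + υ ^ 2 * l) := (Real.exp_add _ _).symm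
          _ ≤ Real.exp l := by
              refine Real.exp_le_exp.2 ?_
              have h5 : υ ^ 2 * l ≤ (1 - 1 / β) * l := mul_le_mul_of_nonneg_right hυβ hl0.le
              have h6 : l / β = 1 / β * l := by ring
              linarith
          _ = p := hel
      have hkc : (τ / 32 * ε) ^ q * (2 * k) ≤ c := by
        rw [Real.mul_rpow (by positivity) hε0.le]
        calc (τ / 32) ^ q * ε ^ q * (2 * k) ≤ (τ / 32) ^ q * ε ^ q * (2 * z) := by gcongr
          _ = (τ / 32) ^ q * 2 * (z * ε ^ q) := by ring
          _ = (τ / 32) ^ q * (2 * κ) * c := by rw [hzε]; ring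
          _ ≤ 1 * c := mul_le_mul_of_nonneg_right hκ1 hc
          _ = c := one_mul c
      have h := sparse_le_of_maxRisk_le (T := T) hq0 hc hτ hk0 hε0.le hε1 hkε hkn hnQ hkc hr hT
      refine le_trans (mul_le_mul_of_nonneg_right (min_le_left _ _) hcx) (le_trans ?_ h)
      have hkey : κ / 2 * υ ^ (1 - q) * (c * s ^ (1 - q)) ≤ k * ε := by
        -- Rounding down loses at most a factor 2 because k ≥ 1; this is the κ/2 in A₁.
        have h2 : z / 2 ≤ k := by linarith
        have hυυ : υ ^ q * υ ^ (1 - q) = υ := by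
          rw [← Real.rpow_add hυ0]
          simp
        have h3 : ε = ε ^ q * (υ ^ (1 - q) * s ^ (1 - q)) := by
          rw [hεq, mul_mul_mul_comm, hυυ, hss]
        calc κ / 2 * υ ^ (1 - q) * (c * s ^ (1 - q))
            = (κ * c) / 2 * (υ ^ (1 - q) * s ^ (1 - q)) := by ring
          _ = z / 2 * (ε ^ q * (υ ^ (1 - q) * s ^ (1 - q))) := by rw [← hzε]; ring
          _ = z / 2 * ε := by rw [← h3]
          _ ≤ k * ε := mul_le_mul_of_nonneg_right h2 hε0.le
      rw [hxq, hA₁]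
      have h4 := mul_le_mul_of_nonneg_left hkey (by positivity : 0 ≤ τ / 32)
      have h5 := pow_le_pow_left₀ (by positivity) h4 2
      calc _ = (τ / 32 * (κ / 2 * υ ^ (1 - q) * (c * s ^ (1 - q)))) ^ 2 / 8 := by ring
        _ ≤ _ := by linarith
    · have h2 : κ * c < ε ^ q := by rwa [div_lt_one hεq0] at h1
      have h3 : κ * c ≤ s ^ q := by
        refine h2.le.trans ?_
        rw [hεq]
        exact mul_le_of_le_one_left hsq.le (Real.rpow_le_one hυ0.le hυ1 hq0)
      have h4 : (κ * c * s ^ (1 - q)) ^ 2 ≤ x := by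
        rw [← hs2]
        refine pow_le_pow_left₀ (by positivity) ?_ 2
        calc κ * c * s ^ (1 - q) ≤ s ^ q * s ^ (1 - q) :=
              mul_le_mul_of_nonneg_right h3 hsq'.le
          _ = s := hss
      refine le_trans (mul_le_mul_of_nonneg_right (min_le_right _ _) hcx) (le_trans ?_ hparam)
      rw [hxq]
      calc _ = A₀ * (κ * c * s ^ (1 - q)) ^ 2 := by ring
        _ ≤ _ := mul_le_mul_of_nonneg_left h4 hA₀0.le
  have h1 : min A₀ (min A₁ (A₀ * κ ^ 2)) * x ≤ A₀ * x :=
    mul_le_mul_of_nonneg_right (min_le_left _ _) hx0.le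
  have h2 : min A₀ (min A₁ (A₀ * κ ^ 2)) * (c ^ 2 * x ^ (1 - q))
      ≤ min A₁ (A₀ * κ ^ 2) * (c ^ 2 * x ^ (1 - q)) :=
    mul_le_mul_of_nonneg_right (min_le_right _ _) (by positivity)
  unfold rate
  rw [← hl, ← hx, mul_add]
  linarith

end SparseCov

theorem theorem3 (q τ β : ℝ) (hq0 : 0 ≤ q) (hq1 : q < 1) (hτ : 0 < τ) (hβ : 1 < β) :
    (∃ γ C₁ δ : ℝ, 0 < γ ∧ 0 < C₁ ∧ 0 < δ ∧ SparseCov.DeviationBound τ γ C₁ δ) ∧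
    (∀ γ C₁ δ : ℝ, 0 < γ → 0 < C₁ → 0 < δ → SparseCov.DeviationBound τ γ C₁ δ →
      ∃ C : ℝ, 0 < C ∧ ∀ (n p : ℕ) (c : ℝ), 1 < n → (n : ℝ) ^ β ≤ p → 0 ≤ c →
        SparseCov.threshold n p γ ≤ δ →
        SparseCov.maxRisk (SparseCov.thresholdEstimator n p γ) q τ c
          ≤ ENNReal.ofReal (C * SparseCov.rate n p q c)) ∧
    (∀ M K : ℝ, 0 < M → 0 < K →
      ∃ c₀ C : ℝ, 0 < c₀ ∧ 0 < C ∧ ∀ (n p : ℕ) (c : ℝ), 1 < n → (n : ℝ) ^ β ≤ p → 0 ≤ c →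
        c ≤ M * (n : ℝ) ^ ((1 - q) / 2) * Real.log p ^ (-((3 - q) / 2)) →
        Real.log p ≤ K * n →
        ENNReal.ofReal (c₀ * SparseCov.rate n p q c) ≤ SparseCov.minimaxRisk n p q τ c ∧
        SparseCov.minimaxRisk n p q τ c ≤ ENNReal.ofReal (C * SparseCov.rate n p q c)) := by
  refine ⟨SparseCov.exists_deviationBound hτ, fun γ C₁ δ hγ hC₁ hδ hdev =>
    SparseCov.maxRisk_thresholdEstimator_le hq0 hq1 hτ hβ hγ hC₁ hδ hdev, fun M K hM hK => ?_⟩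
  obtain ⟨c₀, hc₀, hlow⟩ := SparseCov.le_minimaxRisk hq0 hτ hβ hM hK
  obtain ⟨C, hC, hup⟩ := SparseCov.minimaxRisk_le hq0 hq1 hτ hβ
  exact ⟨c₀, C, hc₀, hC, fun n p c hn hnp hc hcM hpK =>
    ⟨hlow n p c hn hnp hc hcM hpK, hup n p c hn hnp hc⟩⟩
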